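/- **Setting.** Let $L$ be a countable language and $\mathbb M$ an $L$-structure with a pregeometry $\mathrm{cl}$ making it a *quasiminimal pregeometry structure* ($\mathrm{tp}$ = quantifier-free type): (QM1) $\mathrm{tp}(a,b)=\mathrm{tp}(a',b')$ implies $a\in \mathrm{cl}(b)\iff a'\in\mathrm{cl}(b')$ (for singletons $a,a'$ and finite tuples $b,b'$); (QM2) $\mathbb M$ is infinite-dimensional; (QM3) closures of finite sets are countable; (QM4) if $H,H'$ are countable and closed, $\mathrm{tp}(H)=\mathrm{tp}(H')$, $a\notin H$, $a'\notin H'$ are singletons, then $\mathrm{tp}(H,a)=\mathrm{tp}(H',a')$; (QM5) if $H,H'$ are each countable and closed or empty, $\mathrm{tp}(H,b)=\mathrm{tp}(H',b')$ with $b,b'$ finite and $a\in\mathrm{cl}(H,b)$, then $\mathrm{tp}(H,b,a)=\mathrm{tp}(H',b',a')$ for some $a'$. *Models* are the closed infinite-dimensional subsets of $\mathbb M$. Assume $\mathbb M$ is a monster model: for some uncountable $\delta\le|\mathbb M|$, isomorphisms between models of size $<\delta$ extend to automorphisms of $\mathbb M$. *Bounded*, or *small*, means of cardinality $<\delta$;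 sequences are indexed by small sets. $t^g(a/A)$ is the orbit of the finite tuple $a$ under $\mathrm{Aut}(\mathbb M/A)$; the weak type $t(a/A)$ is given by the $t^g(a/B)$, $B\subseteq A$ finite. $b\in \mathrm{bcl}(A)$ iff $t(b/A)$ has boundedly many realizations. $Lt(a/B)=Lt(b/B)$ iff $a,b$ are equivalent for every $A$-invariant equivalence relation with boundedly many classes, for every finite $A\subseteq B$. For finite $A\subseteq B$, $t(a/B)$ *splits* (*Lascar splits*) over $A$ if there are finite tuples $b,c$ in $B$ with $t(b/A)=t(c/A)$ (resp. $Lt(b/A)=Lt(c/A)$) and $t(ab/A)\ne t(ac/A)$. $a\downarrow^{ns}_B C$ means that $t(a/B\cup C)$ does not split over some finite subset of $B$. $a\downarrow_B C$ means: there is a finite $A\subseteq B$ such that for every small $D\supseteq B\cup C$ some $b$ has $t(b/B\cup C)=t(a/B\cup C)$ and $t(b/D)$ does not Lascar split over $A$. For a model $\mathcal A$, $U(a/\mathcal A)\ge n+1$ iff $a\not\downarrow^{ns}_{\mathcal A}\mathcal B$ and $U(a/\mathcal B)\ge n$ for some model $\mathcal B\supseteq\mathcal A$; for $B$ finite $U(a/B)$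 is the maximum of $U(a/\mathcal A)$ over models $\mathcal A\supseteq B$; in general $U(a/A)=\min\{U(a/B):B\subseteq A\text{ finite}\}$; $U(a)=U(a/\emptyset)$. An element of a set of tuples is *generic* (over $A$) if its $U$-rank over $A$ is maximal in the set; if no $A$ is mentioned, $A=\emptyset$. $\mathbb M^{eq}$ consists of the classes $a/E$, $E\in\mathcal E$, for a countable collection $\mathcal E$ of $\emptyset$-invariant equivalence relations on finite powers of $\mathbb M$ that contains equality and the relations coding global types: for each global type $p$ that is the free extension to $\mathbb M$ of the Lascar type of a finite tuple over a finite set, and each finite tuple $a$ over which $p$ does not split, it contains the relation identifying $a_0,a_1$ iff for all finite tuples $c,d$ of equal length and $b\models p$: $\exists d'\,[t(ad')=t(a_0d),\ t(bd')=t(bc)]\iff\exists d'\,[t(ad')=t(a_1d),\ t(bd')=t(bc)]$. The automorphisms of $\mathbb M^{eq}$ are those induced by $\mathrm{Aut}(\mathbb M)$, its models are the $\mathcal A^{eq}$, and $U$ is defined there in the same way. $\alpha=\mathrm{Cb}(a/A)\in\mathbb M^{eq}$ ($A$ finite) means that an automorphism fixes $\alpha$ iff it fixes the free global extension of $Lt(a/A)$.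 For a collection $\mathcal C$ of sets $C\subseteq\mathbb M^n$ ($n\ge1$), a *specialization* $a\to b$ of families $a=(a_i),b=(b_i)$ is a well-defined map $a_i\mapsto b_i$ with $(a_{i_1},\dots,a_{i_n})\in C\Rightarrow(b_{i_1},\dots,b_{i_n})\in C$ for all $C\in\mathcal C$; it is an *isomorphism* if the converse implications hold too. $\mathrm{rk}(a\to b)=\dim(a)-\dim(b)$. *Strongly regular* specializations are generated by: isomorphisms; $a\to a'$ with $a\in\mathbb M$ generic; $aa'\to bb'$ with $a\downarrow_\emptyset a'$ and $a\to b$, $a'\to b'$ strongly regular. *Strongly good* ones: strongly regular ones, and $(a_1,a_2,a_3)\to(a_1',a_2',a_3')$ with $(a_1,a_2)\to(a_1',a_2')$ strongly good, $a_1\to a_1'$ an isomorphism and $a_3\in\mathrm{cl}(a_1)$. A sequence is *indiscernible* over $A$ if all its permutations extend to elements of $\mathrm{Aut}(\mathbb M/A)$, and *strongly indiscernible* if it can be prolonged to indiscernible sequences of every length $\le\delta$. $\mathbb M$ is *Zariski-like* if there is a countable $\mathcal C$ (the *irreducible* sets) such that: (ZL1) each $C\in\mathcal C$ is $\mathrm{Aut}(\mathbb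 M)$-invariant; (ZL2) each finite nonempty tuple is generic in some $C\in\mathcal C$; (ZL3) the generic elements of $C\in\mathcal C$ have the same Galois type; (ZL4) if $a$ is generic in $C\in\mathcal C$ and $a\in D\in\mathcal C$, then $C\subseteq D$; (ZL5) if $(a,b)$ is generic in $C_1\in\mathcal C$, $a$ is generic in $C_2\in\mathcal C$ and $(a',b')\in C_1$, then $a'\in C_2$; (ZL6) $\mathcal C$ is closed under coordinate permutations; (ZL7) if $a\to a'$ is strongly good with $\mathrm{rk}(a\to a')\le1$, and $ab\to a'b'$, $ac\to a'c'$, then there is $b^*$ with $b^*\downarrow_a c$, $t^g(b^*/a)=t^g(b/a)$ and $ab^*c\to a'b'c'$; (ZL8) if $(a_i)_{i\in I}$ is independent and strongly indiscernible over $b$, $(a_i')_{i\in I}$ is strongly indiscernible over $b'$, $a_ib\to a_i'b'$ for all $i$, and $b\to b'$ is strongly good with $\mathrm{rk}(b\to b')\le1$, then $(ba_i)_{i\in I}\to(b'a_i')_{i\in I}$; (ZL9) let $(a_i)_{i<\kappa}\to(b_i)_{i<\kappa}$ be a specialization of sequences of singletons with $a_0\ne a_1$, $b_0=b_1$, and let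 $S$ be a cofinal directed family of finite subsets of $\kappa$, all containing $0,1$, such that whenever $X\subseteq Y$ are in $S$, $(a_i)_{i\in Y}\to(c_i)_{i\in Y}\to(b_i)_{i\in Y}$, $c_0=c_1$ and $\mathrm{rk}((a_i)_{Y}\to(c_i)_{Y})\le1$, also $\mathrm{rk}((a_i)_{X}\to(c_i)_{X})\le1$. Then there is $(c_i)_{i<\kappa}$ with $(a_i)_{i<\kappa}\to(c_i)_{i<\kappa}\to(b_i)_{i<\kappa}$, $c_0=c_1$ and $\mathrm{rk}((a_i)_X\to(c_i)_X)\le1$ for all $X\in S$. Let $E\subseteq\mathbb M^n$ and $C\subseteq\mathbb M^2\times E$ be irreducible, $C(e)=\{(x,y):(x,y,e)\in C\}$. $C$ is a *family of plane curves* parametrized by $E$ if $E$ has a generic element and for every generic $e\in E$ there is $(x,y)$ with $(x,y,e)$ generic in $C$, and the generic points of $C(e)$ over $e$ have $U$-rank $1$ over $e$. It is *relevant* if $x,y\notin\mathrm{bcl}(e)$ for $e\in E$ generic and $(x,y)\in C(e)$ generic over $e$. Its *rank* is $U(\mathrm{Cb}(x,y/e))$ for such $e,(x,y)$. **Lemma.**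 Let $\mathbb M$ be a Zariski-like structure (with $\mathbb M$ and $\mathcal E$ as above). If every relevant family of plane curves on $\mathbb M$ has rank at most $1$, then $\mathbb M$ is locally modular: $\dim(Y\cup Z)+\dim(Y\cap Z)=\dim Y+\dim Z$ for all finite-dimensional closed $Y,Z$ with $\dim(Y\cap Z)>0$. Equivalently, if $\mathbb M$ is not locally modular, there is a relevant family of plane curves on $\mathbb M$ of rank at least $2$. -/

import Mathlib

open Set Cardinal
open scoped FirstOrder

universe u v w x

namespace ZL

/-! ## Types, independence and U-rank in a homogeneous universe

A `Universe` is a set `X` together with its automorphisms and the collection of its submodels.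
The notions below are used twice: for the monster model and for its expansion by imaginaries. -/

structure Universe (X : Type u) where
  Aut : Type w
  act : Aut → X → X
  IsModel : Set X → Prop

namespace Universe

variable {X : Type u} (S : Universe.{u, w} X)

/-- Equality of Galois types over `A` : some automorphism fixing `A` pointwise maps `a` to `b`. -/
def SameGalois (A : Set X) {n : ℕ} (a b : Fin n → X) : Prop :=
  ∃ g : S.Aut, (∀ y ∈ A, S.act g y = y) ∧ ∀ i, S.act g (a i) = b i

/-- Equality of weak types, `t(a/A) = t(b/A)`. -/
def SameType (A : Set X) {n : ℕ} (a b : Fin n → X) : Prop :=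
  ∀ B : Set X, B ⊆ A → B.Finite → S.SameGalois B a b

/-- `t(a/B)` splits over `A`. -/
def Splits {n : ℕ} (a : Fin n → X) (B A : Set X) : Prop :=
  ∃ (m : ℕ) (b c : Fin m → X), range b ⊆ B ∧ range c ⊆ B ∧
    S.SameType A b c ∧ ¬ S.SameType A (Fin.append a b) (Fin.append a c)

/-- Independence in the sense of non-splitting, of `a` from `C` over `B`. -/
def IndepNS {n : ℕ} (a : Fin n → X) (B C : Set X) : Prop :=
  ∃ A : Set X, A ⊆ B ∧ A.Finite ∧ ¬ S.Splits a (B ∪ C) A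

/-- `U(a/𝒜) ≥ k` for a model `𝒜`. -/
def UGe {n : ℕ} (a : Fin n → X) : ℕ → Set X → Prop
  | 0, _ => True
  | k + 1, 𝒜 => ∃ ℬ : Set X, S.IsModel ℬ ∧ 𝒜 ⊆ ℬ ∧ ¬ S.IndepNS a 𝒜 ℬ ∧ UGe a k ℬ

/-- `U(a/𝒜)` for a model `𝒜` : the largest `k` with `U(a/𝒜) ≥ k`. -/
noncomputable def UModel {n : ℕ} (a : Fin n → X) (𝒜 : Set X) : ℕ∞ :=
  ⨆ (k : ℕ) (_ : S.UGe a k 𝒜), (k : ℕ∞)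

/-- `U(a/B)` for a finite set `B` : the maximum of `U(a/𝒜)` over the models `𝒜 ⊇ B`. -/
noncomputable def UFin {n : ℕ} (a : Fin n → X) (B : Set X) : ℕ∞ :=
  ⨆ (𝒜 : Set X) (_ : S.IsModel 𝒜) (_ : B ⊆ 𝒜), S.UModel a 𝒜

/-- `U(a/A)` for an arbitrary set `A` : the minimum of `U(a/B)` over the finite `B ⊆ A`. -/
noncomputable def U {n : ℕ} (a : Fin n → X) (A : Set X) : ℕ∞ :=
  ⨅ (B : Set X) (_ : B ⊆ A) (_ : B.Finite), S.UFin a B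

/-- `b` is a generic element of `B` over `A` : it has maximal U-rank over `A` in `B`. -/
def IsGeneric {n : ℕ} (B : Set (Fin n → X)) (A : Set X) (b : Fin n → X) : Prop :=
  b ∈ B ∧ ∀ c ∈ B, S.U c A ≤ S.U b A

/-- `(a i)` is indiscernible over `A` : every permutation of it extends to an automorphism
over `A`. -/
def Indiscernible {I : Type u} {m : ℕ} (a : I → Fin m → X) (A : Set X) : Prop :=
  ∀ σ : Equiv.Perm I, ∃ g : S.Aut,
    (∀ y ∈ A, S.act g y = y) ∧ ∀ i k, S.act g (a i k) = a (σ i) k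

/-! In what follows `δ` is the homogeneity cardinal of the universe; a set is bounded (or small)
if it has fewer than `δ` elements. -/

variable (δ : Cardinal.{u})

/-- The bounded closure: `t(b/A)` has only boundedly many realizations. -/
def bcl (A : Set X) : Set X :=
  {b | #{c : X | S.SameType A ![b] ![c]} < δ}

/-- `E` is an `A`-invariant equivalence relation with boundedly many classes. -/
def IsBoundedInvariant (A : Set X) {n : ℕ} (E : Setoid (Fin n → X)) : Prop :=
  (∀ g : S.Aut, (∀ y ∈ A, S.act g y = y) →
    ∀ a b, E.r a b → E.r (fun i => S.act g (a i)) (fun i => S.act g (b i))) ∧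
  #(Quotient E) < δ

/-- Equality of Lascar types, `Lt(a/B) = Lt(b/B)`. -/
def SameLascar (B : Set X) {n : ℕ} (a b : Fin n → X) : Prop :=
  ∀ A : Set X, A ⊆ B → A.Finite →
    ∀ E : Setoid (Fin n → X), S.IsBoundedInvariant δ A E → E.r a b

/-- `t(a/B)` Lascar splits over `A`. -/
def LascarSplits {n : ℕ} (a : Fin n → X) (B A : Set X) : Prop :=
  ∃ (m : ℕ) (b c : Fin m → X), range b ⊆ B ∧ range c ⊆ B ∧
    S.SameLascar δ A b c ∧ ¬ S.SameType A (Fin.append a b) (Fin.append a c)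

/-- `a ↓_B C` : `a` is free from `C` over `B`. As always in a monster model, the sets `D` range
over the small subsets of the universe. -/
def Indep {n : ℕ} (a : Fin n → X) (B C : Set X) : Prop :=
  ∃ A : Set X, A ⊆ B ∧ A.Finite ∧
    ∀ D : Set X, B ∪ C ⊆ D → #D < δ →
      ∃ b : Fin n → X, S.SameType (B ∪ C) b a ∧ ¬ S.LascarSplits δ b D A

/-- The sequence `(a i)` is independent over `A`. -/
def IndepSeq {I : Type u} {m : ℕ} (a : I → Fin m → X) (A : Set X) : Prop :=
  ∀ i, S.Indep δ (a i) A (⋃ (j : I) (_ : j ≠ i), range (a j))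

/-- `(a i)` is strongly indiscernible over `A` : it can be prolonged to indiscernible sequences
over `A` of any length (that the monster model can be relied on to contain). -/
def StronglyIndiscernible {I : Type u} {m : ℕ} (a : I → Fin m → X) (A : Set X) : Prop :=
  ∀ (J : Type u) (ι : I ↪ J), #J ≤ δ →
    ∃ a' : J → Fin m → X, (∀ i, a' (ι i) = a i) ∧ S.Indiscernible a' A

/-! ### Global types and canonical bases -/

/-- A global type in the variables `Fin n` : a coherent choice of a Galois type (given as its set
of realizations) over each finite set. The values on infinite sets play no role. -/
def IsGlobalType {n : ℕ} (p : Set X → Set (Fin n → X)) : Prop :=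
  (∀ D : Set X, D.Finite → ∃ y, ∀ z, z ∈ p D ↔ S.SameGalois D y z) ∧
  ∀ D D' : Set X, D'.Finite → D ⊆ D' → p D' ⊆ p D

/-- `p` is the type over the whole universe of a realization of `Lt(a/A)` which is free from the
universe over `A`. Such a realization lives in a larger model; this is expressed through the
restrictions of `p` to finite sets, which are realized in the universe. -/
def IsFreeExt {n : ℕ} (p : Set X → Set (Fin n → X)) (a : Fin n → X) (A : Set X) : Prop :=
  S.IsGlobalType p ∧
  ∀ D : Set X, D.Finite → ∃ y ∈ p D, S.SameLascar δ A y a ∧ S.Indep δ y A D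

/-- `g(p) = p`. -/
def FixesType {n : ℕ} (g : S.Aut) (p : Set X → Set (Fin n → X)) : Prop :=
  ∀ D : Set X, D.Finite → ∀ y ∈ p D, (fun i => S.act g (y i)) ∈ p (S.act g '' D)

/-- The global type `p` does not split over the finite tuple `a`. -/
def NonSplitOver {n k : ℕ} (p : Set X → Set (Fin n → X)) (a : Fin k → X) : Prop :=
  ∀ (m : ℕ) (c d : Fin m → X), S.SameType (range a) c d →
    ∀ y ∈ p (range a ∪ range c ∪ range d),
      S.SameType (range a) (Fin.append y c) (Fin.append y d)

/-- `t(bc/∅) = t(bd/∅)` for a realization `b` of `p`. -/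
def SameOver {n m : ℕ} (p : Set X → Set (Fin n → X)) (c d : Fin m → X) : Prop :=
  ∀ y ∈ p (range c ∪ range d), S.SameType ∅ (Fin.append y c) (Fin.append y d)

/-- For `p` not splitting over `a` and `b` realizing `p`, there are types `q_i` over `∅` such that
`bd` realizes `t(bc/∅)` iff `ad` realizes some `q_i`. This says that `a₀d` realizes some `q_i`. -/
def Coded {n k m : ℕ} (p : Set X → Set (Fin n → X)) (a : Fin k → X) (c : Fin m → X)
    (a₀ : Fin k → X) (d : Fin m → X) : Prop :=
  ∃ d' : Fin m → X, S.SameType ∅ (Fin.append a d') (Fin.append a₀ d) ∧ S.SameOver p d' c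

/-- The equivalence relation coding `p` : the class of `a` is a canonical base of `p`. -/
def codeRel {n k : ℕ} (p : Set X → Set (Fin n → X)) (a : Fin k → X) : Setoid (Fin k → X) where
  r a₀ a₁ := ∀ (m : ℕ) (c d : Fin m → X), S.Coded p a c a₀ d ↔ S.Coded p a c a₁ d
  iseqv :=
    ⟨fun _ _ _ _ => Iff.rfl, fun h m c d => (h m c d).symm,
      fun h h' m c d => (h m c d).trans (h' m c d)⟩

end Universe

/-! ## Pregeometries -/

structure IsPregeometry {M : Type u} (cl : ClosureOperator (Set M)) : Prop where
  finite_char : ∀ (A : Set M) (a : M), a ∈ cl A → ∃ B ⊆ A, B.Finite ∧ a ∈ cl B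
  exchange : ∀ (A : Set M) (a b : M), a ∈ cl (insert b A) → a ∉ cl A → b ∈ cl (insert a A)

def IsIndepSet {M : Type u} (cl : ClosureOperator (Set M)) (I : Set M) : Prop :=
  ∀ y ∈ I, y ∉ cl (I \ {y})

/-- The dimension of a set in a pregeometry: the supremum of the sizes of its independent
subsets. -/
noncomputable def dim {M : Type u} (cl : ClosureOperator (Set M)) (Y : Set M) : ℕ∞ :=
  ⨆ (I : Set M) (_ : I ⊆ Y) (_ : IsIndepSet cl I), I.encard

/-- Local modularity: the modular law for dimensions holds for any two finite-dimensional closed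
sets whose intersection has positive dimension. -/
def LocallyModular {M : Type u} (cl : ClosureOperator (Set M)) : Prop :=
  ∀ Y Z : Set M, cl Y = Y → cl Z = Z → dim cl Y ≠ ⊤ → dim cl Z ≠ ⊤ → dim cl (Y ∩ Z) ≠ 0 →
    dim cl (Y ∪ Z) + dim cl (Y ∩ Z) = dim cl Y + dim cl Z

/-! ## Quasiminimal pregeometry structures -/

section Structure

variable (L : FirstOrder.Language.{v, w}) {M : Type u} [L.Structure M]

/-- Equality of quantifier-free types of two families with the same index set. -/
def SameQF {ι : Type x} (a b : ι → M) : Prop :=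
  ∀ φ : L.Formula ι, FirstOrder.Language.BoundedFormula.IsQF φ → (φ.Realize a ↔ φ.Realize b)

/-- Quasiminimal pregeometry structures. Two countable sets `H`, `H'` enumerated with the same
quantifier-free type are given as `H` and a map `h : H → M` with range `H'`. -/
structure IsQuasiminimal (cl : ClosureOperator (Set M)) : Prop where
  countable_language : L.card ≤ ℵ₀
  pregeometry : IsPregeometry cl
  qm1 : ∀ (n : ℕ) (a a' : M) (b b' : Fin n → M),
    SameQF L (Fin.snoc b a : Fin (n + 1) → M) (Fin.snoc b' a' : Fin (n + 1) → M) →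
      (a ∈ cl (range b) ↔ a' ∈ cl (range b'))
  qm2 : dim cl univ = ⊤
  qm3 : ∀ A : Set M, A.Finite → (cl A).Countable
  qm4 : ∀ (H : Set M) (h : H → M), H.Countable → cl H = H → cl (range h) = range h →
    SameQF L (Subtype.val : H → M) h →
      ∀ a a' : M, a ∉ H → a' ∉ range h →
        SameQF L (Sum.elim (Subtype.val : H → M) ![a]) (Sum.elim h ![a'])
  qm5 : ∀ (H : Set M) (h : H → M), H.Countable → (cl H = H ∨ H = ∅) →
    (cl (range h) = range h ∨ range h = ∅) →
      ∀ (n : ℕ) (b b' : Fin n → M),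
        SameQF L (Sum.elim (Subtype.val : H → M) b) (Sum.elim h b') →
          ∀ a ∈ cl (H ∪ range b), ∃ a' : M,
            SameQF L (Sum.elim (Subtype.val : H → M) (Fin.snoc b a : Fin (n + 1) → M))
              (Sum.elim h (Fin.snoc b' a' : Fin (n + 1) → M))

/-- The structure `M` as a universe; its models are the infinite-dimensional closed subsets. -/
def monster (cl : ClosureOperator (Set M)) : Universe.{u, u} M where
  Aut := M ≃[L] M
  act g y := g y
  IsModel A := cl A = A ∧ dim cl A = ⊤

/-- `M` is a monster model for its quasiminimal class: it is quasiminimal and, for an uncountable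
cardinal `δ`, it has at least `δ` elements and is `δ`-model homogeneous, that is, isomorphisms
between models of size less than `δ` in `M` extend to automorphisms of `M`. -/
structure IsMonster (cl : ClosureOperator (Set M)) (δ : Cardinal.{u}) : Prop where
  quasiminimal : IsQuasiminimal L cl
  uncountable : ℵ₀ < δ
  le_card : δ ≤ #M
  homogeneous : ∀ (A : Set M) (h : A → M),
    (monster L cl).IsModel A → (monster L cl).IsModel (range h) → #A < δ →
      SameQF L (Subtype.val : A → M) h → ∃ g : M ≃[L] M, ∀ a : A, g a = h a

/-! ## Imaginaries -/

/-- A countable collection of `∅`-invariant equivalence relations on finite powers of `M`,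
containing equality. -/
structure ImagSystem (M : Type u) [L.Structure M] where
  rel : ∀ n : ℕ, Set (Setoid (Fin n → M))
  countable : ∀ n, (rel n).Countable
  invariant : ∀ n, ∀ E ∈ rel n, ∀ (g : M ≃[L] M) (a b : Fin n → M),
    E.r a b → E.r (fun i => g (a i)) (fun i => g (b i))
  eq_mem : (⊥ : Setoid (Fin 1 → M)) ∈ rel 1

variable {L}

/-- The elements `a/E` of `M^eq`. -/
def ImagSystem.Meq (𝓔 : ImagSystem L M) : Type u :=
  Σ n : ℕ, Σ E : 𝓔.rel n, Quotient E.1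

/-- `M^eq` as a universe. Its automorphisms are those induced by the automorphisms of `M`, and its
models are the sets `𝒜^eq` for the models `𝒜` of `M`. -/
def ImagSystem.eqUniverse (𝓔 : ImagSystem L M) (cl : ClosureOperator (Set M)) :
    Universe.{u, u} 𝓔.Meq where
  Aut := M ≃[L] M
  act g := fun ⟨n, E, q⟩ =>
    ⟨n, E, Quotient.map (fun a i => g (a i)) (fun a b h => 𝓔.invariant n E.1 E.2 g a b h) q⟩
  IsModel B := ∃ A : Set M, (monster L cl).IsModel A ∧
    B = {y | ∃ (n : ℕ) (E : 𝓔.rel n) (a : Fin n → M), range a ⊆ A ∧ y = ⟨n, E, Quotient.mk _ a⟩}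

/-- The collection contains the equivalence relations that code the global types. -/
def ImagSystem.CodesTypes (𝓔 : ImagSystem L M) (cl : ClosureOperator (Set M))
    (δ : Cardinal.{u}) : Prop :=
  ∀ (n k : ℕ) (p : Set M → Set (Fin n → M)) (y : Fin n → M) (A : Set M) (a : Fin k → M),
    A.Finite → (monster L cl).IsFreeExt δ p y A → (monster L cl).NonSplitOver p a →
      (monster L cl).codeRel p a ∈ 𝓔.rel k

/-- `α = Cb(a/A)` : `α` is a canonical base of the free global extension of `Lt(a/A)`. -/
def ImagSystem.IsCb (𝓔 : ImagSystem L M) (cl : ClosureOperator (Set M)) (δ : Cardinal.{u})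
    (α : 𝓔.Meq) {n : ℕ} (a : Fin n → M) (A : Set M) : Prop :=
  ∃ p : Set M → Set (Fin n → M), (monster L cl).IsFreeExt δ p a A ∧
    ∀ g : M ≃[L] M, (monster L cl).FixesType g p ↔ (𝓔.eqUniverse cl).act g α = α

end Structure

/-! ## Specializations -/

section Specialization

variable {M : Type u} (𝒞 : ∀ n : ℕ, Set (Set (Fin n → M)))

/-- `a → b` : the assignment `a i ↦ b i` is a well-defined map and a specialization with respect
to `𝒞`. -/
def Spec {ι : Type x} (a b : ι → M) : Prop :=
  (∀ i j, a i = a j → b i = b j) ∧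
  ∀ (n : ℕ) (s : Fin n → ι), ∀ C ∈ 𝒞 n, (fun k => a (s k)) ∈ C → (fun k => b (s k)) ∈ C

def SpecIso {ι : Type x} (a b : ι → M) : Prop :=
  Spec 𝒞 a b ∧
  ∀ (n : ℕ) (s : Fin n → ι), ∀ C ∈ 𝒞 n, (fun k => b (s k)) ∈ C → (fun k => a (s k)) ∈ C

/-- `rk(a → b) ≤ 1`, where `rk(a → b) = dim(a/∅) - dim(b/∅)`. -/
def RkLeOne (cl : ClosureOperator (Set M)) {ι : Type x} (a b : ι → M) : Prop :=
  dim cl (range a) ≤ dim cl (range b) + 1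

variable (S : Universe.{u, u} M) (δ : Cardinal.{u}) (cl : ClosureOperator (Set M))

inductive StronglyRegular : ∀ {n : ℕ}, (Fin n → M) → (Fin n → M) → Prop
  | iso {n : ℕ} (a b : Fin n → M) : SpecIso 𝒞 a b → StronglyRegular a b
  | generic (a b : M) : Spec 𝒞 ![a] ![b] → S.IsGeneric (univ : Set (Fin 1 → M)) ∅ ![a] →
      StronglyRegular ![a] ![b]
  | append {n m : ℕ} (a b : Fin n → M) (a' b' : Fin m → M) :
      Spec 𝒞 (Fin.append a a') (Fin.append b b') → S.Indep δ a ∅ (range a') →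
      StronglyRegular a b → StronglyRegular a' b' →
      StronglyRegular (Fin.append a a') (Fin.append b b')

inductive StronglyGood : ∀ {n : ℕ}, (Fin n → M) → (Fin n → M) → Prop
  | regular {n : ℕ} (a b : Fin n → M) : StronglyRegular 𝒞 S δ a b → StronglyGood a b
  | extend {n m k : ℕ} (a₁ b₁ : Fin n → M) (a₂ b₂ : Fin m → M) (a₃ b₃ : Fin k → M) :
      Spec 𝒞 (Fin.append (Fin.append a₁ a₂) a₃) (Fin.append (Fin.append b₁ b₂) b₃) →
      StronglyGood (Fin.append a₁ a₂) (Fin.append b₁ b₂) →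
      SpecIso 𝒞 a₁ b₁ → range a₃ ⊆ cl (range a₁) →
      StronglyGood (Fin.append (Fin.append a₁ a₂) a₃) (Fin.append (Fin.append b₁ b₂) b₃)

end Specialization

/-! ## Zariski-like structures -/

section ZariskiLike

variable (L : FirstOrder.Language.{v, w}) {M : Type u} [L.Structure M]

/-- `M` is Zariski-like, as witnessed by the collection `𝒞` of irreducible sets (`𝒞 n` consists of
subsets of `M^n`, `n ≥ 1`). Index sets of sequences are small. In `zl8` the sequences are strongly
indiscernible, which makes the axiom weaker than for indiscernible sequences. -/
structure IsZariskiLike (cl : ClosureOperator (Set M)) (δ : Cardinal.{u})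
    (𝒞 : ∀ n : ℕ, Set (Set (Fin n → M))) : Prop where
  positive : 𝒞 0 = ∅
  countable : ∀ n, (𝒞 n).Countable
  zl1 : ∀ n, ∀ C ∈ 𝒞 n, ∀ g : M ≃[L] M, (fun (a : Fin n → M) i => g (a i)) '' C = C
  zl2 : ∀ n, 0 < n → ∀ a : Fin n → M, ∃ C ∈ 𝒞 n, (monster L cl).IsGeneric C ∅ a
  zl3 : ∀ n, ∀ C ∈ 𝒞 n, ∀ a b : Fin n → M, (monster L cl).IsGeneric C ∅ a →
    (monster L cl).IsGeneric C ∅ b → (monster L cl).SameGalois ∅ a b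
  zl4 : ∀ n, ∀ C ∈ 𝒞 n, ∀ D ∈ 𝒞 n, ∀ a : Fin n → M,
    (monster L cl).IsGeneric C ∅ a → a ∈ D → C ⊆ D
  zl5 : ∀ n m, ∀ C₁ ∈ 𝒞 (n + m), ∀ C₂ ∈ 𝒞 n, ∀ (a a' : Fin n → M) (b b' : Fin m → M),
    (monster L cl).IsGeneric C₁ ∅ (Fin.append a b) → (monster L cl).IsGeneric C₂ ∅ a →
      Fin.append a' b' ∈ C₁ → a' ∈ C₂
  zl6 : ∀ n, ∀ C ∈ 𝒞 n, ∀ σ : Equiv.Perm (Fin n), (fun a : Fin n → M => a ∘ σ) '' C ∈ 𝒞 n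
  zl7 : ∀ (n m k : ℕ) (a a' : Fin n → M) (b b' : Fin m → M) (c c' : Fin k → M),
    StronglyGood 𝒞 (monster L cl) δ cl a a' → RkLeOne cl a a' →
      Spec 𝒞 (Fin.append a b) (Fin.append a' b') → Spec 𝒞 (Fin.append a c) (Fin.append a' c') →
        ∃ bs : Fin m → M, (monster L cl).Indep δ bs (range a) (range c) ∧
          (monster L cl).SameGalois (range a) bs b ∧
          Spec 𝒞 (Fin.append (Fin.append a bs) c) (Fin.append (Fin.append a' b') c')
  zl8 : ∀ (I : Type u) (n m : ℕ) (a a' : I → Fin m → M) (b b' : Fin n → M), #I < δ →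
    (monster L cl).IndepSeq δ a (range b) →
    (monster L cl).StronglyIndiscernible δ a (range b) →
    (monster L cl).StronglyIndiscernible δ a' (range b') →
    (∀ i, Spec 𝒞 (Fin.append (a i) b) (Fin.append (a' i) b')) →
    StronglyGood 𝒞 (monster L cl) δ cl b b' → RkLeOne cl b b' →
      Spec 𝒞 (Sum.elim b (fun q : I × Fin m => a q.1 q.2))
        (Sum.elim b' (fun q : I × Fin m => a' q.1 q.2))
  zl9 : ∀ (K : Type u) (k₀ k₁ : K) (a b : K → M), #K < δ → a k₀ ≠ a k₁ → b k₀ = b k₁ →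
    Spec 𝒞 a b →
    ∀ 𝒮 : Set (Finset K), (∀ X : Finset K, ∃ Y ∈ 𝒮, X ⊆ Y) → DirectedOn (· ⊆ ·) 𝒮 →
      (∀ X ∈ 𝒮, k₀ ∈ X ∧ k₁ ∈ X) →
      (∀ X ∈ 𝒮, ∀ Y ∈ 𝒮, X ⊆ Y → ∀ c : K → M, c k₀ = c k₁ →
        Spec 𝒞 (fun i : Y => a i) (fun i : Y => c i) →
        Spec 𝒞 (fun i : Y => c i) (fun i : Y => b i) →
        RkLeOne cl (fun i : Y => a i) (fun i : Y => c i) →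
          RkLeOne cl (fun i : X => a i) (fun i : X => c i)) →
      ∃ c : K → M, Spec 𝒞 a c ∧ Spec 𝒞 c b ∧ c k₀ = c k₁ ∧
        ∀ X ∈ 𝒮, RkLeOne cl (fun i : X => a i) (fun i : X => c i)

/-! ## Families of plane curves -/

variable (cl : ClosureOperator (Set M)) (δ : Cardinal.{u})

/-- The fibre `C(e)` for `C ⊆ M² × M^n`. -/
def fiber {n : ℕ} (C : Set (Fin (2 + n) → M)) (e : Fin n → M) : Set (Fin 2 → M) :=
  {q | Fin.append q e ∈ C}

/-- `e` is good for `C`. -/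
def IsGood {n : ℕ} (C : Set (Fin (2 + n) → M)) (e : Fin n → M) : Prop :=
  ∃ q : Fin 2 → M, (monster L cl).IsGeneric C ∅ (Fin.append q e)

/-- `C ⊆ M² × E` is a family of plane curves parametrized by `E`. -/
structure IsFamily (𝒞 : ∀ n : ℕ, Set (Set (Fin n → M))) {n : ℕ}
    (E : Set (Fin n → M)) (C : Set (Fin (2 + n) → M)) : Prop where
  irreducible_base : E ∈ 𝒞 n
  irreducible : C ∈ 𝒞 (2 + n)
  subset : ∀ (q : Fin 2 → M) (e : Fin n → M), Fin.append q e ∈ C → e ∈ E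
  exists_generic : ∃ e, (monster L cl).IsGeneric E ∅ e
  good : ∀ e, (monster L cl).IsGeneric E ∅ e → IsGood L cl C e
  curve : ∀ e, (monster L cl).IsGeneric E ∅ e → ∀ q,
    (monster L cl).IsGeneric (fiber C e) (range e) q → (monster L cl).U q (range e) = 1

def IsRelevant {n : ℕ} (E : Set (Fin n → M)) (C : Set (Fin (2 + n) → M)) : Prop :=
  ∀ e, (monster L cl).IsGeneric E ∅ e → ∀ q,
    (monster L cl).IsGeneric (fiber C e) (range e) q →
      q 0 ∉ (monster L cl).bcl δ (range e) ∧ q 1 ∉ (monster L cl).bcl δ (range e)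

variable {L}

/-- The family has rank `r` : `Cb(x,y/e)` has U-rank `r` over `∅` in `M^eq`, for generic `e ∈ E` and
generic `(x,y) ∈ C(e)`. -/
def HasRank (𝓔 : ImagSystem L M) {n : ℕ} (E : Set (Fin n → M)) (C : Set (Fin (2 + n) → M))
    (r : ℕ) : Prop :=
  (∃ e q α, (monster L cl).IsGeneric E ∅ e ∧
    (monster L cl).IsGeneric (fiber C e) (range e) q ∧ 𝓔.IsCb cl δ α q (range e)) ∧
  ∀ e q α, (monster L cl).IsGeneric E ∅ e →
    (monster L cl).IsGeneric (fiber C e) (range e) q → 𝓔.IsCb cl δ α q (range e) →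
      (𝓔.eqUniverse cl).U ![α] ∅ = (r : ℕ∞)

end ZariskiLike

end ZL

/-!
# Non-locally modular Zariski-like structures have plane curve families of rank two

Suppose that the pregeometry is not locally modular. By exchange arguments
(`ZL.exists_of_not_locallyModular`) there are a finite set `A` of parameters, a point `p ∈ A`
outside `cl ∅` and points `a, b ∉ cl A`, interdependent over `A`, such that `a ∉ cl {b, d, p}` for
all `d ∈ cl A`. After enlarging `A` inside a model that is free from `{a, b}`, the type of `(a, b)`
over `A` is stationary (`ZL.exists_stationary`). With `e` an enumeration of `A`, the irreducible
sets in which `e` and `(a, b, e)` are generic form a relevant family of plane curves, and all its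
generic curves are conjugate (`ZL.IsGenericCurve.exists_aut`). The free global extension of the type
of `(a, b)` over `A` is explicit (`ZL.freeType`), it is the only one (`ZL.IsFreeExt.eq_freeType`),
and it does not split over `e`, so that a code `α` for it in `M^eq` is a canonical base
(`ZL.codeRel_iff_fixesType`). It remains to see that `α` has finite U-rank at least two.

Let `P` be the stabilizer of `α`, that is, of the free extension, and let `m` be the maximum over
`g ∈ P` of the dimension of `g A` over `A`.

* *The orbit of `A` under `P` is small* (`ZL.IsStabilizer.exists_add_two_le`): the dimension of `A`
  over `∅` is at least `m + 2`. Conjugates `h A` with `h ∈ P`, of dimension `m` over everything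
  relevant, are again bases for the curve. If some `g ∈ P` maps `a` to `p`, then `d = g b` is in
  `cl A`, and if `A` had dimension at most `m + 1`, counting dimensions over `h A` would give
  `a ∈ cl {b, d, p}`. If there is no such `g`, then `p` is algebraic over each conjugate `h A`, and
  the same count gives `a ∈ cl {b, p}`.
* *U-rank is codimension of the orbit* (`ZL.ImagSystem.le_U`): the U-rank of `α` is at least the
  dimension of `A` minus `m`. Start with a model `𝒜` free from `A` and add the elements of `A` one
  by one. The dimension which conjugates of `A` under `P` attain over all finite subsets of the
  model falls from the dimension of `A` to at most `m`; it falls by at most one in each step, and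
  not at all if `α` is independent from the new model over the old one, because then finite subsets
  of the new model can be moved into the old one by elements of `P`.
* *U-rank is finite* (`ZL.ImagSystem.U_le_rk`): independence of `e` implies independence of `α`.

All this rests on the homogeneity of the monster model: partial isomorphisms consisting of a
countable closed part and a finite part extend to automorphisms (`ZL.PartIso.exists_aut`), by
back-and-forth with the axioms `qm4` and `qm5`. It makes dimension the U-rank of real tuples
(`ZL.U_eq`), provides free conjugates over small sets (`ZL.exists_free`), and allows moving finite
sets into models (`ZL.exists_aut_subset_model`).
-/

namespace ZL

/-! ### Dimension in a pregeometry -/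

section Pregeometry

variable {M : Type u} {cl : ClosureOperator (Set M)}

theorem subset_cl (cl : ClosureOperator (Set M)) (A : Set M) : A ⊆ cl A := cl.le_closure A

theorem cl_mono (cl : ClosureOperator (Set M)) {A B : Set M} (h : A ⊆ B) : cl A ⊆ cl B :=
  cl.monotone h

theorem cl_subset_iff (cl : ClosureOperator (Set M)) {A B : Set M} : cl A ⊆ cl B ↔ A ⊆ cl B :=
  ⟨fun h => (subset_cl cl A).trans h, fun h => by
    have := cl_mono cl h
    rwa [cl.idempotent] at this⟩

theorem cl_insert_eq {A : Set M} {x : M} (h : x ∈ cl A) : cl (insert x A) = cl A :=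
  Subset.antisymm ((cl_subset_iff cl).2 (insert_subset h (subset_cl cl A)))
    (cl_mono cl (subset_insert _ _))

theorem cl_union_congr {A B : Set M} (h : cl A = cl B) (C : Set M) : cl (A ∪ C) = cl (B ∪ C) := by
  have key : ∀ {A B : Set M}, cl A = cl B → cl (A ∪ C) ⊆ cl (B ∪ C) := fun {A B} h =>
    (cl_subset_iff cl).2 (union_subset
      (((subset_cl cl A).trans h.le).trans (cl_mono cl subset_union_left))
      (subset_union_right.trans (subset_cl cl _)))
  exact Subset.antisymm (key h) (key h.symm)

theorem IsIndepSet.insert {I : Set M} (hcl : IsPregeometry cl) (hI : IsIndepSet cl I) {x : M}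
    (hx : x ∉ cl I) : IsIndepSet cl (insert x I) := by
  have hxI : x ∉ I := fun h => hx (subset_cl cl I h)
  rintro y (rfl | hy) h
  · rw [insert_sdiff_self_of_notMem hxI] at h
    exact hx h
  · have hne : x ≠ y := fun h => hxI (h ▸ hy)
    rw [insert_sdiff_of_notMem _ (by simpa using hne)] at h
    have := hcl.exchange _ _ _ h (hI y hy)
    rw [insert_sdiff_singleton, insert_eq_of_mem hy] at this
    exact hx this

/-- The matroid of a pregeometry. -/
def matroid (hcl : IsPregeometry cl) : Matroid M :=
  (IndepMatroid.ofFinitary univ (IsIndepSet cl) (fun y hy => hy.elim)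
    (fun I J hJ hIJ y hy h => hJ y (hIJ hy) (cl_mono cl (sdiff_subset_sdiff_left hIJ) h))
    (fun I B hI hImax hB => by
      by_contra! hcon
      have h1 : B ⊆ cl I := fun x hx => by
        by_contra hxI
        exact hcon x ⟨hx, fun h => hxI (subset_cl cl I h)⟩ (hI.insert hcl hxI)
      refine hImax ⟨hI, fun J hJ hIJ x hx => ?_⟩
      by_contra hxI
      have hxcl : x ∈ cl B := by
        by_contra hxB
        exact hxB (subset_cl cl B (hB.2 (hB.1.insert hcl hxB) (subset_insert _ _)
          (mem_insert _ _)))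
      refine hJ x hx (cl_mono cl ?_ ((cl_subset_iff cl).2 h1 hxcl))
      exact fun y hy => show y ∈ J \ {x} from ⟨hIJ hy, fun h => hxI (h ▸ hy)⟩)
    (fun I hI y hy h => by
      obtain ⟨B, hB, hfin, hyB⟩ := hcl.finite_char _ _ h
      refine hI (insert y B) (insert_subset hy (hB.trans sdiff_subset)) (hfin.insert y) y
        (mem_insert _ _) (cl_mono cl
          (fun z hz => show z ∈ insert y B \ {y} from ⟨mem_insert_of_mem _ hz, (hB hz).2⟩) hyB))
    (fun _ _ => subset_univ _)).matroid

theorem matroid_indep (hcl : IsPregeometry cl) (I : Set M) :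
    (matroid hcl).Indep I ↔ IsIndepSet cl I := Iff.rfl

theorem dim_eq_eRk (hcl : IsPregeometry cl) (Y : Set M) : dim cl Y = (matroid hcl).eRk Y := by
  refine le_antisymm (iSup_le fun I => iSup_le fun h => iSup_le fun hI =>
    Matroid.Indep.encard_le_eRk_of_subset ((matroid_indep hcl I).2 hI) h) ?_
  obtain ⟨I, hI⟩ := (matroid hcl).exists_isBasis' Y
  rw [← hI.encard_eq_eRk]
  exact le_iSup_of_le I (le_iSup_of_le hI.subset
    (le_iSup (fun _ : IsIndepSet cl I => I.encard) hI.indep))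

theorem subset_cl_of_isBasis' (hcl : IsPregeometry cl) {I Y : Set M}
    (hI : (matroid hcl).IsBasis' I Y) : Y ⊆ cl I := fun y hy => by
  by_contra hyI
  have h := hI.2 (y := insert y I) ⟨IsIndepSet.insert hcl hI.indep hyI,
    insert_subset hy hI.subset⟩ (subset_insert _ _) (mem_insert _ _)
  exact hyI (subset_cl cl I h)

theorem dim_mono {A B : Set M} (h : A ⊆ B) : dim cl A ≤ dim cl B :=
  iSup_mono fun _ => iSup_mono' fun hI => ⟨hI.trans h, le_rfl⟩

theorem dim_cl (hcl : IsPregeometry cl) (Y : Set M) : dim cl (cl Y) = dim cl Y := by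
  refine le_antisymm ?_ (dim_mono (subset_cl cl Y))
  obtain ⟨I, hI⟩ := (matroid hcl).exists_isBasis' Y
  have h : (matroid hcl).IsBasis' I (cl Y) := by
    refine ⟨⟨hI.indep, hI.subset.trans (subset_cl cl Y)⟩, fun J hJ hIJ x hx => ?_⟩
    by_contra hxI
    refine hJ.1 x hx (cl_mono cl (fun y hy => show y ∈ J \ {x} from ⟨hIJ hy, fun h => hxI (h ▸ hy)⟩)
      ((cl_subset_iff cl).2 (subset_cl_of_isBasis' hcl hI) (hJ.2 hx)))
  rw [dim_eq_eRk hcl, dim_eq_eRk hcl, ← h.encard_eq_eRk, ← hI.encard_eq_eRk]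

theorem dim_insert_of_mem (hcl : IsPregeometry cl) {Y : Set M} {x : M} (hx : x ∈ cl Y) :
    dim cl (insert x Y) = dim cl Y := by
  rw [← dim_cl hcl, cl_insert_eq hx, dim_cl hcl]

theorem dim_insert_of_notMem (hcl : IsPregeometry cl) {Y : Set M} {x : M} (hx : x ∉ cl Y) :
    dim cl (insert x Y) = dim cl Y + 1 := by
  obtain ⟨I, hI⟩ := (matroid hcl).exists_isBasis' Y
  have hYI := subset_cl_of_isBasis' hcl hI
  have hxI : x ∉ cl I := fun h => hx (cl_mono cl hI.subset h)
  have h : (matroid hcl).IsBasis' (insert x I) (insert x Y) := by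
    refine ⟨⟨IsIndepSet.insert hcl hI.indep hxI, insert_subset_insert hI.subset⟩,
      fun J hJ hIJ y hy => ?_⟩
    by_contra hyI
    refine hJ.1 y hy (cl_mono cl
      (fun z hz => show z ∈ J \ {y} from ⟨hIJ hz, fun h => hyI (h ▸ hz)⟩) ?_)
    refine (cl_subset_iff cl).2 (insert_subset (subset_cl cl _ (mem_insert _ _))
      (hYI.trans (cl_mono cl (subset_insert _ _)))) (subset_cl cl _ (hJ.2 hy))
  rw [dim_eq_eRk hcl, dim_eq_eRk hcl, ← h.encard_eq_eRk, ← hI.encard_eq_eRk,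
    encard_insert_of_notMem fun h => hxI (subset_cl cl I h)]

theorem dim_empty (cl : ClosureOperator (Set M)) : dim cl ∅ = 0 := by
  refine le_antisymm (iSup_le fun I => iSup_le fun h => iSup_le fun _ => ?_) zero_le
  rw [subset_empty_iff.1 h, encard_empty]

/-- The localization of a closure operator at a set `A`. -/
def loc (cl : ClosureOperator (Set M)) (A : Set M) : ClosureOperator (Set M) :=
  ClosureOperator.mk' (fun X => cl (A ∪ X))
    (fun _ _ h => cl_mono cl (union_subset_union_right A h))
    (fun X => subset_union_right.trans (subset_cl cl (A ∪ X)))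
    (fun X => (cl_subset_iff cl).2 (union_subset
      (subset_union_left.trans (subset_cl cl (A ∪ X))) le_rfl))

theorem loc_apply (cl : ClosureOperator (Set M)) (A X : Set M) : loc cl A X = cl (A ∪ X) := rfl

theorem loc_isPregeometry (hcl : IsPregeometry cl) (A : Set M) : IsPregeometry (loc cl A) where
  finite_char X a ha := by
    obtain ⟨B, hB, hfin, haB⟩ := hcl.finite_char _ _ ha
    refine ⟨B ∩ X, inter_subset_right, hfin.inter_of_left X, cl_mono cl (fun y hy => ?_) haB⟩
    exact (hB hy).elim Or.inl fun h => Or.inr ⟨hy, h⟩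
  exchange X a b h h' := by
    rw [loc_apply, union_insert] at h ⊢
    exact hcl.exchange _ _ _ h h'

/-- The dimension of `C` over `A`, as a natural number; it is meaningful for finite `C`. -/
noncomputable def rk (cl : ClosureOperator (Set M)) (A C : Set M) : ℕ :=
  (dim (loc cl A) C).toNat

theorem dim_loc_ne_top (hcl : IsPregeometry cl) (A : Set M) {C : Set M} (hC : C.Finite) :
    dim (loc cl A) C ≠ ⊤ := by
  rw [dim_eq_eRk (loc_isPregeometry hcl A)]
  exact ((Matroid.eRk_le_encard _ _).trans_lt hC.encard_lt_top).ne

theorem rk_empty (cl : ClosureOperator (Set M)) (A : Set M) : rk cl A ∅ = 0 := by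
  rw [rk, dim_empty]; rfl

theorem rk_insert_of_mem (hcl : IsPregeometry cl) {A C : Set M} {x : M} (hx : x ∈ cl (A ∪ C)) :
    rk cl A (insert x C) = rk cl A C := by
  rw [rk, dim_insert_of_mem (loc_isPregeometry hcl A) hx, rk]

theorem rk_insert_of_notMem (hcl : IsPregeometry cl) {A C : Set M} (hC : C.Finite) {x : M}
    (hx : x ∉ cl (A ∪ C)) : rk cl A (insert x C) = rk cl A C + 1 := by
  rw [rk, dim_insert_of_notMem (loc_isPregeometry hcl A) hx,
    ENat.toNat_add (dim_loc_ne_top hcl A hC) (by simp), rk]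
  rfl

theorem rk_insert_le (hcl : IsPregeometry cl) {A C : Set M} (hC : C.Finite) (x : M) :
    rk cl A (insert x C) ≤ rk cl A C + 1 := by
  by_cases hx : x ∈ cl (A ∪ C)
  · rw [rk_insert_of_mem hcl hx]; omega
  · rw [rk_insert_of_notMem hcl hC hx]

/-- The chain rule for the relative dimension. -/
theorem rk_union (hcl : IsPregeometry cl) (A : Set M) {C D : Set M} (hC : C.Finite)
    (hD : D.Finite) : rk cl A (C ∪ D) = rk cl A C + rk cl (A ∪ C) D := by
  induction D, hD using Set.Finite.induction_on with
  | empty => simp [rk_empty]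
  | @insert x D _ hD ih =>
    rw [union_insert]
    by_cases hx : x ∈ cl (A ∪ C ∪ D)
    · rw [rk_insert_of_mem hcl (by rwa [← union_assoc]), rk_insert_of_mem hcl hx, ih]
    · rw [rk_insert_of_notMem hcl (hC.union hD) (by rwa [← union_assoc]),
        rk_insert_of_notMem hcl hD hx, ih, add_assoc]

theorem rk_congr_left {A B : Set M} (h : cl A = cl B) (C : Set M) : rk cl A C = rk cl B C := by
  have : loc cl A = loc cl B := by
    ext X : 1
    exact cl_union_congr h X
  rw [rk, rk, this]

theorem rk_anti (hcl : IsPregeometry cl) {A B : Set M} (h : cl A ⊆ cl B) {C : Set M}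
    (hC : C.Finite) : rk cl B C ≤ rk cl A C := by
  induction C, hC using Set.Finite.induction_on with
  | empty => simp [rk_empty]
  | @insert x C _ hC ih =>
    by_cases hx : x ∈ cl (B ∪ C)
    · rw [rk_insert_of_mem hcl hx]
      by_cases hx' : x ∈ cl (A ∪ C)
      · rwa [rk_insert_of_mem hcl hx']
      · rw [rk_insert_of_notMem hcl hC hx']; omega
    · have hx' : x ∉ cl (A ∪ C) := fun h' => hx ((cl_subset_iff cl).2 (union_subset
        (((subset_cl cl A).trans h).trans (cl_mono cl subset_union_left))
        (subset_union_right.trans (subset_cl cl _))) h')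
      rw [rk_insert_of_notMem hcl hC hx, rk_insert_of_notMem hcl hC hx']; omega

theorem rk_anti' (hcl : IsPregeometry cl) {A B : Set M} (h : A ⊆ B) {C : Set M}
    (hC : C.Finite) : rk cl B C ≤ rk cl A C := rk_anti hcl (cl_mono cl h) hC

theorem rk_eq_zero_iff (hcl : IsPregeometry cl) {A C : Set M} (hC : C.Finite) :
    rk cl A C = 0 ↔ C ⊆ cl A := by
  induction C, hC using Set.Finite.induction_on with
  | empty => simp [rk_empty]
  | @insert x C _ hC ih =>
    by_cases hx : x ∈ cl (A ∪ C)
    · rw [rk_insert_of_mem hcl hx, ih, insert_subset_iff]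
      refine ⟨fun h => ⟨?_, h⟩, fun h => h.2⟩
      exact (cl_subset_iff cl).2 (union_subset (subset_cl cl A) h) hx
    · rw [rk_insert_of_notMem hcl hC hx]
      refine iff_of_false (by omega) fun h => hx ?_
      exact cl_mono cl subset_union_left (h (mem_insert _ _))

theorem rk_of_subset_cl (hcl : IsPregeometry cl) {A C D : Set M} (hC : C.Finite) (hD : D.Finite)
    (h : D ⊆ cl (A ∪ C)) (h' : C ⊆ D) : rk cl A D = rk cl A C := by
  rw [← union_eq_self_of_subset_left h', rk_union hcl A hC hD, (rk_eq_zero_iff hcl hD).2 h,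
    add_zero]

/-- Symmetry of independence, in terms of relative dimension. -/
theorem rk_symm (hcl : IsPregeometry cl) (A : Set M) {C D : Set M} (hC : C.Finite)
    (hD : D.Finite) :
    rk cl A C + rk cl (A ∪ C) D = rk cl A D + rk cl (A ∪ D) C := by
  rw [← rk_union hcl A hC hD, ← rk_union hcl A hD hC, union_comm]

/-- Local character: the dimension of a finite set over `A` is attained over a finite subset of `A`.
-/
theorem exists_finite_rk_eq (hcl : IsPregeometry cl) (A : Set M) {C : Set M} (hC : C.Finite) :
    ∃ B ⊆ A, B.Finite ∧ rk cl B C = rk cl A C := by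
  induction C, hC using Set.Finite.induction_on with
  | empty => exact ⟨∅, empty_subset _, finite_empty, by simp [rk_empty]⟩
  | @insert x C _ hC ih =>
    obtain ⟨B, hBA, hB, hBC⟩ := ih
    by_cases hx : x ∈ cl (A ∪ C)
    · obtain ⟨B', hB'A, hB', hxB'⟩ := hcl.finite_char _ _ hx
      have hsub : B ∪ (B' ∩ A) ⊆ A := union_subset hBA inter_subset_right
      refine ⟨B ∪ (B' ∩ A), hsub, hB.union (hB'.inter_of_left A), ?_⟩
      have hx' : x ∈ cl (B ∪ (B' ∩ A) ∪ C) := cl_mono cl (fun y hy => by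
        rcases hB'A hy with h | h
        exacts [Or.inl (Or.inr ⟨hy, h⟩), Or.inr h]) hxB'
      rw [rk_insert_of_mem hcl hx, rk_insert_of_mem hcl hx']
      exact le_antisymm ((rk_anti' hcl subset_union_left hC).trans hBC.le) (rk_anti' hcl hsub hC)
    · refine ⟨B, hBA, hB, ?_⟩
      rw [rk_insert_of_notMem hcl hC hx, rk_insert_of_notMem hcl hC, hBC]
      exact fun h => hx (cl_mono cl (union_subset_union_left C hBA) h)

/-- Every finite set has a subset independent over `A` with the same closure over `A`. -/
theorem exists_basis (hcl : IsPregeometry cl) (A : Set M) {C : Set M} (hC : C.Finite) :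
    ∃ B ⊆ C, C ⊆ cl (A ∪ B) ∧ rk cl A B = B.ncard := by
  induction C, hC using Set.Finite.induction_on with
  | empty => exact ⟨∅, by simp, by simp, by simp [rk_empty]⟩
  | @insert x C hxC hC ih =>
    obtain ⟨B, hBC, hCB, hB⟩ := ih
    by_cases hx : x ∈ cl (A ∪ B)
    · exact ⟨B, hBC.trans (subset_insert _ _), insert_subset hx hCB, hB⟩
    · refine ⟨insert x B, insert_subset_insert hBC, insert_subset (subset_cl cl _ (by simp))
        (hCB.trans (cl_mono cl (union_subset_union_right A (subset_insert _ _)))), ?_⟩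
      rw [rk_insert_of_notMem hcl (hC.subset hBC) hx, hB,
        ncard_insert_of_notMem (fun h => hxC (hBC h)) (hC.subset hBC)]

theorem dim_union_eq (hcl : IsPregeometry cl) (A : Set M) {C : Set M} (hC : C.Finite) :
    dim cl (A ∪ C) = dim cl A + rk cl A C := by
  induction C, hC using Set.Finite.induction_on with
  | empty => simp [rk_empty]
  | @insert x C _ hC ih =>
    rw [union_insert]
    by_cases hx : x ∈ cl (A ∪ C)
    · rw [dim_insert_of_mem hcl hx, rk_insert_of_mem hcl hx, ih]
    · rw [dim_insert_of_notMem hcl hx, rk_insert_of_notMem hcl hC hx, ih]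
      push_cast; rw [add_assoc]

theorem exists_finite_subset_cl (hcl : IsPregeometry cl) {Y : Set M} (hY : dim cl Y ≠ ⊤) :
    ∃ C ⊆ Y, C.Finite ∧ Y ⊆ cl C := by
  obtain ⟨I, hI⟩ := (matroid hcl).exists_isBasis' Y
  refine ⟨I, hI.subset, ?_, subset_cl_of_isBasis' hcl hI⟩
  rw [← encard_ne_top_iff, hI.encard_eq_eRk, ← dim_eq_eRk hcl]
  exact hY

/-- Over a point `p`, every element of the closure of a closed set and a finite set lies in the
closure of a single point of the closed set and the finite set, provided this holds for finite
sets with one element (and closures of finite sets). -/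
theorem exists_mem_cl_of_mem_cl_union (hcl : IsPregeometry cl) {p : M}
    (H : ∀ e : Set M, e.Finite → p ∈ e → ∀ a b, a ∉ cl e → b ∉ cl e → a ∈ cl (insert b e) →
      ∃ d ∈ cl e, a ∈ cl {b, d, p})
    {Z : Set M} (hZ : cl Z = Z) (hpZ : p ∈ Z) {C : Set M} (hC : C.Finite) {x : M}
    (hx : x ∈ cl (Z ∪ C)) : ∃ z ∈ Z, x ∈ cl (insert z (insert p C)) := by
  induction C, hC using Set.Finite.induction_on generalizing x with
  | empty =>
    rw [union_empty, hZ] at hx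
    exact ⟨x, hx, subset_cl cl _ (mem_insert _ _)⟩
  | @insert y C _ hC ih =>
    have hmono : ∀ z, cl (insert z (insert p C)) ⊆ cl (insert z (insert p (insert y C))) :=
      fun z => cl_mono cl (insert_subset_insert (insert_subset_insert (subset_insert _ _)))
    by_cases hx' : x ∈ cl (Z ∪ C)
    · obtain ⟨z, hz, hxz⟩ := ih hx'
      exact ⟨z, hz, hmono z hxz⟩
    have hy : y ∉ cl (Z ∪ C) := fun h => hx' (by rwa [union_insert, cl_insert_eq h] at hx)
    rw [union_insert] at hx
    obtain ⟨B, hB, hBfin, hxB⟩ := hcl.finite_char _ _ hx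
    have he : insert p (B ∩ (Z ∪ C)) ⊆ Z ∪ C := insert_subset (Or.inl hpZ) inter_subset_right
    obtain ⟨d, hd, hxd⟩ := H (insert p (B ∩ (Z ∪ C))) ((hBfin.inter_of_left _).insert p)
      (mem_insert _ _) x y (fun h => hx' (cl_mono cl he h)) (fun h => hy (cl_mono cl he h))
      (cl_mono cl (fun z hz => by
        rcases hB hz with h | h
        · exact Or.inl h
        · exact Or.inr (Or.inr ⟨hz, h⟩)) hxB)
    obtain ⟨z, hz, hdz⟩ := ih (cl_mono cl he hd)
    refine ⟨z, hz, (cl_subset_iff cl).2 ?_ hxd⟩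
    rintro w (rfl | rfl | rfl)
    · exact subset_cl cl _ (by simp)
    · exact hmono z hdz
    · exact subset_cl cl _ (by simp)

/-- A failure of local modularity is witnessed by two dependent points over a finite set `e` whose
dependence over `p ∈ e` does not reduce to a single point of the closure of `e`. -/
theorem exists_of_not_locallyModular (hcl : IsPregeometry cl) (h : ¬ LocallyModular cl) :
    ∃ (p : M) (e : Set M) (a b : M), p ∉ cl ∅ ∧ e.Finite ∧ p ∈ e ∧ a ∉ cl e ∧ b ∉ cl e ∧
      a ∈ cl (insert b e) ∧ ∀ d ∈ cl e, a ∉ cl {b, d, p} := by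
  by_contra! hcon
  refine h fun Y Z hY hZ hYt hZt hYZ => ?_
  have hI : cl (Y ∩ Z) = Y ∩ Z := Subset.antisymm
    (subset_inter ((cl_mono cl inter_subset_left).trans hY.le)
      ((cl_mono cl inter_subset_right).trans hZ.le)) (subset_cl cl _)
  obtain ⟨p, hpI, hp⟩ : ∃ p ∈ Y ∩ Z, p ∉ cl ∅ := by
    by_contra! h'
    refine hYZ (le_antisymm ?_ zero_le)
    rw [← dim_empty cl, ← dim_cl hcl ∅]
    exact dim_mono h'
  obtain ⟨C, hCY, hC, hYC⟩ := exists_finite_subset_cl hcl hYt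
  -- elements of `Y` have the same dimension over `Z` as over `Y ∩ Z`: the single point of `Z` used
  -- for a dependence inside `Y` lies in `Y` by exchange
  have key : ∀ D ⊆ C, rk cl Z D = rk cl (Y ∩ Z) D := by
    intro D hDC
    induction D, hC.subset hDC using Set.Finite.induction_on with
    | empty => simp [rk_empty]
    | @insert x D _ hD ih =>
      have hxC : x ∈ C := hDC (mem_insert _ _)
      have hDC' : D ⊆ C := (subset_insert _ _).trans hDC
      have hDY : D ⊆ Y := hDC'.trans hCY
      specialize ih hDC'
      by_cases hx : x ∈ cl (Y ∩ Z ∪ D)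
      · rw [rk_insert_of_mem hcl hx, rk_insert_of_mem hcl, ih]
        exact cl_mono cl (union_subset_union_left D inter_subset_right) hx
      · rw [rk_insert_of_notMem hcl hD hx, rk_insert_of_notMem hcl hD, ih]
        intro hxZ
        obtain ⟨z, hz, hxz⟩ := exists_mem_cl_of_mem_cl_union hcl
          (fun e he hpe a b ha hb hab => hcon p e a b hp he hpe ha hb hab) hZ hpI.2 hD hxZ
        have hpD : insert p D ⊆ Y ∩ Z ∪ D := insert_subset (Or.inl hpI) subset_union_right
        have hzY : z ∈ Y := by
          rw [← hY]
          exact cl_mono cl (insert_subset (hCY hxC) (insert_subset hpI.1 hDY))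
            (hcl.exchange _ _ _ hxz fun h => hx (cl_mono cl hpD h))
        exact hx (cl_mono cl (insert_subset (Or.inl ⟨hzY, hz⟩) hpD) hxz)
  have h1 : dim cl Y = dim cl (Y ∩ Z) + rk cl (Y ∩ Z) C := by
    rw [← dim_union_eq hcl _ hC]
    refine le_antisymm ?_ (dim_mono (union_subset inter_subset_left hCY))
    rw [← dim_cl hcl (Y ∩ Z ∪ C)]
    exact dim_mono (hYC.trans (cl_mono cl subset_union_right))
  have h2 : dim cl (Y ∪ Z) = dim cl Z + rk cl Z C := by
    rw [← dim_union_eq hcl _ hC]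
    refine le_antisymm ?_ (dim_mono (union_subset subset_union_right
      (hCY.trans subset_union_left)))
    rw [← dim_cl hcl (Z ∪ C)]
    exact dim_mono (union_subset (hYC.trans (cl_mono cl subset_union_right))
      (subset_union_left.trans (subset_cl cl _)))
  rw [h1, h2, key C le_rfl]
  ring

end Pregeometry

/-! ### Partial isomorphisms and homogeneity -/

section Homogeneity

variable {L : FirstOrder.Language.{v, w}} {M : Type u} [L.Structure M]

theorem SameQF.comp {ι κ : Type*} {a b : ι → M} (h : SameQF L a b) (f : κ → ι) :
    SameQF L (a ∘ f) (b ∘ f) := fun φ hφ => by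
  have := h (φ.relabel f) (hφ.relabel _)
  rwa [FirstOrder.Language.Formula.realize_relabel,
    FirstOrder.Language.Formula.realize_relabel] at this

theorem SameQF.symm {ι : Type*} {a b : ι → M} (h : SameQF L a b) : SameQF L b a :=
  fun φ hφ => (h φ hφ).symm

theorem SameQF.eq_iff {ι : Type*} {a b : ι → M} (h : SameQF L a b) (i j : ι) :
    a i = a j ↔ b i = b j := by
  have := h ((FirstOrder.Language.var i).equal (FirstOrder.Language.var j))
    (FirstOrder.Language.BoundedFormula.IsAtomic.equal _ _).isQF
  simpa [FirstOrder.Language.Formula.realize_equal] using this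

theorem sameQF_aut {ι : Type*} (g : M ≃[L] M) (a : ι → M) : SameQF L a (fun i => g (a i)) :=
  fun φ hφ => by
    have := hφ.realize_embedding g (v := a) (xs := default)
    rw [Subsingleton.elim (g ∘ default) default] at this
    exact this.symm

theorem realize_congr_of_freeVar {ι : Type*} [DecidableEq ι] {φ : L.Formula ι} {a b : ι → M}
    (h : ∀ i ∈ φ.freeVarFinset, a i = b i) : φ.Realize a ↔ φ.Realize b := by
  have h1 := FirstOrder.Language.BoundedFormula.realize_restrictFreeVar (φ := φ) (f := id)
    (v := fun i => a i) (xs := default) a (fun _ => rfl)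
  have h2 := FirstOrder.Language.BoundedFormula.realize_restrictFreeVar (φ := φ) (f := id)
    (v := fun i => b i) (xs := default) b (fun _ => rfl)
  have h3 : (fun i : φ.freeVarFinset => a i) = fun i : φ.freeVarFinset => b i :=
    funext fun i => h i i.2
  rw [h3] at h1
  exact h1.symm.trans h2

/-- Quantifier-free types are determined by finite subfamilies. -/
theorem sameQF_of_fin {ι : Type*} {a b : ι → M}
    (h : ∀ (n : ℕ) (s : Fin n → ι), SameQF L (a ∘ s) (b ∘ s)) : SameQF L a b := by
  classical
  intro φ hφ
  have key : ∀ (n : ℕ) (s : Fin n → ι) (f : ι → Fin n),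
      (∀ i ∈ φ.freeVarFinset, s (f i) = i) → (φ.Realize a ↔ φ.Realize b) := by
    intro n s f hf
    have h1 := (h n s).comp f φ hφ
    rwa [realize_congr_of_freeVar (a := (a ∘ s) ∘ f) (b := a) (fun i hi => by simp [hf i hi]),
      realize_congr_of_freeVar (a := (b ∘ s) ∘ f) (b := b) (fun i hi => by simp [hf i hi])] at h1
  rcases isEmpty_or_nonempty ι with hι | ⟨⟨i₀⟩⟩
  · exact key 0 Fin.elim0 isEmptyElim fun i => isEmptyElim i
  · refine key (φ.freeVarFinset.card + 1)
      (Fin.cons i₀ fun k => (φ.freeVarFinset.equivFin.symm k : ι))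
      (fun i => if hi : i ∈ φ.freeVarFinset then (φ.freeVarFinset.equivFin ⟨i, hi⟩).succ else 0)
      fun i hi => ?_
    simp [hi]

variable (L) in
/-- A partial isomorphism of `M`, given by its graph. -/
def PartIso (R : Set (M × M)) : Prop :=
  ∀ (n : ℕ) (s : Fin n → M × M), (∀ i, s i ∈ R) →
    SameQF L (fun i => (s i).1) (fun i => (s i).2)

theorem PartIso.mono {R S : Set (M × M)} (hR : PartIso L R) (h : S ⊆ R) : PartIso L S :=
  fun n s hs => hR n s fun i => h (hs i)

theorem PartIso.sameQF {R : Set (M × M)} (hR : PartIso L R) {ι : Type*} {a b : ι → M}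
    (h : ∀ i, (a i, b i) ∈ R) : SameQF L a b :=
  sameQF_of_fin fun n s => hR n (fun i => (a (s i), b (s i))) fun i => h (s i)

theorem SameQF.partIso {ι : Type*} {a b : ι → M} (h : SameQF L a b) :
    PartIso L (range fun i => (a i, b i)) := by
  intro n s hs
  choose f hf using hs
  have := h.comp f
  have hs : s = fun i => (a (f i), b (f i)) := funext fun i => (hf i).symm
  rw [hs]
  exact this

theorem PartIso.swap {R : Set (M × M)} (hR : PartIso L R) : PartIso L (Prod.swap '' R) := by
  intro n s hs
  refine (hR n (fun i => (s i).swap) fun i => ?_).symm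
  obtain ⟨y, hy, h⟩ := hs i
  rw [← h, Prod.swap_swap]
  exact hy

theorem PartIso.eq_iff {R : Set (M × M)} (hR : PartIso L R) {p q : M × M} (hp : p ∈ R)
    (hq : q ∈ R) : p.1 = q.1 ↔ p.2 = q.2 := by
  have := (hR 2 ![p, q] (by simp [Fin.forall_fin_two, hp, hq])).eq_iff 0 1
  simpa using this

theorem partIso_aut (g : M ≃[L] M) : PartIso L {p : M × M | g p.1 = p.2} := by
  intro n s hs
  have := sameQF_aut g fun i => (s i).1
  have hs : (fun i => g (s i).1) = fun i => (s i).2 := funext hs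
  rwa [hs] at this

variable {cl : ClosureOperator (Set M)} {δ : Cardinal.{u}}

theorem exists_fin_range {α : Type*} {S : Set α} (hS : S.Finite) :
    ∃ (n : ℕ) (f : Fin n → α), range f = S := by
  obtain ⟨n, f, -, hf⟩ := hS.fin_param
  exact ⟨n, f, hf⟩

/-- By `IsQuasiminimal.qm1`, partial isomorphisms respect the closure. -/
theorem PartIso.mem_cl (hq : IsQuasiminimal L cl) {R S : Set (M × M)} (hR : PartIso L R)
    (hS : S ⊆ R) {p : M × M} (hp : p ∈ R) (h : p.1 ∈ cl (Prod.fst '' S)) :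
    p.2 ∈ cl (Prod.snd '' S) := by
  obtain ⟨B, hB, hBfin, hpB⟩ := hq.pregeometry.finite_char _ _ h
  obtain ⟨n, f, rfl⟩ := exists_fin_range hBfin
  choose s hs hsf using fun i => hB (mem_range_self i)
  have h1 := (hq.qm1 n p.1 p.2 (fun i => (s i).1) (fun i => (s i).2)
    (hR.sameQF fun i => ?_)).1 ?_
  · refine cl_mono cl ?_ h1
    rintro _ ⟨i, rfl⟩
    exact ⟨s i, hs i, rfl⟩
  · refine Fin.lastCases ?_ (fun i => ?_) i
    · simpa using hp
    · simpa using hS (hs i)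
  · convert hpB using 3
    exact funext hsf

/-- The axiom `IsQuasiminimal.qm5` in terms of graphs: a partial isomorphism consisting of a
countable closed (or empty) part and a finite part extends to each element of the closure of its
domain. -/
theorem PartIso.exists_of_mem_cl (hq : IsQuasiminimal L cl) {R₀ R₁ : Set (M × M)}
    (h₀ : R₀.Countable) (hd : cl (Prod.fst '' R₀) = Prod.fst '' R₀ ∨ R₀ = ∅)
    (hr : cl (Prod.snd '' R₀) = Prod.snd '' R₀ ∨ R₀ = ∅) (h₁ : R₁.Finite)
    (hR : PartIso L (R₀ ∪ R₁)) {a : M} (ha : a ∈ cl (Prod.fst '' (R₀ ∪ R₁))) :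
    ∃ a', PartIso L (insert (a, a') (R₀ ∪ R₁)) := by
  obtain ⟨n, s, hs⟩ := exists_fin_range h₁
  choose t ht ht1 using fun x : Prod.fst '' R₀ => x.2
  have htR : ∀ p ∈ R₀, ∃ x, t x = p := fun p hp => by
    refine ⟨⟨p.1, p, hp, rfl⟩, ?_⟩
    have h1 := ht1 ⟨p.1, p, hp, rfl⟩
    exact Prod.ext h1 ((hR.eq_iff (Or.inl (ht _)) (Or.inl hp)).1 h1)
  have hrange : range (fun x => (t x).2) = Prod.snd '' R₀ := by
    ext y
    constructor
    · rintro ⟨x, rfl⟩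
      exact ⟨_, ht x, rfl⟩
    · rintro ⟨p, hp, rfl⟩
      obtain ⟨x, hx⟩ := htR p hp
      exact ⟨x, congrArg Prod.snd hx⟩
  have hsR : ∀ i, s i ∈ R₁ := fun i => hs ▸ mem_range_self i
  obtain ⟨a', ha'⟩ := hq.qm5 (Prod.fst '' R₀) (fun x => (t x).2) (h₀.image _)
    (hd.imp id fun h => by rw [h, image_empty])
    (by rw [hrange]; exact hr.imp id fun h => by rw [h, image_empty])
    n (fun i => (s i).1) (fun i => (s i).2)
    (hR.sameQF (by
      rintro (x | i)
      · have := ht x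
        rw [← Prod.mk.eta (p := t x), ht1 x] at this
        exact Or.inl this
      · exact Or.inr (hsR i))) a (by
        convert ha using 2
        rw [image_union, ← hs, ← range_comp]; rfl)
  refine ⟨a', ha'.partIso.mono ?_⟩
  rintro p (rfl | hp | hp)
  · exact ⟨Sum.inr (Fin.last n), by simp⟩
  · obtain ⟨x, rfl⟩ := htR p hp
    exact ⟨Sum.inl x, Prod.ext (ht1 x).symm rfl⟩
  · rw [← hs] at hp
    obtain ⟨i, rfl⟩ := hp
    exact ⟨Sum.inr i.castSucc, by simp⟩

theorem countable_cl (hq : IsQuasiminimal L cl) {A : Set M} (hA : A.Countable) :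
    (cl A).Countable := by
  have : cl A ⊆ ⋃ B ∈ {B : Set M | B.Finite ∧ B ⊆ A}, cl B := fun x hx => by
    obtain ⟨B, hB, hfin, hxB⟩ := hq.pregeometry.finite_char _ _ hx
    exact mem_biUnion (show B ∈ {B : Set M | B.Finite ∧ B ⊆ A} from ⟨hfin, hB⟩) hxB
  refine Countable.mono this ((countable_ofPred_finite_subset hA).biUnion fun B hB => ?_)
  exact hq.qm3 B hB.1

/-- A finite subset of the limit of a generic ideal of approximations is contained in a single
approximation. -/
theorem exists_mem_ideal {P α : Type*} [Preorder P] (I : Order.Ideal P) {f : P → Set α}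
    (hf : Monotone f) (S : Set α) {T : Set α} (hT : T.Finite) (h : T ⊆ S ∪ ⋃ F ∈ I, f F) :
    ∃ F ∈ I, T ⊆ S ∪ f F := by
  induction T, hT using Set.Finite.induction_on with
  | empty => exact I.nonempty.imp fun F hF => ⟨hF, empty_subset _⟩
  | @insert x T _ _ ih =>
    obtain ⟨F, hF, hTF⟩ := ih ((subset_insert _ _).trans h)
    rcases h (mem_insert _ _) with hx | hx
    · exact ⟨F, hF, insert_subset (Or.inl hx) hTF⟩
    · obtain ⟨G, hG, hxG⟩ := mem_iUnion₂.1 hx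
      obtain ⟨K, hK, hFK, hGK⟩ := I.directed F hF G hG
      exact ⟨K, hK, insert_subset (Or.inr (hf hGK hxG))
        (hTF.trans (union_subset_union_right S (hf hFK)))⟩

/-- A partial isomorphism consisting of a countable closed part and a finite part extends to the
closures. -/
theorem PartIso.exists_closed (hq : IsQuasiminimal L cl) {R₀ R₁ : Set (M × M)}
    (h₀ : R₀.Countable) (hd : cl (Prod.fst '' R₀) = Prod.fst '' R₀ ∨ R₀ = ∅)
    (hr : cl (Prod.snd '' R₀) = Prod.snd '' R₀ ∨ R₀ = ∅) (h₁ : R₁.Finite)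
    (hR : PartIso L (R₀ ∪ R₁)) :
    ∃ R, R₀ ∪ R₁ ⊆ R ∧ R.Countable ∧ PartIso L R ∧ cl (Prod.fst '' R) = Prod.fst '' R ∧
      cl (Prod.snd '' R) = Prod.snd '' R := by
  set X := cl (Prod.fst '' (R₀ ∪ R₁)) with hX
  set Y := cl (Prod.snd '' (R₀ ∪ R₁)) with hY
  have hRc : (R₀ ∪ R₁).Countable := h₀.union h₁.countable
  have hXc : X.Countable := countable_cl hq (hRc.image _)
  have hYc : Y.Countable := countable_cl hq (hRc.image _)
  -- finite extensions of the given map inside the two closures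
  let P := {F : Set (M × M) // R₁ ⊆ F ∧ F.Finite ∧ PartIso L (R₀ ∪ F) ∧
    Prod.fst '' F ⊆ X ∧ Prod.snd '' F ⊆ Y}
  have hXF : ∀ F : P, cl (Prod.fst '' (R₀ ∪ F.1)) = X := fun F => by
    refine Subset.antisymm ((cl_subset_iff cl).2 ?_)
      (cl_mono cl (image_mono (union_subset_union_right R₀ F.2.1)))
    rw [image_union]
    exact union_subset ((image_mono subset_union_left).trans (subset_cl cl _)) F.2.2.2.2.1
  have hYF : ∀ F : P, cl (Prod.snd '' (R₀ ∪ F.1)) = Y := fun F => by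
    refine Subset.antisymm ((cl_subset_iff cl).2 ?_)
      (cl_mono cl (image_mono (union_subset_union_right R₀ F.2.1)))
    rw [image_union]
    exact union_subset ((image_mono subset_union_left).trans (subset_cl cl _)) F.2.2.2.2.2
  have hcofX : ∀ x : X, IsCofinal {F : P | (x : M) ∈ Prod.fst '' F.1} := fun x F => by
    obtain ⟨y, hy⟩ := PartIso.exists_of_mem_cl hq h₀ hd hr F.2.2.1 F.2.2.2.1
      (a := x) (by rw [hXF F]; exact x.2)
    have hyY : y ∈ Y := by
      rw [← hYF F]
      exact hy.mem_cl hq (subset_insert _ _) (mem_insert _ _) (by rw [hXF F]; exact x.2)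
    refine ⟨⟨insert (x.1, y) F.1, F.2.1.trans (subset_insert _ _), F.2.2.1.insert _,
      by rwa [union_insert], ?_, ?_⟩, ⟨_, mem_insert _ _, rfl⟩, subset_insert _ _⟩
    · rw [image_insert_eq]; exact insert_subset x.2 F.2.2.2.2.1
    · rw [image_insert_eq]; exact insert_subset hyY F.2.2.2.2.2
  have hswap : ∀ S : Set (M × M), Prod.fst '' (Prod.swap '' S) = Prod.snd '' S := fun S => by
    rw [← image_comp]; rfl
  have hswap' : ∀ S : Set (M × M), Prod.snd '' (Prod.swap '' S) = Prod.fst '' S := fun S => by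
    rw [← image_comp]; rfl
  have hcofY : ∀ y : Y, IsCofinal {F : P | (y : M) ∈ Prod.snd '' F.1} := fun y F => by
    obtain ⟨x, hx⟩ := PartIso.exists_of_mem_cl hq (R₀ := Prod.swap '' R₀)
      (R₁ := Prod.swap '' F.1) (h₀.image _)
      (by rw [hswap]; exact hr.imp id fun h => by rw [h, image_empty])
      (by rw [hswap']; exact hd.imp id fun h => by rw [h, image_empty]) (F.2.2.1.image _)
      (by rw [← image_union]; exact F.2.2.2.1.swap) (a := y)
      (by rw [← image_union, hswap, hYF F]; exact y.2)
    have hx' : PartIso L (insert (x, y.1) (R₀ ∪ F.1)) := by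
      have := hx.swap
      rwa [image_insert_eq, image_union, Prod.swap_prod_mk, ← image_comp, ← image_comp,
        Prod.swap_swap_eq, image_id, image_id] at this
    have hxX : x ∈ X := by
      rw [← hXF F, ← hswap', image_union]
      exact hx.mem_cl hq (subset_insert _ _) (mem_insert _ _)
        (by rw [← image_union, hswap, hYF F]; exact y.2)
    refine ⟨⟨insert (x, y.1) F.1, F.2.1.trans (subset_insert _ _), F.2.2.1.insert _,
      by rwa [union_insert], ?_, ?_⟩, ⟨_, mem_insert _ _, rfl⟩, subset_insert _ _⟩
    · rw [image_insert_eq]; exact insert_subset hxX F.2.2.2.2.1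
    · rw [image_insert_eq]; exact insert_subset y.2 F.2.2.2.2.2
  have := hXc.to_subtype
  have := hYc.to_subtype
  let _ : Encodable (X ⊕ Y) := Encodable.ofCountable _
  let F₀ : P := ⟨R₁, le_rfl, h₁, hR, (image_mono subset_union_right).trans (subset_cl cl _),
    (image_mono subset_union_right).trans (subset_cl cl _)⟩
  let I := Order.idealOfCofinals F₀
    (fun i : X ⊕ Y => Sum.elim (fun x => ⟨_, hcofX x⟩) (fun y => ⟨_, hcofY y⟩) i)
  let R : Set (M × M) := R₀ ∪ ⋃ F ∈ I, F.1
  have hfst : Prod.fst '' R = X := by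
    refine Subset.antisymm ?_ fun x hx => ?_
    · rw [image_union]
      refine union_subset ((image_mono subset_union_left).trans (subset_cl cl _)) ?_
      rw [image_iUnion₂]
      exact iUnion₂_subset fun F _ => F.2.2.2.2.1
    · obtain ⟨F, ⟨p, hp, hpx⟩, hF⟩ := Order.cofinal_meets_idealOfCofinals F₀
        (fun i : X ⊕ Y => Sum.elim (fun x => ⟨_, hcofX x⟩) (fun y => ⟨_, hcofY y⟩) i)
        (Sum.inl ⟨x, hx⟩)
      exact ⟨p, Or.inr (mem_biUnion hF hp), hpx⟩
  have hsnd : Prod.snd '' R = Y := by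
    refine Subset.antisymm ?_ fun x hx => ?_
    · rw [image_union]
      refine union_subset ((image_mono subset_union_left).trans (subset_cl cl _)) ?_
      rw [image_iUnion₂]
      exact iUnion₂_subset fun F _ => F.2.2.2.2.2
    · obtain ⟨F, ⟨p, hp, hpx⟩, hF⟩ := Order.cofinal_meets_idealOfCofinals F₀
        (fun i : X ⊕ Y => Sum.elim (fun x => ⟨_, hcofX x⟩) (fun y => ⟨_, hcofY y⟩) i)
        (Sum.inr ⟨x, hx⟩)
      exact ⟨p, Or.inr (mem_biUnion hF hp), hpx⟩
  refine ⟨R, union_subset_union_right R₀ fun p hp => mem_biUnion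
    (Order.mem_idealOfCofinals _ _) hp, ?_, ?_, by rw [hfst, hX, cl.idempotent],
    by rw [hsnd, hY, cl.idempotent]⟩
  · refine (hXc.prod hYc).mono fun p hp => mk_mem_prod ?_ ?_
    · rw [← hfst]; exact ⟨p, hp, rfl⟩
    · rw [← hsnd]; exact ⟨p, hp, rfl⟩
  · intro n s hs
    obtain ⟨F, -, hF⟩ := exists_mem_ideal I (f := fun F : P => F.1) (fun _ _ h => h) R₀
      (finite_range s) (range_subset_iff.2 hs)
    exact F.2.2.2.1 n s fun i => hF (mem_range_self i)

end Homogeneity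

section Extension

variable {L : FirstOrder.Language.{v, w}} {M : Type u} [L.Structure M]
variable {cl : ClosureOperator (Set M)} {δ : Cardinal.{u}}

/-- The axiom `IsQuasiminimal.qm4` in terms of graphs: points outside the closed domain and range
may be paired freely. -/
theorem PartIso.insert_of_notMem (hq : IsQuasiminimal L cl) {R : Set (M × M)} (hR : PartIso L R)
    (hc : R.Countable) (hd : cl (Prod.fst '' R) = Prod.fst '' R)
    (hr : cl (Prod.snd '' R) = Prod.snd '' R) {a a' : M} (ha : a ∉ Prod.fst '' R)
    (ha' : a' ∉ Prod.snd '' R) : PartIso L (insert (a, a') R) := by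
  choose t ht ht1 using fun x : Prod.fst '' R => x.2
  have htR : ∀ p ∈ R, ∃ x, t x = p := fun p hp => by
    refine ⟨⟨p.1, p, hp, rfl⟩, ?_⟩
    have h1 := ht1 ⟨p.1, p, hp, rfl⟩
    exact Prod.ext h1 ((hR.eq_iff (ht _) hp).1 h1)
  have hrange : range (fun x => (t x).2) = Prod.snd '' R := by
    ext y
    constructor
    · rintro ⟨x, rfl⟩
      exact ⟨_, ht x, rfl⟩
    · rintro ⟨p, hp, rfl⟩
      obtain ⟨x, hx⟩ := htR p hp
      exact ⟨x, congrArg Prod.snd hx⟩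
  have h := hq.qm4 (Prod.fst '' R) (fun x => (t x).2) (hc.image _) hd (by rwa [hrange])
    (hR.sameQF fun x => by
      have := ht x
      rwa [← Prod.mk.eta (p := t x), ht1 x] at this) a a' ha (by rwa [hrange])
  refine h.partIso.mono ?_
  rintro p (rfl | hp)
  · exact ⟨Sum.inr 0, rfl⟩
  · obtain ⟨x, rfl⟩ := htR p hp
    exact ⟨Sum.inl x, Prod.ext (ht1 x).symm rfl⟩

/-- The closure of a small set is small. -/
theorem mk_cl_lt (hM : IsMonster L cl δ) {D : Set M} (hD : #D < δ) : #(cl D) < δ := by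
  rcases le_or_gt #D ℵ₀ with h | h
  · exact (le_aleph0_iff_set_countable.2 (countable_cl hM.quasiminimal
      (le_aleph0_iff_set_countable.1 h))).trans_lt hM.uncountable
  have : Infinite D := infinite_iff.2 h.le
  have hsub : cl D ⊆ ⋃ F : Finset D, cl (Subtype.val '' (F : Set D)) := fun x hx => by
    obtain ⟨B, hB, hfin, hxB⟩ := hM.quasiminimal.pregeometry.finite_char _ _ hx
    have hfin' : (Subtype.val ⁻¹' B : Set D).Finite := hfin.preimage Subtype.val_injective.injOn
    refine mem_iUnion.2 ⟨hfin'.toFinset, ?_⟩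
    rw [hfin'.coe_toFinset, Subtype.image_preimage_coe, inter_eq_right.2 hB]
    exact hxB
  refine (mk_le_mk_of_subset hsub).trans_lt ((mk_iUnion_le _).trans_lt ?_)
  rw [mk_finset_of_infinite]
  refine (mul_le_max_of_aleph0_le_left h.le).trans_lt (max_lt hD ?_)
  refine (ciSup_le' fun F => ?_).trans_lt hM.uncountable
  exact le_aleph0_iff_set_countable.2 (hM.quasiminimal.qm3 _ (F.finite_toSet.image _))

theorem exists_notMem_cl (hM : IsMonster L cl δ) {D : Set M} (hD : #D < δ) : ∃ x, x ∉ cl D := by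
  by_contra! h
  have h1 := mk_cl_lt hM hD
  rw [eq_univ_of_forall h, mk_univ] at h1
  exact absurd hM.le_card h1.not_ge

theorem mk_lt_of_countable (hM : IsMonster L cl δ) {D : Set M} (hD : D.Countable) : #D < δ :=
  (le_aleph0_iff_set_countable.2 hD).trans_lt hM.uncountable

theorem mk_union_lt (hM : IsMonster L cl δ) {D E : Set M} (hD : #D < δ) (hE : #E < δ) :
    #(D ∪ E : Set M) < δ :=
  (mk_union_le D E).trans_lt (add_lt_of_lt hM.uncountable.le hD hE)

theorem exists_subset_of_monotone {α : Type*} {A : ℕ → Set α} (hA : Monotone A) {B : Set α}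
    (hB : B.Finite) (h : B ⊆ ⋃ n, A n) : ∃ n, B ⊆ A n := by
  induction B, hB using Set.Finite.induction_on with
  | empty => exact ⟨0, empty_subset _⟩
  | @insert x B _ _ ih =>
    obtain ⟨n, hn⟩ := ih ((subset_insert _ _).trans h)
    obtain ⟨m, hm⟩ := mem_iUnion.1 (h (mem_insert _ _))
    exact ⟨max n m, insert_subset (hA (le_max_right _ _) hm) (hn.trans (hA (le_max_left _ _)))⟩

theorem cl_iUnion_eq (hcl : IsPregeometry cl) {A : ℕ → Set M} (hA : Monotone A)
    (h : ∀ n, cl (A n) = A n) : cl (⋃ n, A n) = ⋃ n, A n := by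
  refine Subset.antisymm (fun x hx => ?_) (subset_cl cl _)
  obtain ⟨B, hB, hfin, hxB⟩ := hcl.finite_char _ _ hx
  obtain ⟨n, hn⟩ := exists_subset_of_monotone hA hfin hB
  exact mem_iUnion.2 ⟨n, by rw [← h n]; exact cl_mono cl hn hxB⟩

theorem dim_iUnion_eq_top (hcl : IsPregeometry cl) {A : ℕ → Set M} (hA : Monotone A)
    (h : ∀ n, cl (A n) = A n) (hne : ∀ n, ∃ x ∈ A (n + 1), x ∉ A n) : dim cl (⋃ n, A n) = ⊤ := by
  have key : ∀ n : ℕ, (n : ℕ∞) ≤ dim cl (A n) := by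
    intro n
    induction n with
    | zero => simp
    | succ n ih =>
      obtain ⟨x, hx, hxn⟩ := hne n
      calc ((n + 1 : ℕ) : ℕ∞) ≤ dim cl (A n) + 1 := by push_cast; gcongr
        _ = dim cl (insert x (A n)) := (dim_insert_of_notMem hcl (by rwa [h n])).symm
        _ ≤ dim cl (A (n + 1)) := dim_mono (insert_subset hx (hA n.le_succ))
  refine ENat.eq_top_iff_forall_ge.2 fun n => (key n).trans (dim_mono (subset_iUnion A n))

/-- Countable closed partial isomorphisms extend to automorphisms. -/
theorem PartIso.exists_aut_of_closed (hM : IsMonster L cl δ) {R : Set (M × M)} (hR : PartIso L R)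
    (hc : R.Countable) (hd : cl (Prod.fst '' R) = Prod.fst '' R)
    (hr : cl (Prod.snd '' R) = Prod.snd '' R) : ∃ g : M ≃[L] M, ∀ p ∈ R, g p.1 = p.2 := by
  have hq := hM.quasiminimal
  -- adding new points infinitely often makes the domain and the range models, so that the
  -- homogeneity of `M` applies
  let T := {R : Set (M × M) // PartIso L R ∧ R.Countable ∧ cl (Prod.fst '' R) = Prod.fst '' R ∧
    cl (Prod.snd '' R) = Prod.snd '' R}
  have step : ∀ R : T, ∃ R' : T, R.1 ⊆ R'.1 ∧ (∃ x ∈ Prod.fst '' R'.1, x ∉ Prod.fst '' R.1) ∧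
      ∃ y ∈ Prod.snd '' R'.1, y ∉ Prod.snd '' R.1 := by
    rintro ⟨R, hR, hc, hd, hr⟩
    obtain ⟨a, ha⟩ := exists_notMem_cl hM (mk_lt_of_countable hM (hc.image Prod.fst))
    obtain ⟨a', ha'⟩ := exists_notMem_cl hM (mk_lt_of_countable hM (hc.image Prod.snd))
    rw [hd] at ha
    rw [hr] at ha'
    have h1 := hR.insert_of_notMem hq hc hd hr ha ha'
    rw [← union_singleton] at h1
    obtain ⟨R', hRR', hc', hR', hd', hr'⟩ := h1.exists_closed hq hc (Or.inl hd) (Or.inl hr)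
      (finite_singleton _)
    have hmem : (a, a') ∈ R' := hRR' (Or.inr rfl)
    exact ⟨⟨R', hR', hc', hd', hr'⟩, subset_union_left.trans hRR', ⟨a, ⟨_, hmem, rfl⟩, ha⟩,
      ⟨a', ⟨_, hmem, rfl⟩, ha'⟩⟩
  choose F hF hF1 hF2 using step
  let S : ℕ → T := fun n => F^[n] ⟨R, hR, hc, hd, hr⟩
  have hS : ∀ n, S (n + 1) = F (S n) := fun n => Function.iterate_succ_apply' F n _
  have hmono : Monotone fun n => (S n).1 := monotone_nat_of_le_succ fun n => by
    rw [hS]; exact hF (S n)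
  have hmono1 : Monotone fun n => Prod.fst '' (S n).1 := fun m n h => image_mono (hmono h)
  have hmono2 : Monotone fun n => Prod.snd '' (S n).1 := fun m n h => image_mono (hmono h)
  set R' : Set (M × M) := ⋃ n, (S n).1 with hR'def
  have hR'c : R'.Countable := countable_iUnion fun n => (S n).2.2.1
  have hR' : PartIso L R' := fun n s hs => by
    obtain ⟨m, hm⟩ := exists_subset_of_monotone hmono (finite_range s) (range_subset_iff.2 hs)
    exact (S m).2.1 n s fun i => hm (mem_range_self i)
  have hfst : Prod.fst '' R' = ⋃ n, Prod.fst '' (S n).1 := image_iUnion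
  have hsnd : Prod.snd '' R' = ⋃ n, Prod.snd '' (S n).1 := image_iUnion
  have hm1 : (monster L cl).IsModel (Prod.fst '' R') := by
    rw [hfst]
    exact ⟨cl_iUnion_eq hq.pregeometry hmono1 fun n => (S n).2.2.2.1,
      dim_iUnion_eq_top hq.pregeometry hmono1 (fun n => (S n).2.2.2.1) fun n => by
        rw [hS]; exact hF1 (S n)⟩
  have hm2 : (monster L cl).IsModel (Prod.snd '' R') := by
    rw [hsnd]
    exact ⟨cl_iUnion_eq hq.pregeometry hmono2 fun n => (S n).2.2.2.2,
      dim_iUnion_eq_top hq.pregeometry hmono2 (fun n => (S n).2.2.2.2) fun n => by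
        rw [hS]; exact hF2 (S n)⟩
  choose t ht ht1 using fun x : Prod.fst '' R' => x.2
  have htR : ∀ p ∈ R', ∃ x, t x = p ∧ x.1 = p.1 := fun p hp => by
    refine ⟨⟨p.1, p, hp, rfl⟩, ?_, rfl⟩
    have h1 := ht1 ⟨p.1, p, hp, rfl⟩
    exact Prod.ext h1 ((hR'.eq_iff (ht _) hp).1 h1)
  have hrange : range (fun x => (t x).2) = Prod.snd '' R' := by
    ext y
    constructor
    · rintro ⟨x, rfl⟩
      exact ⟨_, ht x, rfl⟩
    · rintro ⟨p, hp, rfl⟩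
      obtain ⟨x, hx, -⟩ := htR p hp
      exact ⟨x, congrArg Prod.snd hx⟩
  obtain ⟨g, hg⟩ := hM.homogeneous (Prod.fst '' R') (fun x => (t x).2) hm1 (by rwa [hrange])
    (mk_lt_of_countable hM (hR'c.image _)) (hR'.sameQF fun x => by
      have := ht x
      rwa [← Prod.mk.eta (p := t x), ht1 x] at this)
  refine ⟨g, fun p hp => ?_⟩
  obtain ⟨x, hx, hx1⟩ := htR p (mem_iUnion.2 ⟨0, hp⟩)
  rw [← hx1, hg x, hx]

/-- Partial isomorphisms consisting of a countable closed part and a finite part extend to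
automorphisms. -/
theorem PartIso.exists_aut (hM : IsMonster L cl δ) {R₀ R₁ : Set (M × M)}
    (h₀ : R₀.Countable) (hd : cl (Prod.fst '' R₀) = Prod.fst '' R₀ ∨ R₀ = ∅)
    (hr : cl (Prod.snd '' R₀) = Prod.snd '' R₀ ∨ R₀ = ∅) (h₁ : R₁.Finite)
    (hR : PartIso L (R₀ ∪ R₁)) : ∃ g : M ≃[L] M, ∀ p ∈ R₀ ∪ R₁, g p.1 = p.2 := by
  obtain ⟨R, hsub, hc, hR', hd', hr'⟩ := hR.exists_closed hM.quasiminimal h₀ hd hr h₁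
  obtain ⟨g, hg⟩ := hR'.exists_aut_of_closed hM hc hd' hr'
  exact ⟨g, fun p hp => hg p (hsub hp)⟩

/-! ### The action of the automorphism group -/

theorem mem_cl_aut (hq : IsQuasiminimal L cl) (g : M ≃[L] M) {A : Set M} {x : M}
    (h : x ∈ cl A) : g x ∈ cl (g '' A) := by
  have hfst : Prod.fst '' ((fun y => (y, g y)) '' A) = A := by rw [← image_comp]; exact image_id A
  have hsnd : Prod.snd '' ((fun y => (y, g y)) '' A) = g '' A := by rw [← image_comp]; rfl
  have := (partIso_aut g).mem_cl hq (S := (fun y => (y, g y)) '' A) (p := (x, g x))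
    (by rintro _ ⟨y, -, rfl⟩; exact rfl) rfl (by rwa [hfst])
  rwa [hsnd] at this

theorem image_symm_image (g : M ≃[L] M) (A : Set M) : g.symm '' (g '' A) = A := by
  rw [← image_comp]
  exact (image_congr fun x _ => by simp).trans (image_id' A)

theorem image_image_symm (g : M ≃[L] M) (A : Set M) : g '' (g.symm '' A) = A := by
  rw [← image_comp]
  exact (image_congr fun x _ => by simp).trans (image_id' A)

theorem mem_cl_image_iff (hq : IsQuasiminimal L cl) (g : M ≃[L] M) {A : Set M} {x : M} :
    g x ∈ cl (g '' A) ↔ x ∈ cl A := by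
  refine ⟨fun h => ?_, mem_cl_aut hq g⟩
  have := mem_cl_aut hq g.symm h
  rwa [g.symm_apply_apply, image_symm_image] at this

theorem image_cl (hq : IsQuasiminimal L cl) (g : M ≃[L] M) (A : Set M) :
    g '' cl A = cl (g '' A) := by
  ext x
  constructor
  · rintro ⟨y, hy, rfl⟩
    exact mem_cl_aut hq g hy
  · intro hx
    refine ⟨g.symm x, ?_, g.apply_symm_apply x⟩
    rwa [← mem_cl_image_iff hq g, g.apply_symm_apply]

theorem rk_image (hq : IsQuasiminimal L cl) (g : M ≃[L] M) (A : Set M) {C : Set M}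
    (hC : C.Finite) : rk cl (g '' A) (g '' C) = rk cl A C := by
  have hcl := hq.pregeometry
  induction C, hC using Set.Finite.induction_on with
  | empty => simp [rk_empty]
  | @insert x C _ hC ih =>
    rw [image_insert_eq]
    have hx := mem_cl_image_iff hq g (A := A ∪ C) (x := x)
    rw [image_union] at hx
    by_cases h : x ∈ cl (A ∪ C)
    · rw [rk_insert_of_mem hcl h, rk_insert_of_mem hcl (hx.2 h), ih]
    · rw [rk_insert_of_notMem hcl hC h, rk_insert_of_notMem hcl (hC.image _) (mt hx.1 h), ih]

theorem image_eq_self {g : M ≃[L] M} {A : Set M} (h : ∀ y ∈ A, g y = y) : g '' A = A := by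
  rw [image_congr h, image_id']

/-- All points outside the closure of a countable set are conjugate over the closure. -/
theorem exists_aut_of_notMem (hM : IsMonster L cl δ) {A : Set M} (hA : A.Countable) {x x' : M}
    (hx : x ∉ cl A) (hx' : x' ∉ cl A) : ∃ g : M ≃[L] M, (∀ y ∈ cl A, g y = y) ∧ g x = x' := by
  have hq := hM.quasiminimal
  let R : Set (M × M) := (fun y => (y, y)) '' cl A
  have h1 : Prod.fst '' R = cl A := by rw [← image_comp]; exact image_id _
  have h2 : Prod.snd '' R = cl A := by rw [← image_comp]; exact image_id _
  have hc : R.Countable := (countable_cl hq hA).image _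
  have hR : PartIso L R := by
    refine (partIso_aut (FirstOrder.Language.Equiv.refl L M)).mono ?_
    rintro _ ⟨y, -, rfl⟩
    exact FirstOrder.Language.Equiv.refl_apply y
  have hd : cl (Prod.fst '' R) = Prod.fst '' R := by rw [h1, cl.idempotent]
  have hr : cl (Prod.snd '' R) = Prod.snd '' R := by rw [h2, cl.idempotent]
  have := hR.insert_of_notMem hq hc hd hr (a := x) (a' := x') (by rwa [h1]) (by rwa [h2])
  rw [← union_singleton] at this
  obtain ⟨g, hg⟩ := this.exists_aut hM hc (Or.inl hd) (Or.inl hr) (finite_singleton _)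
  exact ⟨g, fun y hy => hg (y, y) (Or.inl ⟨y, hy, rfl⟩), hg (x, x') (Or.inr rfl)⟩

/-- Extension property: every finite set has a conjugate over the countable set `A` which is free
over `A` from a given small set. -/
theorem exists_free (hM : IsMonster L cl δ) {A D : Set M} (hA : A.Countable) (hAD : A ⊆ D)
    (hD : #D < δ) {C : Set M} (hC : C.Finite) :
    ∃ g : M ≃[L] M, (∀ y ∈ cl A, g y = y) ∧ rk cl D (g '' C) = rk cl A C := by
  have hq := hM.quasiminimal
  have hcl := hq.pregeometry
  induction C, hC using Set.Finite.induction_on with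
  | empty => exact ⟨FirstOrder.Language.Equiv.refl L M, by simp, by simp [rk_empty]⟩
  | @insert x C _ hC ih =>
    obtain ⟨g, hgA, hg⟩ := ih
    have hgA' : g '' A = A := image_eq_self fun y hy => hgA y (subset_cl cl A hy)
    have hmem : g x ∈ cl (A ∪ g '' C) ↔ x ∈ cl (A ∪ C) := by
      have := mem_cl_image_iff hq g (A := A ∪ C) (x := x)
      rwa [image_union, hgA'] at this
    by_cases hx : x ∈ cl (A ∪ C)
    · refine ⟨g, hgA, ?_⟩
      rw [image_insert_eq, rk_insert_of_mem hcl hx, rk_insert_of_mem hcl, hg]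
      exact cl_mono cl (union_subset_union_left _ hAD) (hmem.2 hx)
    · obtain ⟨y, hy⟩ := exists_notMem_cl hM
        (mk_union_lt hM hD (mk_lt_of_countable hM (hC.image g).countable))
      obtain ⟨h, hh, hhx⟩ := exists_aut_of_notMem hM (A := A ∪ g '' C)
        (hA.union (hC.image g).countable) (mt hmem.1 hx)
        (fun h => hy (cl_mono cl (union_subset_union_left _ hAD) h))
      have himage : h.comp g '' C = g '' C := by
        rw [show (h.comp g : M → M) = h ∘ g from rfl, image_comp]
        exact image_eq_self fun z hz => hh z (subset_cl cl _ (Or.inr hz))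
      refine ⟨h.comp g, fun z hz => ?_, ?_⟩
      · rw [FirstOrder.Language.Equiv.comp_apply, hgA z hz]
        exact hh z (cl_mono cl subset_union_left hz)
      · rw [image_insert_eq, himage, FirstOrder.Language.Equiv.comp_apply, hhx,
          rk_insert_of_notMem hcl hC hx, rk_insert_of_notMem hcl (hC.image g) hy, hg]

theorem dim_ne_top (hcl : IsPregeometry cl) {F : Set M} (hF : F.Finite) : dim cl F ≠ ⊤ := by
  rw [dim_eq_eRk hcl]
  exact ((Matroid.eRk_le_encard _ _).trans_lt hF.encard_lt_top).ne

theorem exists_mem_notMem_cl (hcl : IsPregeometry cl) {N F : Set M} (hN : dim cl N = ⊤)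
    (hF : F.Finite) : ∃ x ∈ N, x ∉ cl F := by
  by_contra! h
  refine dim_ne_top hcl hF (top_le_iff.1 ?_)
  rw [← hN, ← dim_cl hcl F]
  exact dim_mono h

/-- A finite set `D` which is free from `C` over `A` can be moved over `A ∪ C` into a model which
is free from `C` over `A`. -/
theorem exists_aut_subset_model (hM : IsMonster L cl δ) {N A C : Set M}
    (hN : (monster L cl).IsModel N) (hA : A.Finite) (hAN : A ⊆ N) (hC : C.Finite)
    (hNC : rk cl N C = rk cl A C) {D : Set M} (hD : D.Finite)
    (hDC : rk cl (A ∪ C) D = rk cl A D) :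
    ∃ g : M ≃[L] M, (∀ y ∈ A ∪ C, g y = y) ∧ g '' D ⊆ N := by
  have hq := hM.quasiminimal
  have hcl := hq.pregeometry
  induction D, hD using Set.Finite.induction_on with
  | empty => exact ⟨FirstOrder.Language.Equiv.refl L M, by simp, by simp⟩
  | @insert y D _ hD ih =>
    have h1 := rk_anti' hcl (subset_union_left : A ⊆ A ∪ C) hD
    have h2 := rk_anti' hcl (union_subset_union_left D (subset_union_left : A ⊆ A ∪ C))
      (finite_singleton y)
    rw [← union_singleton, rk_union hcl _ hD (finite_singleton y),
      rk_union hcl _ hD (finite_singleton y)] at hDC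
    obtain ⟨g, hg, hgD⟩ := ih (by omega)
    have hgA : g '' A = A := image_eq_self fun y hy => hg y (Or.inl hy)
    have hgAC : g '' (A ∪ C) = A ∪ C := image_eq_self hg
    have hAgD : A ∪ g '' D ⊆ N := union_subset hAN hgD
    by_cases hy : y ∈ cl (A ∪ D)
    · refine ⟨g, hg, ?_⟩
      rw [image_insert_eq]
      refine insert_subset ?_ hgD
      rw [← hN.1]
      refine cl_mono cl hAgD ?_
      rwa [← hgA, ← image_union, mem_cl_image_iff hq]
    · have hy' : y ∉ cl (A ∪ C ∪ D) := fun h => hy (by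
        have h3 := (rk_eq_zero_iff hcl (finite_singleton y)).2 (singleton_subset_iff.2 h)
        have h4 : rk cl (A ∪ D) {y} = 0 := by omega
        exact singleton_subset_iff.1 ((rk_eq_zero_iff hcl (finite_singleton y)).1 h4))
      obtain ⟨z, hzN, hz⟩ := exists_mem_notMem_cl hcl hN.2 (hA.union (hD.image g))
      have hz' : z ∉ cl (A ∪ C ∪ g '' D) := fun h => hz (by
        have h3 : rk cl (A ∪ g '' D ∪ C) {z} = 0 :=
          (rk_eq_zero_iff hcl (finite_singleton z)).2
            (singleton_subset_iff.2 (by rwa [union_right_comm]))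
        have h4 := rk_symm hcl (A ∪ g '' D) hC (finite_singleton z)
        have h5 : rk cl N C ≤ rk cl (A ∪ g '' D ∪ {z}) C :=
          rk_anti' hcl (union_subset hAgD (singleton_subset_iff.2 hzN)) hC
        have h6 : rk cl (A ∪ g '' D) C ≤ rk cl A C := rk_anti' hcl subset_union_left hC
        have h7 : rk cl (A ∪ g '' D) {z} = 0 := by omega
        exact singleton_subset_iff.1 ((rk_eq_zero_iff hcl (finite_singleton z)).1 h7))
      obtain ⟨h, hh, hhy⟩ := exists_aut_of_notMem hM (A := A ∪ C ∪ g '' D)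
        ((hA.union hC).union (hD.image g)).countable (x := g y) (x' := z) (by
          rwa [← hgAC, ← image_union, mem_cl_image_iff hq]) hz'
      refine ⟨h.comp g, fun w hw => ?_, ?_⟩
      · rw [FirstOrder.Language.Equiv.comp_apply, hg w hw]
        exact hh w (subset_cl cl _ (Or.inl hw))
      · rintro _ ⟨w, rfl | hw, rfl⟩
        · rwa [FirstOrder.Language.Equiv.comp_apply, hhy]
        · rw [FirstOrder.Language.Equiv.comp_apply,
            hh _ (subset_cl cl _ (Or.inr (mem_image_of_mem g hw)))]
          exact hgD (mem_image_of_mem g hw)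

theorem rk_le_ncard (hcl : IsPregeometry cl) (A : Set M) {B : Set M} (hB : B.Finite) :
    rk cl A B ≤ B.ncard := by
  induction B, hB using Set.Finite.induction_on with
  | empty => simp [rk_empty]
  | @insert x B hx hB ih =>
    rw [ncard_insert_of_notMem hx hB]
    exact (rk_insert_le hcl hB x).trans (by omega)

/-- Conjugate sets that are independent over `A` are conjugate over `A`. -/
theorem exists_aut_of_indep (hM : IsMonster L cl δ) {A B : Set M} (hA : A.Finite) (hB : B.Finite)
    (k : M ≃[L] M) (hAB : rk cl A B = B.ncard) (hAk : rk cl A (k '' B) = B.ncard) :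
    ∃ g : M ≃[L] M, (∀ y ∈ A, g y = y) ∧ ∀ x ∈ B, g x = k x := by
  have hq := hM.quasiminimal
  have hcl := hq.pregeometry
  induction B, hB using Set.Finite.induction_on with
  | empty => exact ⟨FirstOrder.Language.Equiv.refl L M, by simp, by simp⟩
  | @insert x B hxB hB ih =>
    have hx : x ∉ cl (A ∪ B) := fun hx => by
      rw [rk_insert_of_mem hcl hx, ncard_insert_of_notMem hxB hB] at hAB
      have := rk_le_ncard hcl A hB
      omega
    have hkB : (k '' B).ncard = B.ncard := ncard_image_of_injective B k.injective
    rw [image_insert_eq] at hAk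
    have hkx : k x ∉ cl (A ∪ k '' B) := fun hx => by
      rw [rk_insert_of_mem hcl hx, ncard_insert_of_notMem hxB hB, ← hkB] at hAk
      have := rk_le_ncard hcl A (hB.image k)
      omega
    rw [rk_insert_of_notMem hcl hB hx, ncard_insert_of_notMem hxB hB] at hAB
    rw [rk_insert_of_notMem hcl (hB.image k) hkx, ncard_insert_of_notMem hxB hB] at hAk
    obtain ⟨g, hgA, hgB⟩ := ih (by omega) (by omega)
    have hgA' : g '' A = A := image_eq_self hgA
    have hgB' : g '' B = k '' B := image_congr hgB
    have hmem := mem_cl_image_iff hq g (A := A ∪ B) (x := x)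
    rw [image_union, hgA', hgB'] at hmem
    obtain ⟨h, hh, hhx⟩ := exists_aut_of_notMem hM (A := A ∪ k '' B)
      (hA.union (hB.image k)).countable (x := g x) (x' := k x) (mt hmem.1 hx) hkx
    refine ⟨h.comp g, fun y hy => ?_, ?_⟩
    · rw [FirstOrder.Language.Equiv.comp_apply, hgA y hy]
      exact hh y (subset_cl cl _ (Or.inl hy))
    · rintro y (rfl | hy)
      · rw [FirstOrder.Language.Equiv.comp_apply, hhx]
      · rw [FirstOrder.Language.Equiv.comp_apply, hgB y hy]
        exact hh _ (subset_cl cl _ (Or.inr (mem_image_of_mem k hy)))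

end Extension

/-! ### Stationary types -/

section Stationary

variable {L : FirstOrder.Language.{v, w}} {M : Type u} [L.Structure M]
variable {cl : ClosureOperator (Set M)} {δ : Cardinal.{u}}

theorem sameGalois_iff {A : Set M} {n : ℕ} {a b : Fin n → M} :
    (monster L cl).SameGalois A a b ↔
      ∃ g : M ≃[L] M, (∀ y ∈ A, g y = y) ∧ ∀ i, g (a i) = b i := Iff.rfl

theorem SameGalois.refl (A : Set M) {n : ℕ} (a : Fin n → M) :
    (monster L cl).SameGalois A a a :=
  sameGalois_iff.2 ⟨FirstOrder.Language.Equiv.refl L M, by simp, by simp⟩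

theorem SameGalois.symm {A : Set M} {n : ℕ} {a b : Fin n → M}
    (h : (monster L cl).SameGalois A a b) : (monster L cl).SameGalois A b a := by
  obtain ⟨g, hg, hab⟩ := sameGalois_iff.1 h
  refine sameGalois_iff.2 ⟨g.symm, fun y hy => ?_, fun i => ?_⟩
  · rw [← hg y hy, g.symm_apply_apply, hg y hy]
  · rw [← hab i, g.symm_apply_apply]

theorem SameGalois.trans {A : Set M} {n : ℕ} {a b c : Fin n → M}
    (h : (monster L cl).SameGalois A a b) (h' : (monster L cl).SameGalois A b c) :
    (monster L cl).SameGalois A a c := by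
  obtain ⟨g, hg, hab⟩ := sameGalois_iff.1 h
  obtain ⟨k, hk, hbc⟩ := sameGalois_iff.1 h'
  exact sameGalois_iff.2 ⟨k.comp g, fun y hy => by simp [hg y hy, hk y hy],
    fun i => by simp [hab i, hbc i]⟩

theorem SameGalois.mono {A B : Set M} (hAB : A ⊆ B) {n : ℕ} {a b : Fin n → M}
    (h : (monster L cl).SameGalois B a b) : (monster L cl).SameGalois A a b := by
  obtain ⟨g, hg, hab⟩ := sameGalois_iff.1 h
  exact sameGalois_iff.2 ⟨g, fun y hy => hg y (hAB hy), hab⟩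

theorem SameGalois.map (g : M ≃[L] M) {A : Set M} {n : ℕ} {a b : Fin n → M}
    (h : (monster L cl).SameGalois A a b) :
    (monster L cl).SameGalois (g '' A) (fun i => g (a i)) (fun i => g (b i)) := by
  obtain ⟨k, hk, hab⟩ := sameGalois_iff.1 h
  refine sameGalois_iff.2 ⟨g.comp (k.comp g.symm), ?_, fun i => by simp [hab i]⟩
  rintro _ ⟨y, hy, rfl⟩
  simp [hk y hy]

theorem sameGalois_aut (g : M ≃[L] M) {A : Set M} (hg : ∀ y ∈ A, g y = y) {n : ℕ}
    (a : Fin n → M) : (monster L cl).SameGalois A (fun i => g (a i)) a :=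
  SameGalois.symm (sameGalois_iff.2 ⟨g, hg, fun _ => rfl⟩)

theorem sameType_iff {A : Set M} (hA : A.Finite) {n : ℕ} {a b : Fin n → M} :
    (monster L cl).SameType A a b ↔ (monster L cl).SameGalois A a b :=
  ⟨fun h => h A le_rfl hA, fun h _ hB _ => SameGalois.mono hB h⟩

theorem range_aut (g : M ≃[L] M) {n : ℕ} (a : Fin n → M) :
    range (fun i => g (a i)) = g '' range a := by
  rw [← range_comp]; rfl

theorem rk_sameGalois (hq : IsQuasiminimal L cl) {A : Set M} {n : ℕ} {a b : Fin n → M}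
    (h : (monster L cl).SameGalois A a b) : rk cl A (range a) = rk cl A (range b) := by
  obtain ⟨g, hg, hab⟩ := sameGalois_iff.1 h
  rw [← rk_image hq g A (finite_range a), image_eq_self hg, ← range_aut, funext hab]

variable (L cl) in
/-- The type of the finite tuple `c` over the finite set `A` is stationary: over every larger
finite set it has at most one extension of the same dimension. -/
def Stationary (A : Set M) {n : ℕ} (c : Fin n → M) : Prop :=
  ∀ D : Set M, D.Finite → A ⊆ D → ∀ x y : Fin n → M,
    (monster L cl).SameGalois A x c → (monster L cl).SameGalois A y c →
      rk cl D (range x) = rk cl A (range c) → rk cl D (range y) = rk cl A (range c) →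
        (monster L cl).SameGalois D x y

/-- A failure of stationarity over a finite subset `A` of a model `N` which is free from `c` over
`A` is visible inside `N`: conjugate tuples of `N` have different types over `c`. -/
theorem exists_of_not_stationary (hM : IsMonster L cl δ) {N A B : Set M} {n : ℕ} {c : Fin n → M}
    (hN : (monster L cl).IsModel N) (hA : A.Finite) (hAN : A ⊆ N)
    (hNc : rk cl N (range c) = rk cl A (range c)) (hB : B.Finite)
    (hNB : ∀ D, D.Finite → A ⊆ D → D ⊆ N → rk cl D B = B.ncard)
    (h : ¬ Stationary L cl A c) :
    ∃ (m : ℕ) (d₀ d₁ : Fin m → M), range d₀ ⊆ N ∧ range d₁ ⊆ N ∧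
      (∃ k : M ≃[L] M, (∀ y ∈ A, k y = y) ∧ (∀ y ∈ B, k y = y) ∧ ∀ i, k (d₀ i) = d₁ i) ∧
      ¬ ∃ k : M ≃[L] M, (∀ y ∈ A, k y = y) ∧ (∀ i, k (c i) = c i) ∧ ∀ i, k (d₀ i) = d₁ i := by
  have hq := hM.quasiminimal
  have hcl := hq.pregeometry
  simp only [Stationary, not_forall] at h
  obtain ⟨D, hD, hAD, x, y, hx, hy, hxr, hyr, hxy⟩ := h
  obtain ⟨m, d, hd⟩ := exists_fin_range hD
  -- a realization which is free from `D` can be moved to `c` in such a way that `D` lands in `N`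
  have key : ∀ z : Fin n → M, (monster L cl).SameGalois A z c →
      rk cl D (range z) = rk cl A (range c) →
      ∃ p : M ≃[L] M, (∀ y ∈ A, p y = y) ∧ (∀ i, p (z i) = c i) ∧ p '' D ⊆ N := by
    intro z hz hzr
    obtain ⟨g, hgA, hgz⟩ := sameGalois_iff.1 hz
    have hAgD : A ⊆ g '' D := fun w hw => ⟨w, hAD hw, hgA w hw⟩
    have h1 : rk cl (g '' D) (range c) = rk cl A (range c) := by
      rw [← hzr, ← rk_image hq g D (finite_range z), ← range_aut, funext hgz]
    have h2 := rk_symm hcl A (finite_range c) (hD.image g)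
    rw [union_eq_self_of_subset_left hAgD, h1] at h2
    obtain ⟨k, hk, hkN⟩ := exists_aut_subset_model hM hN hA hAN (finite_range c) hNc
      (hD.image g) (by omega)
    refine ⟨k.comp g, fun w hw => ?_, fun i => ?_, ?_⟩
    · rw [FirstOrder.Language.Equiv.comp_apply, hgA w hw, hk w (Or.inl hw)]
    · rw [FirstOrder.Language.Equiv.comp_apply, hgz i, hk _ (Or.inr (mem_range_self i))]
    · rw [← image_comp] at hkN
      exact hkN
  obtain ⟨p, hpA, hpx, hpN⟩ := key x hx hxr
  obtain ⟨q, hqA, hqy, hqN⟩ := key y hy hyr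
  have hdD : ∀ i, d i ∈ D := fun i => hd ▸ mem_range_self i
  refine ⟨m, fun i => p (d i), fun i => q (d i), ?_, ?_, ?_, ?_⟩
  · rwa [range_aut, hd]
  · rwa [range_aut, hd]
  · have hApD : A ⊆ p '' D := fun w hw => ⟨w, hAD hw, hpA w hw⟩
    have hAqD : A ⊆ q '' D := fun w hw => ⟨w, hAD hw, hqA w hw⟩
    -- `r` need not fix `B`, but `B` is independent over both copies of `D`
    let r : M ≃[L] M := q.comp p.symm
    have hrD : r '' (p '' D) = q '' D := by
      rw [← image_comp]
      exact image_congr fun w _ => by simp [r]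
    have h1 : rk cl (q '' D) (r '' B) = B.ncard := by
      rw [← hrD, rk_image hq r _ hB]
      exact hNB _ (hD.image p) hApD hpN
    have hc : (r '' B).ncard = B.ncard := ncard_image_of_injective B r.injective
    obtain ⟨g, hgD, hgB⟩ := exists_aut_of_indep hM (hD.image q) (hB.image r) r.symm
      (h1.trans hc.symm)
      (by rw [image_symm_image, hc]; exact hNB _ (hD.image q) hAqD hqN)
    have hrA : ∀ y ∈ A, r y = y := fun y hy => by
      have : p.symm y = y := by rw [← hpA y hy, p.symm_apply_apply, hpA y hy]
      rw [FirstOrder.Language.Equiv.comp_apply, this, hqA y hy]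
    refine ⟨g.comp r, fun y hy => ?_, fun y hy => ?_, fun i => ?_⟩
    · rw [FirstOrder.Language.Equiv.comp_apply, hrA y hy, hgD y (hAqD hy)]
    · rw [FirstOrder.Language.Equiv.comp_apply, hgB _ (mem_image_of_mem r hy),
        r.symm_apply_apply]
    · have : r (p (d i)) = q (d i) := by simp [r]
      rw [FirstOrder.Language.Equiv.comp_apply, this, hgD _ (mem_image_of_mem q (hdD i))]
  · rintro ⟨k, hkA, hkc, hkd⟩
    refine hxy (sameGalois_iff.2 ⟨q.symm.comp (k.comp p), ?_, fun i => ?_⟩)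
    · rw [← hd]
      rintro _ ⟨i, rfl⟩
      simp [hkd i]
    · rw [FirstOrder.Language.Equiv.comp_apply, FirstOrder.Language.Equiv.comp_apply, hpx i, hkc i,
        ← hqy i, q.symm_apply_apply]

/-- In a countable model free from `c` over a finite set there is a larger finite set over which
the type of `c` is stationary. Otherwise one builds, by finite approximations, an automorphism of
the model fixing a basis of `c`, all of whose extensions move `c` to a tuple different from each
tuple of a countable set which is bound to contain the image of `c`. -/
theorem exists_stationary_of_countable (hM : IsMonster L cl δ) {N A₀ : Set M} {n : ℕ}
    (c : Fin n → M) (hN : (monster L cl).IsModel N) (hNc : N.Countable) (hA₀ : A₀.Finite)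
    (hAN : A₀ ⊆ N) (hrk : rk cl N (range c) = rk cl A₀ (range c)) :
    ∃ A, A.Finite ∧ A₀ ⊆ A ∧ A ⊆ N ∧ Stationary L cl A c := by
  have hq := hM.quasiminimal
  have hcl := hq.pregeometry
  by_contra! H
  obtain ⟨B, hBc, hcB, hB⟩ := exists_basis hcl A₀ (finite_range c)
  have hBfin : B.Finite := (finite_range c).subset hBc
  have hrkA : ∀ A, A.Finite → A₀ ⊆ A → A ⊆ N → rk cl N (range c) = rk cl A (range c) :=
    fun A hA h1 h2 => le_antisymm (rk_anti' hcl h2 (finite_range c))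
      (hrk ▸ rk_anti' hcl h1 (finite_range c))
  have hrkB : ∀ D, A₀ ⊆ D → D ⊆ N → rk cl D B = B.ncard := by
    intro D h1 h2
    refine le_antisymm (rk_le_ncard hcl D hBfin) ?_
    rw [← hB, ← rk_of_subset_cl hcl hBfin (finite_range c) hcB hBc, ← hrk]
    exact (rk_anti' hcl h2 (finite_range c)).trans (rk_of_subset_cl hcl hBfin (finite_range c)
      (hcB.trans (cl_mono cl (union_subset_union_left B h1))) hBc).le
  -- `good g F`: the automorphism `g` fixes the basis and extends the finite map `F`
  let good : (M ≃[L] M) → Set (M × M) → Prop :=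
    fun g F => (∀ b ∈ B, g b = b) ∧ ∀ p ∈ F, g p.1 = p.2
  -- the finite approximations: restrictions of automorphisms fixing the basis, inside `N` and
  -- extending the identity of `A₀`
  let Q : Set (M × M) → Prop := fun F => F.Finite ∧ F ⊆ N ×ˢ N ∧
    (∀ a ∈ A₀, (a, a) ∈ F) ∧ ∃ g, good g F
  have hext : ∀ F, Q F → ∀ E : Set M, E.Finite → E ⊆ N → ∃ g, good g F ∧ g '' E ⊆ N := by
    rintro F ⟨hF, hFN, hFA, g, hgB, hgF⟩ E hE hEN
    have hA1 : A₀ ⊆ Prod.fst '' F := fun a ha => ⟨_, hFA a ha, rfl⟩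
    have hA2 : A₀ ⊆ Prod.snd '' F := fun a ha => ⟨_, hFA a ha, rfl⟩
    have hF1 : Prod.fst '' F ⊆ N := by rintro _ ⟨p, hp, rfl⟩; exact (hFN hp).1
    have hF2 : Prod.snd '' F ⊆ N := by rintro _ ⟨p, hp, rfl⟩; exact (hFN hp).2
    have hgim : g '' (Prod.fst '' F) = Prod.snd '' F := by
      rw [← image_comp]; exact image_congr hgF
    have h1 : rk cl (Prod.snd '' F ∪ g '' E) B = B.ncard := by
      have h2 := rk_image hq g (Prod.fst '' F ∪ E) hBfin
      rw [image_union, hgim, image_eq_self hgB] at h2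
      rw [h2]
      exact hrkB _ (hA1.trans subset_union_left) (union_subset hF1 hEN)
    have h3 := rk_symm hcl (Prod.snd '' F) hBfin (hE.image g)
    rw [h1, hrkB _ hA2 hF2] at h3
    obtain ⟨h, hh, hhN⟩ := exists_aut_subset_model hM hN (hF.image _) hF2 hBfin
      ((hrkB N hAN le_rfl).trans (hrkB _ hA2 hF2).symm) (hE.image g) (by omega)
    refine ⟨h.comp g, ⟨fun b hb => ?_, fun p hp => ?_⟩, by rw [← image_comp] at hhN; exact hhN⟩
    · rw [FirstOrder.Language.Equiv.comp_apply, hgB b hb, hh b (Or.inr hb)]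
    · rw [FirstOrder.Language.Equiv.comp_apply, hgF p hp, hh _ (Or.inl ⟨p, hp, rfl⟩)]
  have hswap : ∀ F, Q F → Q (Prod.swap '' F) := by
    rintro F ⟨hF, hFN, hFA, g, hgB, hgF⟩
    refine ⟨hF.image _, ?_, fun a ha => ⟨_, hFA a ha, rfl⟩, g.symm, fun b hb => ?_, ?_⟩
    · rintro _ ⟨p, hp, rfl⟩
      exact ⟨(hFN hp).2, (hFN hp).1⟩
    · rw [← hgB b hb, g.symm_apply_apply, hgB b hb]
    · rintro _ ⟨p, hp, rfl⟩
      simp [← hgF p hp]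
  have hdom : ∀ F, Q F → ∀ x ∈ N, ∃ y, Q (insert (x, y) F) := by
    intro F hF x hx
    obtain ⟨g, hg, hgx⟩ := hext F hF {x} (finite_singleton x) (singleton_subset_iff.2 hx)
    refine ⟨g x, hF.1.insert _, insert_subset ⟨hx, hgx ⟨x, rfl, rfl⟩⟩ hF.2.1,
      fun a ha => Or.inr (hF.2.2.1 a ha), g, hg.1, ?_⟩
    rintro p (rfl | hp)
    exacts [rfl, hg.2 p hp]
  have hran : ∀ F, Q F → ∀ y ∈ N, ∃ x, Q (insert (x, y) F) := by
    intro F hF y hy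
    obtain ⟨x, hx⟩ := hdom _ (hswap F hF) y hy
    refine ⟨x, ?_⟩
    have := hswap _ hx
    rwa [image_insert_eq, Prod.swap_prod_mk, ← image_comp, Prod.swap_swap_eq, image_id] at this
  -- non-stationarity gives conjugate tuples `d₀`, `d₁` of different types over `c`; sending one or
  -- the other to the same tuple, at least one choice prevents `c` from being mapped to `t`
  have havoid : ∀ F, Q F → ∀ t : Fin n → M, ∃ F', F ⊆ F' ∧ Q F' ∧
      ¬ ∃ g, good g F' ∧ ∀ i, g (c i) = t i := by
    intro F hF t
    have hA1 : A₀ ⊆ Prod.fst '' F := fun a ha => ⟨_, hF.2.2.1 a ha, rfl⟩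
    have hF1 : Prod.fst '' F ⊆ N := by rintro _ ⟨p, hp, rfl⟩; exact (hF.2.1 hp).1
    have hF1fin : (Prod.fst '' F).Finite := hF.1.image _
    obtain ⟨m, d₀, d₁, hd₀, hd₁, ⟨k, hkA, hkB, hkd⟩, hno⟩ := exists_of_not_stationary hM hN
      hF1fin hF1 (hrkA _ hF1fin hA1 hF1) hBfin (fun D _ h1 h2 => hrkB D (hA1.trans h1) h2)
      (H _ hF1fin hA1 hF1)
    obtain ⟨g, ⟨hgB, hgF⟩, hgd⟩ := hext F hF (range d₁) (finite_range _) hd₁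
    have hgd' : ∀ i, g (d₁ i) ∈ N := fun i => hgd ⟨_, mem_range_self i, rfl⟩
    by_contra! hcon
    obtain ⟨g₁, hg₁, hg₁c⟩ := hcon (F ∪ range fun i => (d₁ i, g (d₁ i))) subset_union_left
      ⟨hF.1.union (finite_range _), union_subset hF.2.1 (range_subset_iff.2 fun i =>
        ⟨hd₁ (mem_range_self i), hgd' i⟩), fun a ha => Or.inl (hF.2.2.1 a ha), g, hgB, by
          rintro p (hp | ⟨i, rfl⟩)
          exacts [hgF p hp, rfl]⟩
    obtain ⟨g₂, hg₂, hg₂c⟩ := hcon (F ∪ range fun i => (d₀ i, g (d₁ i))) subset_union_left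
      ⟨hF.1.union (finite_range _), union_subset hF.2.1 (range_subset_iff.2 fun i =>
        ⟨hd₀ (mem_range_self i), hgd' i⟩), fun a ha => Or.inl (hF.2.2.1 a ha), g.comp k,
        fun b hb => by rw [FirstOrder.Language.Equiv.comp_apply, hkB b hb, hgB b hb], by
          rintro p (hp | ⟨i, rfl⟩)
          · rw [FirstOrder.Language.Equiv.comp_apply, hkA _ ⟨p, hp, rfl⟩, hgF p hp]
          · rw [FirstOrder.Language.Equiv.comp_apply, hkd i]⟩
    refine hno ⟨g₁.symm.comp g₂, ?_, fun i => ?_, fun i => ?_⟩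
    · rintro _ ⟨p, hp, rfl⟩
      rw [FirstOrder.Language.Equiv.comp_apply, hg₂.2 p (Or.inl hp), ← hg₁.2 p (Or.inl hp),
        g₁.symm_apply_apply]
    · rw [FirstOrder.Language.Equiv.comp_apply, hg₂c i, ← hg₁c i, g₁.symm_apply_apply]
    · rw [FirstOrder.Language.Equiv.comp_apply, hg₂.2 _ (Or.inr ⟨i, rfl⟩),
        ← hg₁.2 _ (Or.inr ⟨i, rfl⟩), g₁.symm_apply_apply]
  let P := {F // Q F}
  set X := cl (A₀ ∪ B) with hX
  have hXc : X.Countable := countable_cl hq (hA₀.union hBfin).countable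
  have := hNc.to_subtype
  have := hXc.to_subtype
  have hcof1 : ∀ x : N, IsCofinal {F : P | (x : M) ∈ Prod.fst '' F.1} := fun x F => by
    obtain ⟨y, hy⟩ := hdom F.1 F.2 x x.2
    exact ⟨⟨_, hy⟩, ⟨_, mem_insert _ _, rfl⟩, subset_insert _ _⟩
  have hcof2 : ∀ x : N, IsCofinal {F : P | (x : M) ∈ Prod.snd '' F.1} := fun x F => by
    obtain ⟨y, hy⟩ := hran F.1 F.2 x x.2
    exact ⟨⟨_, hy⟩, ⟨_, mem_insert _ _, rfl⟩, subset_insert _ _⟩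
  have hcof3 : ∀ t : Fin n → X, IsCofinal {F : P | ¬ ∃ g, good g F.1 ∧ ∀ i, g (c i) = t i} :=
    fun t F => by
      obtain ⟨F', hFF', hF', h⟩ := havoid F.1 F.2 fun i => t i
      exact ⟨⟨F', hF'⟩, h, hFF'⟩
  let _ : Encodable (N ⊕ N ⊕ (Fin n → X)) := Encodable.ofCountable _
  let 𝒟 : N ⊕ N ⊕ (Fin n → X) → Order.Cofinal P :=
    Sum.elim (fun x => ⟨_, hcof1 x⟩) (Sum.elim (fun x => ⟨_, hcof2 x⟩) (fun t => ⟨_, hcof3 t⟩))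
  let F₀ : P := ⟨(fun a => (a, a)) '' A₀, hA₀.image _, by
      rintro _ ⟨a, ha, rfl⟩
      exact ⟨hAN ha, hAN ha⟩, fun a ha => ⟨a, ha, rfl⟩, FirstOrder.Language.Equiv.refl L M,
      fun b _ => by simp, by rintro _ ⟨a, ha, rfl⟩; simp⟩
  let I := Order.idealOfCofinals F₀ 𝒟
  let R : Set (M × M) := ⋃ F ∈ I, F.1
  have hRN : R ⊆ N ×ˢ N := iUnion₂_subset fun F _ => F.2.2.1
  have hfst : Prod.fst '' R = N := by
    refine Subset.antisymm (by rintro _ ⟨p, hp, rfl⟩; exact (hRN hp).1) fun x hx => ?_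
    obtain ⟨F, ⟨p, hp, hpx⟩, hF⟩ := Order.cofinal_meets_idealOfCofinals F₀ 𝒟 (Sum.inl ⟨x, hx⟩)
    exact ⟨p, mem_biUnion hF hp, hpx⟩
  have hsnd : Prod.snd '' R = N := by
    refine Subset.antisymm (by rintro _ ⟨p, hp, rfl⟩; exact (hRN hp).2) fun x hx => ?_
    obtain ⟨F, ⟨p, hp, hpx⟩, hF⟩ :=
      Order.cofinal_meets_idealOfCofinals F₀ 𝒟 (Sum.inr (Sum.inl ⟨x, hx⟩))
    exact ⟨p, mem_biUnion hF hp, hpx⟩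
  let R₁ : Set (M × M) := (fun b => (b, b)) '' B
  have hR : PartIso L (R ∪ R₁) := fun m s hs => by
    obtain ⟨F, -, hF⟩ := exists_mem_ideal I (f := fun F : P => F.1) (fun _ _ h => h) R₁
      (finite_range s) (range_subset_iff.2 fun i => (hs i).symm)
    obtain ⟨g, hgB, hgF⟩ := F.2.2.2.2
    refine partIso_aut g m s fun i => ?_
    rcases hF (mem_range_self i) with ⟨b, hb, h⟩ | h
    · rw [← h]; exact hgB b hb
    · exact hgF _ h
  obtain ⟨g, hg⟩ := hR.exists_aut hM ((hNc.prod hNc).mono hRN) (Or.inl (by rw [hfst, hN.1]))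
    (Or.inl (by rw [hsnd, hN.1])) (hBfin.image _)
  -- the image of `c` lies in the countable set `X`, but all tuples of `X` have been avoided
  have hgX : ∀ i, g (c i) ∈ X := fun i => by
    have h1 : g '' (A₀ ∪ B) = A₀ ∪ B := image_eq_self fun y hy => by
      rcases hy with hy | hy
      · exact hg (y, y) (Or.inl (mem_biUnion (Order.mem_idealOfCofinals F₀ 𝒟) ⟨y, hy, rfl⟩))
      · exact hg (y, y) (Or.inr ⟨y, hy, rfl⟩)
    rw [hX, ← h1]
    exact mem_cl_aut hq g (hcB (mem_range_self i))
  obtain ⟨F, hF, hFI⟩ := Order.cofinal_meets_idealOfCofinals F₀ 𝒟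
    (Sum.inr (Sum.inr fun i => ⟨g (c i), hgX i⟩))
  exact hF ⟨g, ⟨fun b hb => hg (b, b) (Or.inr ⟨b, hb, rfl⟩),
    fun p hp => hg p (Or.inl (mem_biUnion hFI hp))⟩, fun i => rfl⟩

theorem isModel_univ (hq : IsQuasiminimal L cl) : (monster L cl).IsModel univ :=
  ⟨eq_univ_of_univ_subset (subset_cl cl univ), hq.qm2⟩

theorem dim_image_le (hq : IsQuasiminimal L cl) (g : M ≃[L] M) (Y : Set M) :
    dim cl Y ≤ dim cl (g '' Y) := by
  refine iSup_le fun I => iSup_le fun hI => iSup_le fun hind => ?_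
  have : IsIndepSet cl (g '' I) := by
    rintro _ ⟨y, hy, rfl⟩ h
    rw [← image_singleton, ← image_sdiff g.injective, mem_cl_image_iff hq] at h
    exact hind y hy h
  rw [← g.injective.encard_image I]
  exact le_iSup_of_le _ (le_iSup_of_le (image_mono hI)
    (le_iSup (fun _ : IsIndepSet cl (g '' I) => (g '' I).encard) this))

theorem isModel_image (hq : IsQuasiminimal L cl) (g : M ≃[L] M) {N : Set M}
    (hN : (monster L cl).IsModel N) : (monster L cl).IsModel (g '' N) :=
  ⟨by rw [← image_cl hq, hN.1], top_le_iff.1 (hN.2.symm.le.trans (dim_image_le hq g N))⟩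

theorem isModel_cl_insert {N : Set M} (hN : (monster L cl).IsModel N)
    (x : M) : (monster L cl).IsModel (cl (insert x N)) :=
  ⟨cl.idempotent _, top_le_iff.1 (hN.2.symm.le.trans
    (dim_mono ((subset_insert x N).trans (subset_cl cl _))))⟩

theorem exists_countable_model (hq : IsQuasiminimal L cl) {N A : Set M}
    (hN : (monster L cl).IsModel N) (hA : A.Countable) (hAN : A ⊆ N) :
    ∃ N' ⊆ N, A ⊆ N' ∧ N'.Countable ∧ (monster L cl).IsModel N' := by
  have h : ∀ n : ℕ, ∃ I ⊆ N, IsIndepSet cl I ∧ I.encard = n := fun n => by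
    have hlt : (n : ℕ∞) < dim cl N := by rw [hN.2]; exact ENat.natCast_lt_top n
    simp only [dim, lt_iSup_iff] at hlt
    obtain ⟨J, hJN, hJ, hn⟩ := hlt
    obtain ⟨I, hIJ, hI⟩ := exists_subset_encard_eq hn.le
    exact ⟨I, hIJ.trans hJN, fun y hy h => hJ y (hIJ hy)
      (cl_mono cl (sdiff_subset_sdiff_left hIJ) h), hI⟩
  choose I hIN hI hIn using h
  have hIfin : ∀ n, (I n).Finite := fun n => finite_of_encard_eq_coe (hIn n)
  refine ⟨cl (A ∪ ⋃ n, I n), ?_, subset_union_left.trans (subset_cl cl _),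
    countable_cl hq (hA.union (countable_iUnion fun n => (hIfin n).countable)),
    cl.idempotent _, ENat.eq_top_iff_forall_ge.2 fun n => ?_⟩
  · rw [← hN.1]
    exact cl_mono cl (union_subset hAN (iUnion_subset hIN))
  · rw [← hIn n]
    have : I n ⊆ cl (A ∪ ⋃ n, I n) :=
      ((subset_iUnion I n).trans subset_union_right).trans (subset_cl cl _)
    exact le_iSup_of_le _ (le_iSup_of_le this
      (le_iSup (fun _ : IsIndepSet cl (I n) => (I n).encard) (hI n)))

/-- Every finite set is free, over a given finite set, from some model. -/
theorem exists_free_model (hM : IsMonster L cl δ) {A C : Set M} (hA : A.Finite) (hC : C.Finite) :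
    ∃ N, A ⊆ N ∧ N.Countable ∧ (monster L cl).IsModel N ∧ rk cl N C = rk cl A C := by
  have hq := hM.quasiminimal
  obtain ⟨N, -, hAN, hNc, hN⟩ := exists_countable_model hq (isModel_univ hq) hA.countable
    (subset_univ A)
  obtain ⟨g, hgA, hg⟩ := exists_free hM hA.countable hAN (mk_lt_of_countable hM hNc) hC
  refine ⟨g.symm '' N, fun a ha => ⟨a, hAN ha, ?_⟩, hNc.image _, isModel_image hq _ hN, ?_⟩
  · conv_lhs => rw [← hgA a (subset_cl cl A ha)]
    exact g.symm_apply_apply a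
  · rw [← rk_image hq g _ hC, image_image_symm, hg]

/-- Over a large enough finite subset of a model the type of a tuple which is free from the model is
stationary. -/
theorem exists_stationary (hM : IsMonster L cl δ) {N A₀ : Set M} {n : ℕ} (c : Fin n → M)
    (hN : (monster L cl).IsModel N) (hA₀ : A₀.Finite) (hAN : A₀ ⊆ N)
    (hrk : rk cl N (range c) = rk cl A₀ (range c)) :
    ∃ A, A.Finite ∧ A₀ ⊆ A ∧ A ⊆ N ∧ Stationary L cl A c := by
  have hcl := hM.quasiminimal.pregeometry
  obtain ⟨N', hN'N, hAN', hN'c, hN'⟩ := exists_countable_model hM.quasiminimal hN hA₀.countable hAN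
  obtain ⟨A, hA, h1, h2, h3⟩ := exists_stationary_of_countable hM c hN' hN'c hA₀ hAN'
    (le_antisymm (rk_anti' hcl hAN' (finite_range c))
      (hrk ▸ rk_anti' hcl hN'N (finite_range c)))
  exact ⟨A, hA, h1, h2.trans hN'N, h3⟩

/-- Every finite set can be moved into a given model over a finite subset of the model. -/
theorem exists_aut_subset_model' (hM : IsMonster L cl δ) {N A : Set M}
    (hN : (monster L cl).IsModel N) (hA : A.Finite) (hAN : A ⊆ N) {D : Set M} (hD : D.Finite) :
    ∃ g : M ≃[L] M, (∀ y ∈ A, g y = y) ∧ g '' D ⊆ N := by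
  obtain ⟨g, hg, hgN⟩ := exists_aut_subset_model hM hN hA hAN finite_empty
    (by simp [rk_empty]) hD (by rw [union_empty])
  exact ⟨g, fun y hy => hg y (Or.inl hy), hgN⟩

theorem stationary_singleton (hM : IsMonster L cl δ) {A : Set M} {x : M} (hx : x ∉ cl A) :
    Stationary L cl A ![x] := by
  have hcl := hM.quasiminimal.pregeometry
  have hr : ∀ (D : Set M) (y : Fin 1 → M), range y = insert (y 0) ∅ := fun D y => by
    ext z; simp [Fin.exists_fin_one, eq_comm]
  have h1 : rk cl A (range ![x]) = 1 := by
    rw [hr A ![x], rk_insert_of_notMem hcl finite_empty (by simpa using hx), rk_empty]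
  intro D hD hAD y z _ _ hyr hzr
  have key : ∀ y : Fin 1 → M, rk cl D (range y) = rk cl A (range ![x]) → y 0 ∉ cl D := by
    intro y hyr hy
    rw [h1, hr D y, rk_insert_of_mem hcl (by simpa using hy), rk_empty] at hyr
    omega
  obtain ⟨g, hg, hgy⟩ := exists_aut_of_notMem hM hD.countable (key y hyr) (key z hzr)
  exact sameGalois_iff.2 ⟨g, fun w hw => hg w (subset_cl cl D hw), fun i => by
    rw [Subsingleton.elim i 0]; exact hgy⟩

end Stationary

/-! ### U-rank and dimension -/

section URank

theorem Universe.sameGalois_append {X : Type u} (S : Universe.{u, w} X) {A : Set X} {n m : ℕ}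
    {a a' : Fin n → X} {b b' : Fin m → X} :
    S.SameGalois A (Fin.append a b) (Fin.append a' b') ↔
      ∃ g : S.Aut, (∀ y ∈ A, S.act g y = y) ∧ (∀ i, S.act g (a i) = a' i) ∧
        ∀ i, S.act g (b i) = b' i := by
  constructor
  · rintro ⟨g, hg, h⟩
    exact ⟨g, hg, fun i => by simpa using h (Fin.castAdd m i),
      fun i => by simpa using h (Fin.natAdd n i)⟩
  · rintro ⟨g, hg, h1, h2⟩
    refine ⟨g, hg, fun i => ?_⟩
    refine Fin.addCases (fun i => ?_) (fun i => ?_) i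
    · simpa using h1 i
    · simpa using h2 i

theorem Universe.UGe.mono {X : Type u} {S : Universe.{u, w} X} {n : ℕ} {a : Fin n → X} {k : ℕ}
    {A B : Set X} (hAB : A ⊆ B) (h : S.UGe a k B) : S.UGe a k A := by
  cases k with
  | zero => trivial
  | succ k =>
    obtain ⟨C, hC, hBC, hns, hk⟩ := h
    refine ⟨C, hC, hAB.trans hBC, ?_, hk⟩
    rintro ⟨F, hFA, hF, hsp⟩
    refine hns ⟨F, hFA.trans hAB, hF, ?_⟩
    rwa [union_eq_self_of_subset_left (hAB.trans hBC), ← union_eq_self_of_subset_left hBC] at hsp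

variable {L : FirstOrder.Language.{v, w}} {M : Type u} [L.Structure M]
variable {cl : ClosureOperator (Set M)} {δ : Cardinal.{u}}

theorem sameGalois_append {A : Set M} {n m : ℕ} {a a' : Fin n → M} {b b' : Fin m → M} :
    (monster L cl).SameGalois A (Fin.append a b) (Fin.append a' b') ↔
      ∃ g : M ≃[L] M, (∀ y ∈ A, g y = y) ∧ (∀ i, g (a i) = a' i) ∧ ∀ i, g (b i) = b' i :=
  (monster L cl).sameGalois_append

/-- If `c` is free from `B` over the model `A`, a finite base of stationarity witnesses that the
type of `c` over `B` does not split. -/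
theorem indepNS_of_rk_eq (hM : IsMonster L cl δ) {A B : Set M} {n : ℕ} {c : Fin n → M}
    (hA : (monster L cl).IsModel A) (hAB : A ⊆ B) (h : rk cl B (range c) = rk cl A (range c)) :
    (monster L cl).IndepNS c A B := by
  have hq := hM.quasiminimal
  have hcl := hq.pregeometry
  obtain ⟨F₀, hF₀A, hF₀, hF₀r⟩ := exists_finite_rk_eq hcl A (finite_range c)
  obtain ⟨F, hF, h0F, hFA, hst⟩ := exists_stationary hM c hA hF₀ hF₀A hF₀r.symm
  refine ⟨F, hFA, hF, ?_⟩
  rw [union_eq_self_of_subset_left hAB]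
  rintro ⟨m, b, d, hb, hd, hbd, hns⟩
  refine hns ?_
  obtain ⟨g, hgF, hgb⟩ := sameGalois_iff.1 ((sameType_iff hF).1 hbd)
  have hrF : rk cl F (range c) = rk cl A (range c) :=
    le_antisymm ((rk_anti' hcl h0F (finite_range c)).trans hF₀r.le)
      (rk_anti' hcl hFA (finite_range c))
  have hfree : ∀ b : Fin m → M, range b ⊆ B →
      rk cl (F ∪ range b) (range c) = rk cl F (range c) := fun b hb =>
    le_antisymm (rk_anti' hcl subset_union_left (finite_range c)) (by
      rw [hrF, ← h]
      exact rk_anti' hcl (union_subset (hFA.trans hAB) hb) (finite_range c))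
  have h1 : rk cl (F ∪ range d) (range fun i => g (c i)) = rk cl F (range c) := by
    rw [← hfree b hb, ← rk_image hq g (F ∪ range b) (finite_range c), image_union,
      image_eq_self hgF, ← range_aut, ← range_aut, funext hgb]
  obtain ⟨k, hk, hkc⟩ := sameGalois_iff.1 (hst (F ∪ range d) (hF.union (finite_range d))
    subset_union_left _ c (sameGalois_aut g hgF c) (SameGalois.refl F c) h1 (hfree d hd))
  refine (sameType_iff hF).2 (sameGalois_append.2 ⟨k.comp g, fun y hy => ?_, hkc, fun i => ?_⟩)
  · rw [FirstOrder.Language.Equiv.comp_apply, hgF y hy, hk y (Or.inl hy)]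
  · rw [FirstOrder.Language.Equiv.comp_apply, hgb i, hk _ (Or.inr (mem_range_self i))]

theorem sameGalois_singleton (hM : IsMonster L cl δ) {A : Set M} (hA : A.Countable) {x y : M}
    (hx : x ∉ cl A) (hy : y ∉ cl A) : (monster L cl).SameGalois A ![x] ![y] := by
  obtain ⟨g, hg, hxy⟩ := exists_aut_of_notMem hM hA hx hy
  exact sameGalois_iff.2 ⟨g, fun z hz => hg z (subset_cl cl A hz), fun i => by
    rw [Subsingleton.elim i 0]; exact hxy⟩

/-- The type of `c` over `B` splits over finite subsets of the model `A` as soon as some coordinate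
lies in `B` but not in `A`: that coordinate is conjugate to elements of `A`. -/
theorem not_indepNS (hM : IsMonster L cl δ) {A B : Set M} {n : ℕ} {c : Fin n → M}
    (hA : (monster L cl).IsModel A) {i : Fin n} (hiA : c i ∉ A) (hiB : c i ∈ B) :
    ¬ (monster L cl).IndepNS c A B := by
  rintro ⟨F, hFA, hF, hns⟩
  obtain ⟨x, hxA, hx⟩ := exists_mem_notMem_cl hM.quasiminimal.pregeometry hA.2 hF
  have hci : c i ∉ cl F := fun h => hiA (by rw [← hA.1]; exact cl_mono cl hFA h)
  refine hns ⟨1, ![x], ![c i], ?_, ?_, (sameType_iff hF).2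
    (sameGalois_singleton hM hF.countable hx hci), fun h => ?_⟩
  · rintro _ ⟨j, rfl⟩
    rw [Subsingleton.elim j 0]
    exact Or.inl hxA
  · rintro _ ⟨j, rfl⟩
    rw [Subsingleton.elim j 0]
    exact Or.inr hiB
  · obtain ⟨g, -, hgc, hgx⟩ := sameGalois_append.1 ((sameType_iff hF).1 h)
    have h1 : g x = c i := hgx 0
    rw [← hgc i] at h1
    exact hiA (g.injective h1 ▸ hxA)

theorem uGe_iff (hM : IsMonster L cl δ) {n : ℕ} {c : Fin n → M} {k : ℕ} {A : Set M}
    (hA : (monster L cl).IsModel A) :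
    (monster L cl).UGe c k A ↔ k ≤ rk cl A (range c) := by
  have hcl := hM.quasiminimal.pregeometry
  induction k generalizing A with
  | zero => exact iff_of_true trivial (Nat.zero_le _)
  | succ k ih =>
    constructor
    · rintro ⟨B, hB, hAB, hns, hk⟩
      have h1 := (ih hB).1 hk
      have h2 := rk_anti' hcl hAB (finite_range c)
      have h3 : rk cl B (range c) ≠ rk cl A (range c) :=
        fun h => hns (indepNS_of_rk_eq hM hA hAB h)
      omega
    · intro hk
      obtain ⟨_, ⟨i, rfl⟩, hi⟩ : ∃ x ∈ range c, x ∉ cl A := by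
        by_contra! h
        rw [(rk_eq_zero_iff hcl (finite_range c)).2 h] at hk
        omega
      have hins : insert (c i) A ⊆ cl (insert (c i) A) := subset_cl cl _
      have hB := isModel_cl_insert hA (c i)
      have hAB : A ⊆ cl (insert (c i) A) := (subset_insert _ _).trans hins
      refine ⟨cl (insert (c i) A), hB, hAB, not_indepNS hM hA (i := i)
        (fun h => hi (subset_cl cl A h)) (hins (mem_insert _ _)), (ih hB).2 ?_⟩
      have h1 := rk_union hcl A (finite_singleton (c i)) (finite_range c)
      have h2 : rk cl A {c i} ≤ 1 := by simpa using rk_le_ncard hcl A (finite_singleton (c i))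
      rw [union_eq_self_of_subset_left (singleton_subset_iff.2 (mem_range_self i)),
        union_singleton] at h1
      rw [rk_congr_left (cl.idempotent _)]
      omega

theorem uModel_eq (hM : IsMonster L cl δ) {n : ℕ} (c : Fin n → M) {A : Set M}
    (hA : (monster L cl).IsModel A) :
    (monster L cl).UModel c A = rk cl A (range c) := by
  refine le_antisymm (iSup₂_le fun k hk => by exact_mod_cast (uGe_iff hM hA).1 hk) ?_
  exact le_iSup₂ (f := fun (k : ℕ) (_ : (monster L cl).UGe c k A) => (k : ℕ∞)) _
    ((uGe_iff hM hA).2 le_rfl)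

theorem uFin_eq (hM : IsMonster L cl δ) {n : ℕ} (c : Fin n → M) {A : Set M} (hA : A.Finite) :
    (monster L cl).UFin c A = rk cl A (range c) := by
  have hcl := hM.quasiminimal.pregeometry
  refine le_antisymm (iSup_le fun N => iSup₂_le fun hN hAN => ?_) ?_
  · rw [uModel_eq hM c hN]
    exact_mod_cast rk_anti' hcl hAN (finite_range c)
  · obtain ⟨N, hAN, -, hN, h⟩ := exists_free_model hM hA (finite_range c)
    rw [← h, ← uModel_eq hM c hN]
    exact le_iSup_of_le N (le_iSup₂ (f := fun (_ : (monster L cl).IsModel N) (_ : A ⊆ N) =>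
      (monster L cl).UModel c N) hN hAN)

/-- Over finite sets, the U-rank in the monster model is the dimension. -/
theorem U_eq (hM : IsMonster L cl δ) {n : ℕ} (c : Fin n → M) {A : Set M} (hA : A.Finite) :
    (monster L cl).U c A = rk cl A (range c) := by
  have hcl := hM.quasiminimal.pregeometry
  refine le_antisymm ?_ (le_iInf fun B => le_iInf₂ fun hBA hB => ?_)
  · rw [← uFin_eq hM c hA]
    exact iInf_le_of_le A (iInf₂_le le_rfl hA)
  · rw [uFin_eq hM c hB]
    exact_mod_cast rk_anti' hcl hBA (finite_range c)

theorem isGeneric_iff (hM : IsMonster L cl δ) {n : ℕ} {B : Set (Fin n → M)} {A : Set M}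
    (hA : A.Finite) {b : Fin n → M} :
    (monster L cl).IsGeneric B A b ↔
      b ∈ B ∧ ∀ c ∈ B, rk cl A (range c) ≤ rk cl A (range b) := by
  simp only [Universe.IsGeneric, U_eq hM _ hA, Nat.cast_le]

end URank

/-! ### Lascar types and free extensions -/

section FreeExtension

variable {L : FirstOrder.Language.{v, w}} {M : Type u} [L.Structure M]
variable {cl : ClosureOperator (Set M)} {δ : Cardinal.{u}}

variable (L cl) in
/-- Conjugacy over `A` of tuples of length `n`. -/
def galoisSetoid (A : Set M) (n : ℕ) : Setoid (Fin n → M) where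
  r := (monster L cl).SameGalois A
  iseqv := ⟨SameGalois.refl A, SameGalois.symm, SameGalois.trans⟩

/-- There are only countably many Galois types over a finite set. -/
theorem galoisSetoid_isBoundedInvariant (hM : IsMonster L cl δ) {A : Set M} (hA : A.Finite)
    (n : ℕ) : (monster L cl).IsBoundedInvariant δ A (galoisSetoid L cl A n) := by
  have hq := hM.quasiminimal
  refine ⟨fun g hg a b hab => ?_, ?_⟩
  · exact SameGalois.trans (sameGalois_aut g hg a)
      (SameGalois.trans hab (SameGalois.symm (sameGalois_aut g hg b)))
  -- every tuple is conjugate over `A` to a tuple of a fixed countable model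
  · obtain ⟨N, -, hAN, hNc, hN⟩ := exists_countable_model hq (isModel_univ hq) hA.countable
      (subset_univ A)
    have := hNc.to_subtype
    have hsurj : Function.Surjective
        fun t : Fin n → N => (Quotient.mk (galoisSetoid L cl A n) fun i => (t i : M)) := by
      intro q
      obtain ⟨a, rfl⟩ := Quotient.exists_rep q
      obtain ⟨g, hg, hgN⟩ := exists_aut_subset_model' hM hN hA hAN (finite_range a)
      rw [← range_aut] at hgN
      exact ⟨fun i => ⟨g (a i), hgN (mem_range_self i)⟩, Quotient.sound (sameGalois_aut g hg a)⟩
    have := hsurj.countable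
    exact (mk_le_aleph0).trans_lt hM.uncountable

/-- Over finite sets, Lascar types refine Galois types. -/
theorem SameLascar.sameGalois (hM : IsMonster L cl δ) {A : Set M} (hA : A.Finite) {n : ℕ}
    {a b : Fin n → M} (h : (monster L cl).SameLascar δ A a b) :
    (monster L cl).SameGalois A a b :=
  h A le_rfl hA _ (galoisSetoid_isBoundedInvariant hM hA n)

/-- For stationary types, having the same type implies having the same Lascar type. -/
theorem Stationary.sameLascar (hM : IsMonster L cl δ) {A : Set M} (hA : A.Finite) {n : ℕ}
    {c x : Fin n → M} (hst : Stationary L cl A c) (hx : (monster L cl).SameGalois A x c) :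
    (monster L cl).SameLascar δ A x c := by
  have hq := hM.quasiminimal
  have hcl := hq.pregeometry
  rintro A' hA'A - E ⟨hE, hEδ⟩
  replace hE : ∀ g : M ≃[L] M, (∀ y ∈ A, g y = y) → ∀ a b, E.r a b →
      E.r (fun i => g (a i)) (fun i => g (b i)) := fun g hg => hE g fun y hy => hg y (hA'A hy)
  -- a realization `u` free from a set `D` of representatives for the classes of `E`
  set D : Set M := A ∪ ⋃ q : Quotient E, range q.out with hDdef
  have hD : #D < δ := by
    refine mk_union_lt hM (mk_lt_of_countable hM hA.countable) ((mk_iUnion_le _).trans_lt ?_)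
    refine mul_lt_of_lt hM.uncountable.le hEδ ((ciSup_le' fun q => ?_).trans_lt hM.uncountable)
    exact le_aleph0_iff_set_countable.2 (countable_range _)
  obtain ⟨g, hgA, hg⟩ := exists_free hM hA.countable subset_union_left hD (finite_range c)
  replace hgA : ∀ y ∈ A, g y = y := fun y hy => hgA y (subset_cl cl A hy)
  rw [← range_aut] at hg
  set u : Fin n → M := fun i => g (c i) with hu
  have huc : (monster L cl).SameGalois A u c := sameGalois_aut g hgA c
  set t : Fin n → M := (Quotient.mk E u).out with ht
  have hut : E.r u t := E.symm' (Quotient.mk_out u)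
  have htD : A ∪ range t ⊆ D :=
    union_subset_union_right A (subset_iUnion (fun q : Quotient E => range q.out) _)
  have hrt : rk cl (A ∪ range t) (range u) = rk cl A (range c) :=
    le_antisymm (by
      rw [← rk_sameGalois hq huc]
      exact rk_anti' hcl subset_union_left (finite_range u))
      (hg ▸ rk_anti' hcl htD (finite_range u))
  -- a conjugate `u'` of `u` over the representative `t`, free from `u`
  obtain ⟨k, hk, hku⟩ := exists_free hM (A := A ∪ range t) (D := A ∪ range t ∪ range u)
    (hA.union (finite_range t)).countable subset_union_left
    (mk_lt_of_countable hM ((hA.union (finite_range t)).union (finite_range u)).countable)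
    (finite_range u)
  replace hk : ∀ y ∈ A ∪ range t, k y = y := fun y hy => hk y (subset_cl cl _ hy)
  rw [← range_aut, hrt] at hku
  set u' : Fin n → M := fun i => k (u i) with hu'
  have hu'u : (monster L cl).SameGalois A u' u := sameGalois_aut k (fun y hy => hk y (Or.inl hy)) u
  have hEu : E.r u u' := by
    have h1 := hE k (fun y hy => hk y (Or.inl hy)) _ _ hut
    have h2 : (fun i => k (t i)) = t := funext fun i => hk _ (Or.inr (mem_range_self i))
    rw [h2] at h1
    exact E.trans' hut (E.symm' h1)
  have hru' : rk cl (A ∪ range u) (range u') = rk cl A (range c) := by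
    refine le_antisymm ?_ (hku ▸ rk_anti' hcl ?_ (finite_range u'))
    · rw [← rk_sameGalois hq (SameGalois.trans hu'u huc)]
      exact rk_anti' hcl subset_union_left (finite_range u')
    · exact union_subset_union_left _ subset_union_left
  -- by stationarity all pairs of free realizations are conjugate to `(u, u')`
  have key : ∀ y z : Fin n → M, (monster L cl).SameGalois A y c →
      (monster L cl).SameGalois A z c → rk cl (A ∪ range y) (range z) = rk cl A (range c) →
      E.r y z := by
    intro y z hy hz hyz
    obtain ⟨p, hpA, hpu⟩ := sameGalois_iff.1 (SameGalois.trans huc (SameGalois.symm hy))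
    have h1 : rk cl (A ∪ range y) (range fun i => p (u' i)) = rk cl A (range c) := by
      rw [← hru', ← rk_image hq p (A ∪ range u) (finite_range u'), image_union,
        image_eq_self hpA, ← range_aut, ← range_aut, funext hpu]
    obtain ⟨r, hr, hru⟩ := sameGalois_iff.1 (hst (A ∪ range y) (hA.union (finite_range y))
      subset_union_left _ z (SameGalois.trans (sameGalois_aut p hpA u')
        (SameGalois.trans hu'u huc)) hz h1 hyz)
    have h2 := hE (r.comp p) (fun w hw => by
      rw [FirstOrder.Language.Equiv.comp_apply, hpA w hw, hr w (Or.inl hw)]) _ _ hEu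
    have h3 : (fun i => r.comp p (u i)) = y := funext fun i => by
      rw [FirstOrder.Language.Equiv.comp_apply, hpu i, hr _ (Or.inr (mem_range_self i))]
    have h4 : (fun i => r.comp p (u' i)) = z := funext hru
    rwa [h3, h4] at h2
  obtain ⟨p, hpA, hp⟩ := exists_free hM hA.countable (D := A ∪ (range x ∪ range c))
    subset_union_left (mk_lt_of_countable hM
      (hA.union ((finite_range x).union (finite_range c))).countable) (finite_range c)
  rw [← range_aut] at hp
  have hpc : (monster L cl).SameGalois A (fun i => p (c i)) c :=
    sameGalois_aut p (fun y hy => hpA y (subset_cl cl A hy)) c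
  have hfree : ∀ y : Fin n → M, range y ⊆ range x ∪ range c →
      rk cl (A ∪ range y) (range fun i => p (c i)) = rk cl A (range c) := fun y hy =>
    le_antisymm (by
      rw [← rk_sameGalois hq hpc]
      exact rk_anti' hcl subset_union_left (finite_range _))
      (hp ▸ rk_anti' hcl (union_subset_union_right A hy) (finite_range _))
  exact E.trans' (key x _ hx hpc (hfree x subset_union_left))
    (E.symm' (key c _ (SameGalois.refl A c) hpc (hfree c subset_union_right)))

/-- Free realizations of a stationary type are independent in the sense of Lascar splitting. -/
theorem Stationary.indep (hM : IsMonster L cl δ) {A : Set M} (hA : A.Finite) {n : ℕ}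
    {c z : Fin n → M} (hst : Stationary L cl A c) (hz : (monster L cl).SameGalois A z c)
    {D : Set M} (hD : D.Finite) (hzr : rk cl (A ∪ D) (range z) = rk cl A (range c)) :
    (monster L cl).Indep δ z A D := by
  have hq := hM.quasiminimal
  have hcl := hq.pregeometry
  refine ⟨A, le_rfl, hA, fun D' hD' hD'δ => ?_⟩
  have hAD := hA.union hD
  obtain ⟨g, hgA, hg⟩ := exists_free hM hAD.countable hD' hD'δ (finite_range z)
  replace hgA : ∀ y ∈ A ∪ D, g y = y := fun y hy => hgA y (subset_cl cl _ hy)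
  rw [← range_aut, hzr] at hg
  set b : Fin n → M := fun i => g (z i) with hb
  have hbz : (monster L cl).SameGalois (A ∪ D) b z := sameGalois_aut g hgA z
  have hbc : (monster L cl).SameGalois A b c := 
    SameGalois.trans (SameGalois.mono subset_union_left hbz) hz
  refine ⟨b, (sameType_iff hAD).2 hbz, ?_⟩
  rintro ⟨m, s, t, hs, ht, hst', hns⟩
  refine hns ?_
  obtain ⟨k, hkA, hk⟩ := sameGalois_iff.1 (SameLascar.sameGalois hM hA hst')
  have hfree : ∀ s : Fin m → M, range s ⊆ D' →
      rk cl (A ∪ range s) (range b) = rk cl A (range c) := fun s hs =>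
    le_antisymm (by
      rw [← rk_sameGalois hq hbc]
      exact rk_anti' hcl subset_union_left (finite_range _))
      (hg ▸ rk_anti' hcl (union_subset (subset_union_left.trans hD') hs) (finite_range _))
  have h1 : rk cl (A ∪ range t) (range fun i => k (b i)) = rk cl A (range c) := by
    rw [← hfree s hs, ← rk_image hq k (A ∪ range s) (finite_range b), image_union,
      image_eq_self hkA, ← range_aut, ← range_aut, funext hk]
  obtain ⟨r, hr, hrb⟩ := sameGalois_iff.1 (hst (A ∪ range t) (hA.union (finite_range t))
    subset_union_left _ b (SameGalois.trans (sameGalois_aut k hkA b) hbc) hbc h1 (hfree t ht))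
  refine (sameType_iff hA).2 (sameGalois_append.2 ⟨r.comp k, fun y hy => ?_, hrb, fun i => ?_⟩)
  · rw [FirstOrder.Language.Equiv.comp_apply, hkA y hy, hr y (Or.inl hy)]
  · rw [FirstOrder.Language.Equiv.comp_apply, hk i, hr _ (Or.inr (mem_range_self i))]

/-- A tuple of dimension one over `A` which is independent from `D` over `A` still has dimension
one over `A ∪ D`. -/
theorem rk_eq_one_of_indep (hM : IsMonster L cl δ) {A : Set M} (hA : A.Finite) {n : ℕ}
    {z : Fin n → M} (hz : rk cl A (range z) = 1) {D : Set M} (hD : D.Finite)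
    (h : (monster L cl).Indep δ z A D) : rk cl (A ∪ D) (range z) = 1 := by
  have hq := hM.quasiminimal
  have hcl := hq.pregeometry
  have hAD := hA.union hD
  by_contra hne
  have h0 : rk cl (A ∪ D) (range z) = 0 := by
    have := rk_anti' hcl (subset_union_left : A ⊆ A ∪ D) (finite_range z)
    omega
  rw [rk_eq_zero_iff hcl (finite_range z)] at h0
  obtain ⟨_, ⟨i, rfl⟩, hi⟩ : ∃ x ∈ range z, x ∉ cl A := by
    by_contra! h'
    rw [(rk_eq_zero_iff hcl (finite_range z)).2 h'] at hz
    omega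
  obtain ⟨A', hA'A, hA', h⟩ := h
  obtain ⟨t, ht⟩ := exists_notMem_cl hM (mk_lt_of_countable hM hAD.countable)
  obtain ⟨b, hbz, hns⟩ := h (cl (insert t (A ∪ D)))
    ((subset_insert _ _).trans (subset_cl cl _))
    (mk_lt_of_countable hM (countable_cl hq (hAD.insert t).countable))
  obtain ⟨g, hg, hgz⟩ := sameGalois_iff.1 ((sameType_iff hAD).1 hbz)
  have hgA : g '' (A ∪ D) = A ∪ D := image_eq_self hg
  have hgA' : g '' A = A := image_eq_self fun y hy => hg y (Or.inl hy)
  have hb1 : b i ∈ cl (A ∪ D) := by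
    rw [← mem_cl_image_iff hq g, hgA, hgz i]
    exact h0 (mem_range_self i)
  have hb2 : b i ∉ cl A' := fun h' => hi (by
    rw [← hgz i, ← hgA', mem_cl_image_iff hq g]
    exact cl_mono cl hA'A h')
  have ht' : t ∉ cl A' := fun h' => ht (cl_mono cl (hA'A.trans subset_union_left) h')
  -- `b i` lies in the closure of `A ∪ D`, while the point `t` of the same Lascar type over `A'`
  -- does not; the type of `b` over `{b i, t}` tells them apart
  refine hns ⟨1, ![b i], ![t], ?_, ?_, (stationary_singleton hM ht').sameLascar hM hA'
    (sameGalois_singleton hM hA'.countable hb2 ht'), fun h' => ?_⟩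
  · rintro _ ⟨j, rfl⟩
    rw [Subsingleton.elim j 0]
    exact cl_mono cl (subset_insert _ _) hb1
  · rintro _ ⟨j, rfl⟩
    rw [Subsingleton.elim j 0]
    exact subset_cl cl _ (mem_insert _ _)
  · obtain ⟨k, -, hkb, hkt⟩ := sameGalois_append.1 ((sameType_iff hA').1 h')
    have h1 : k (b i) = t := hkt 0
    rw [hkb i] at h1
    exact ht (h1 ▸ hb1)

/-! ### Global types and their codes -/

theorem mem_globalType_iff {n : ℕ} {p : Set M → Set (Fin n → M)}
    (hp : (monster L cl).IsGlobalType p) {D : Set M} (hD : D.Finite) {y z : Fin n → M}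
    (hy : y ∈ p D) : z ∈ p D ↔ (monster L cl).SameGalois D y z := by
  obtain ⟨x, hx⟩ := hp.1 D hD
  rw [hx z]
  exact ⟨fun h => SameGalois.trans (SameGalois.symm ((hx y).1 hy)) h,
    fun h => SameGalois.trans ((hx y).1 hy) h⟩

theorem globalType_nonempty {n : ℕ} {p : Set M → Set (Fin n → M)}
    (hp : (monster L cl).IsGlobalType p) {D : Set M} (hD : D.Finite) : ∃ y, y ∈ p D := by
  obtain ⟨x, hx⟩ := hp.1 D hD
  exact ⟨x, (hx x).2 (SameGalois.refl D x)⟩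

theorem sameOver_iff {n m : ℕ} {p : Set M → Set (Fin n → M)}
    (hp : (monster L cl).IsGlobalType p) {c d : Fin m → M} {D : Set M} (hD : D.Finite)
    (hcD : range c ⊆ D) (hdD : range d ⊆ D) {y : Fin n → M} (hy : y ∈ p D) :
    (monster L cl).SameOver p c d ↔
      (monster L cl).SameGalois ∅ (Fin.append y c) (Fin.append y d) := by
  have hcd : (range c ∪ range d).Finite := (finite_range c).union (finite_range d)
  have hy' := hp.2 _ _ hD (union_subset hcD hdD) hy
  refine ⟨fun h => (sameType_iff finite_empty).1 (h y hy'), fun h z hz => ?_⟩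
  obtain ⟨g, hg, hgy⟩ := sameGalois_iff.1 ((mem_globalType_iff hp hcd hy').1 hz)
  have key : ∀ s : Fin m → M, range s ⊆ range c ∪ range d →
      (monster L cl).SameGalois ∅ (Fin.append y s) (Fin.append z s) := fun s hs =>
    sameGalois_append.2 ⟨g, by simp, hgy, fun i => hg _ (hs (mem_range_self i))⟩
  exact (sameType_iff finite_empty).2
    (SameGalois.trans (SameGalois.symm (key c subset_union_left))
      (SameGalois.trans h (key d subset_union_right)))

theorem SameOver.trans {n m : ℕ} {p : Set M → Set (Fin n → M)}
    (hp : (monster L cl).IsGlobalType p) {a b c : Fin m → M}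
    (h : (monster L cl).SameOver p a b) (h' : (monster L cl).SameOver p b c) :
    (monster L cl).SameOver p a c := by
  have hD := ((finite_range a).union (finite_range b)).union (finite_range c)
  obtain ⟨y, hy⟩ := globalType_nonempty hp hD
  have ha : range a ⊆ range a ∪ range b ∪ range c := subset_union_left.trans subset_union_left
  have hb : range b ⊆ range a ∪ range b ∪ range c := subset_union_right.trans subset_union_left
  have hc : range c ⊆ range a ∪ range b ∪ range c := subset_union_right
  rw [sameOver_iff hp hD ha hb hy] at h
  rw [sameOver_iff hp hD hb hc hy] at h'
  rw [sameOver_iff hp hD ha hc hy]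
  exact SameGalois.trans h h'

theorem SameOver.symm {n m : ℕ} {p : Set M → Set (Fin n → M)}
    (hp : (monster L cl).IsGlobalType p) {a b : Fin m → M}
    (h : (monster L cl).SameOver p a b) : (monster L cl).SameOver p b a := by
  have hD := (finite_range a).union (finite_range b)
  obtain ⟨y, hy⟩ := globalType_nonempty hp hD
  rw [sameOver_iff hp hD subset_union_left subset_union_right hy] at h
  rw [sameOver_iff hp hD subset_union_right subset_union_left hy]
  exact SameGalois.symm h

theorem sameOver_of_nonSplit {n k m : ℕ} {p : Set M → Set (Fin n → M)} {e : Fin k → M}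
    (hp : (monster L cl).IsGlobalType p) (hns : (monster L cl).NonSplitOver p e)
    {c d : Fin m → M} (h : (monster L cl).SameGalois (range e) c d) :
    (monster L cl).SameOver p c d := by
  have hD := ((finite_range e).union (finite_range c)).union (finite_range d)
  obtain ⟨y, hy⟩ := globalType_nonempty hp hD
  rw [sameOver_iff hp hD (subset_union_right.trans subset_union_left) subset_union_right hy]
  exact SameGalois.mono (empty_subset _) ((sameType_iff (finite_range e)).1
    (hns m c d ((sameType_iff (finite_range e)).2 h) y hy))

/-- For a conjugate `g e` of the base `e`, the coding relation speaks about the global type `g p`.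
-/
theorem coded_iff {n k m : ℕ} {p : Set M → Set (Fin n → M)} {e : Fin k → M}
    (hp : (monster L cl).IsGlobalType p) (hns : (monster L cl).NonSplitOver p e)
    (g : M ≃[L] M) (c d : Fin m → M) :
    (monster L cl).Coded p e c (fun i => g (e i)) d ↔
      (monster L cl).SameOver p (fun i => g.symm (d i)) c := by
  constructor
  · rintro ⟨d', h, hd'⟩
    obtain ⟨k, -, hke, hkd⟩ := sameGalois_append.1 ((sameType_iff finite_empty).1 h)
    refine SameOver.trans hp (SameOver.symm hp (sameOver_of_nonSplit hp hns ?_)) hd'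
    refine sameGalois_iff.2 ⟨g.symm.comp k, ?_, fun i => ?_⟩
    · rintro _ ⟨i, rfl⟩
      rw [FirstOrder.Language.Equiv.comp_apply, hke i, g.symm_apply_apply]
    · rw [FirstOrder.Language.Equiv.comp_apply, hkd i]
  · intro h
    refine ⟨_, (sameType_iff finite_empty).2 (sameGalois_append.2
      ⟨g, by simp, fun i => rfl, fun i => ?_⟩), h⟩
    rw [g.apply_symm_apply]

theorem fixesType_iff {n : ℕ} {p : Set M → Set (Fin n → M)} (g : M ≃[L] M) :
    (monster L cl).FixesType g p ↔
      ∀ D : Set M, D.Finite → ∀ y ∈ p D, (fun i => g (y i)) ∈ p (g '' D) := Iff.rfl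

/-- An automorphism fixes a global type `p` which does not split over `e` iff it fixes the class
of `e` under the equivalence relation coding `p`. -/
theorem codeRel_iff_fixesType {n k : ℕ} {p : Set M → Set (Fin n → M)} {e : Fin k → M}
    (hp : (monster L cl).IsGlobalType p) (hns : (monster L cl).NonSplitOver p e)
    (g : M ≃[L] M) :
    ((monster L cl).codeRel p e).r (fun i => g (e i)) e ↔ (monster L cl).FixesType g p := by
  have hrefl : ∀ {m : ℕ} (c d : Fin m → M),
      (monster L cl).Coded p e c e d ↔ (monster L cl).SameOver p d c := fun {m} c d => by
    have := coded_iff hp hns (FirstOrder.Language.Equiv.refl L M) c d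
    simp only [FirstOrder.Language.Equiv.refl_apply] at this
    have h2 : (fun i => (FirstOrder.Language.Equiv.refl L M).symm (d i)) = d :=
      funext fun i => by
        rw [← FirstOrder.Language.Equiv.refl_apply (L := L) (d i)]
        exact FirstOrder.Language.Equiv.symm_apply_apply _ _
    rwa [h2] at this
  rw [fixesType_iff]
  constructor
  · intro h D hD y hy
    obtain ⟨m, d, hd⟩ := exists_fin_range (hD.image g)
    have hgd : ∀ i, g.symm (d i) ∈ D := fun i => by
      obtain ⟨x, hx, hxd⟩ : d i ∈ g '' D := hd ▸ mem_range_self i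
      rwa [← hxd, g.symm_apply_apply]
    have h1 : (monster L cl).SameOver p (fun i => g.symm (d i)) d := by
      rw [← coded_iff hp hns]
      refine (h m d d).2 ((hrefl d d).2 fun y _ => ?_)
      exact (sameType_iff finite_empty).2 (SameGalois.refl _ _)
    have hDD := hD.union (hD.image g)
    obtain ⟨z, hz⟩ := globalType_nonempty hp hDD
    rw [sameOver_iff hp hDD ((range_subset_iff.2 hgd).trans subset_union_left)
      (hd.le.trans subset_union_right) hz] at h1
    obtain ⟨k, -, hkz, hkd⟩ := sameGalois_append.1 h1
    have hz1 := hp.2 _ _ hDD subset_union_left hz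
    have hz2 := hp.2 _ _ hDD subset_union_right hz
    have h2 : (fun i => g (z i)) ∈ p (g '' D) := by
      rw [mem_globalType_iff hp (hD.image g) hz2]
      refine SameGalois.symm (sameGalois_iff.2 ⟨k.comp g.symm, ?_, fun i => ?_⟩)
      · rw [← hd]
        rintro _ ⟨i, rfl⟩
        exact hkd i
      · rw [FirstOrder.Language.Equiv.comp_apply, g.symm_apply_apply, hkz i]
    rw [mem_globalType_iff hp (hD.image g) h2]
    exact SameGalois.map g ((mem_globalType_iff hp hD hz1).1 hy)
  · intro h m c d
    rw [coded_iff hp hns, hrefl]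
    have h1 : (monster L cl).SameOver p (fun i => g.symm (d i)) d := by
      have hS := (finite_range d).union (finite_range fun i => g.symm (d i))
      obtain ⟨y, hy⟩ := globalType_nonempty hp hS
      have hgS := h _ hS y hy
      have hsub : range d ⊆ g '' (range d ∪ range fun i => g.symm (d i)) := by
        rintro _ ⟨i, rfl⟩
        exact ⟨_, Or.inr ⟨i, rfl⟩, g.apply_symm_apply _⟩
      obtain ⟨k, hk, hky⟩ := sameGalois_iff.1 ((mem_globalType_iff hp (finite_range d)
        (hp.2 _ _ (hS.image g) hsub hgS)).1 (hp.2 _ _ hS subset_union_left hy))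
      rw [sameOver_iff hp hS subset_union_right subset_union_left hy]
      refine sameGalois_append.2 ⟨k.comp g, by simp, hky, fun i => ?_⟩
      rw [FirstOrder.Language.Equiv.comp_apply, g.apply_symm_apply, hk _ (mem_range_self i)]
    exact ⟨fun h => SameOver.trans hp (SameOver.symm hp h1) h, fun h => SameOver.trans hp h1 h⟩

end FreeExtension

/-! ### The free extension of a stationary type and its stabilizer -/

section FreeType

variable {L : FirstOrder.Language.{v, w}} {M : Type u} [L.Structure M]
variable {cl : ClosureOperator (Set M)} {δ : Cardinal.{u}}

variable (L cl) in
/-- The global type of the realizations of the type of `c` over `A` which are free from everything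
over `A`: its restriction to `D` is the type over `D` of such a realization. -/
def freeType (A : Set M) {n : ℕ} (c : Fin n → M) (D : Set M) : Set (Fin n → M) :=
  {z | ∃ w : Fin n → M, (monster L cl).SameGalois A w c ∧
    rk cl (A ∪ D) (range w) = rk cl A (range c) ∧ (monster L cl).SameGalois D w z}

theorem mem_freeType_iff (hq : IsQuasiminimal L cl) {A D : Set M} {n : ℕ} {c z : Fin n → M}
    (hAD : A ⊆ D) : z ∈ freeType L cl A c D ↔
      (monster L cl).SameGalois A z c ∧ rk cl D (range z) = rk cl A (range c) := by
  rw [freeType, union_eq_self_of_subset_left hAD]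
  constructor
  · rintro ⟨w, hw, hr, hwz⟩
    exact ⟨SameGalois.trans (SameGalois.symm (SameGalois.mono hAD hwz)) hw,
      (rk_sameGalois hq hwz).symm.trans hr⟩
  · rintro ⟨hz, hr⟩
    exact ⟨z, hz, hr, SameGalois.refl D z⟩

theorem freeType_isGlobalType (hM : IsMonster L cl δ) {A : Set M} (hA : A.Finite) {n : ℕ}
    {c : Fin n → M} (hst : Stationary L cl A c) :
    (monster L cl).IsGlobalType (freeType L cl A c) := by
  have hq := hM.quasiminimal
  have hcl := hq.pregeometry
  refine ⟨fun D hD => ?_, ?_⟩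
  · obtain ⟨g, hg, hgr⟩ := exists_free hM hA.countable (D := A ∪ D) subset_union_left
      (mk_lt_of_countable hM (hA.union hD).countable) (finite_range c)
    rw [← range_aut] at hgr
    have hgc := sameGalois_aut (cl := cl) g (fun y hy => hg y (subset_cl cl A hy)) c
    refine ⟨fun i => g (c i), fun z => ⟨?_, fun h => ⟨_, hgc, hgr, h⟩⟩⟩
    rintro ⟨w, hw, hr, hwz⟩
    exact SameGalois.trans (SameGalois.mono subset_union_right
      (hst (A ∪ D) (hA.union hD) subset_union_left _ w hgc hw hgr hr)) hwz
  · rintro D D' hD' hDD' z ⟨w, hw, hr, hwz⟩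
    refine ⟨w, hw, le_antisymm ?_ ?_, SameGalois.mono hDD' hwz⟩
    · rw [← rk_sameGalois hq hw]
      exact rk_anti' hcl subset_union_left (finite_range w)
    · rw [← hr]
      exact rk_anti' hcl (union_subset_union_right A hDD') (finite_range w)

theorem freeType_isFreeExt (hM : IsMonster L cl δ) {A : Set M} (hA : A.Finite) {n : ℕ}
    {c : Fin n → M} (hst : Stationary L cl A c) :
    (monster L cl).IsFreeExt δ (freeType L cl A c) c A := by
  refine ⟨freeType_isGlobalType hM hA hst, fun D hD => ?_⟩
  obtain ⟨z, w, hw, hr, -⟩ := globalType_nonempty (freeType_isGlobalType hM hA hst) hD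
  exact ⟨w, ⟨w, hw, hr, SameGalois.refl D w⟩, hst.sameLascar hM hA hw, hst.indep hM hA hw hD hr⟩

theorem freeType_nonSplitOver (hM : IsMonster L cl δ) {n k : ℕ} {c : Fin n → M} {e : Fin k → M}
    (hst : Stationary L cl (range e) c) :
    (monster L cl).NonSplitOver (freeType L cl (range e) c) e := by
  have hq := hM.quasiminimal
  have hcl := hq.pregeometry
  have he := finite_range e
  intro m s t hst' y hy
  obtain ⟨hyc, hyr⟩ := (mem_freeType_iff hq (subset_union_left.trans subset_union_left)).1 hy
  have hfree : ∀ s' : Fin m → M, range s' ⊆ range e ∪ range s ∪ range t →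
      rk cl (range e ∪ range s') (range y) = rk cl (range e) (range c) := fun s' hs =>
    le_antisymm (by
      rw [← rk_sameGalois hq hyc]
      exact rk_anti' hcl subset_union_left (finite_range _))
      (hyr ▸ rk_anti' hcl (union_subset (subset_union_left.trans subset_union_left) hs)
        (finite_range _))
  obtain ⟨g, hg, hgs⟩ := sameGalois_iff.1 ((sameType_iff he).1 hst')
  have h1 : rk cl (range e ∪ range t) (range fun i => g (y i)) = rk cl (range e) (range c) := by
    rw [← hfree s (subset_union_right.trans subset_union_left),
      ← rk_image hq g (range e ∪ range s) (finite_range y), image_union,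
      image_eq_self hg, ← range_aut, ← range_aut, funext hgs]
  obtain ⟨k, hk, hky⟩ := sameGalois_iff.1 (hst (range e ∪ range t) (he.union (finite_range t))
    subset_union_left _ y (SameGalois.trans (sameGalois_aut g hg y) hyc) hyc h1
    (hfree t subset_union_right))
  refine (sameType_iff he).2 (sameGalois_append.2 ⟨k.comp g, fun x hx => ?_, hky, fun i => ?_⟩)
  · rw [FirstOrder.Language.Equiv.comp_apply, hg x hx, hk x (Or.inl hx)]
  · rw [FirstOrder.Language.Equiv.comp_apply, hgs i, hk _ (Or.inr (mem_range_self i))]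

/-- The free global extension of a stationary type of dimension one is unique. -/
theorem IsFreeExt.eq_freeType (hM : IsMonster L cl δ) {A : Set M} (hA : A.Finite) {n : ℕ}
    {c : Fin n → M} (hst : Stationary L cl A c) (hc : rk cl A (range c) = 1)
    {p : Set M → Set (Fin n → M)} (hp : (monster L cl).IsFreeExt δ p c A) {D : Set M}
    (hD : D.Finite) : p D = freeType L cl A c D := by
  obtain ⟨y, hy, hyc, hind⟩ := hp.2 D hD
  have hyc' := SameLascar.sameGalois hM hA hyc
  have hr := rk_eq_one_of_indep hM hA ((rk_sameGalois hM.quasiminimal hyc').trans hc) hD hind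
  have hyf : y ∈ freeType L cl A c D := ⟨y, hyc', hr.trans hc.symm, SameGalois.refl D y⟩
  ext z
  rw [mem_globalType_iff hp.1 hD hy,
    mem_globalType_iff (freeType_isGlobalType hM hA hst) hD hyf]

theorem IsFreeExt.fixesType_iff (hM : IsMonster L cl δ) {A : Set M} (hA : A.Finite) {n : ℕ}
    {c : Fin n → M} (hst : Stationary L cl A c) (hc : rk cl A (range c) = 1)
    {p : Set M → Set (Fin n → M)} (hp : (monster L cl).IsFreeExt δ p c A) (g : M ≃[L] M) :
    (monster L cl).FixesType g p ↔ (monster L cl).FixesType g (freeType L cl A c) := by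
  rw [ZL.fixesType_iff, ZL.fixesType_iff]
  refine forall₂_congr fun D hD => ?_
  rw [IsFreeExt.eq_freeType hM hA hst hc hp hD,
    IsFreeExt.eq_freeType hM hA hst hc hp (hD.image g)]

theorem FixesType.comp {n : ℕ} {p : Set M → Set (Fin n → M)} {g k : M ≃[L] M}
    (hg : (monster L cl).FixesType g p) (hk : (monster L cl).FixesType k p) :
    (monster L cl).FixesType (k.comp g) p := by
  rw [fixesType_iff] at *
  intro D hD y hy
  have := hk _ (hD.image g) _ (hg D hD y hy)
  rwa [← image_comp] at this

theorem FixesType.symm {n : ℕ} {p : Set M → Set (Fin n → M)}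
    (hp : (monster L cl).IsGlobalType p) {g : M ≃[L] M}
    (hg : (monster L cl).FixesType g p) : (monster L cl).FixesType g.symm p := by
  rw [fixesType_iff] at *
  intro D hD y hy
  have hD' := hD.image g.symm
  obtain ⟨z, hz⟩ := globalType_nonempty hp hD'
  have h1 := hg _ hD' z hz
  rw [image_image_symm] at h1
  rw [mem_globalType_iff hp hD' hz]
  have h2 := SameGalois.map g.symm ((mem_globalType_iff hp hD h1).1 hy)
  simpa only [g.symm_apply_apply] using h2

theorem fixesType_freeType_of_fixes {A : Set M} {n : ℕ} {c : Fin n → M} {g : M ≃[L] M}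
    (hq : IsQuasiminimal L cl) (hg : ∀ y ∈ A, g y = y) :
    (monster L cl).FixesType g (freeType L cl A c) := by
  rw [fixesType_iff]
  rintro D - y ⟨w, hw, hr, hwy⟩
  refine ⟨fun i => g (w i), SameGalois.trans (sameGalois_aut g hg w) hw, ?_, SameGalois.map g hwy⟩
  rw [← hr, ← rk_image hq g (A ∪ D) (finite_range w), image_union, image_eq_self hg, range_aut]

/-- If `k` and `h` fix the free extension of the type of `c` over `A`, the conjugate `k c` being
free over `k A` from `h A` makes it a free realization over `h A` as well. -/
theorem rk_eq_of_fixesType (hM : IsMonster L cl δ) {A : Set M} (hA : A.Finite) {n : ℕ}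
    {c : Fin n → M} (hst : Stationary L cl A c) {k h : M ≃[L] M}
    (hk : (monster L cl).FixesType k (freeType L cl A c))
    (hh : (monster L cl).FixesType h (freeType L cl A c))
    (hr : rk cl (k '' A ∪ h '' A) (k '' range c) = rk cl A (range c)) :
    rk cl (h '' A) (k '' range c) = rk cl A (range c) := by
  have hq := hM.quasiminimal
  have h1 : c ∈ freeType L cl A c (A ∪ k.symm '' (h '' A)) := by
    rw [mem_freeType_iff hq subset_union_left]
    refine ⟨SameGalois.refl A c, ?_⟩
    rw [← hr, ← rk_image hq k _ (finite_range c), image_union, image_image_symm]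
  have h2 := fixesType_iff (h.symm) |>.1 (FixesType.symm (freeType_isGlobalType hM hA hst) hh) _
    ((hA.union ((hA.image h).image k.symm)).image k) _
    ((fixesType_iff k).1 hk _ (hA.union ((hA.image h).image k.symm)) _ h1)
  rw [image_union, image_image_symm, image_union, image_symm_image,
    mem_freeType_iff hq subset_union_right] at h2
  rw [← rk_sameGalois hq h2.1, range_aut h.symm fun i => k (c i), range_aut,
    ← rk_image hq h A (((finite_range c).image k).image h.symm), image_image_symm]

theorem freeType_image (hq : IsQuasiminimal L cl) (g : M ≃[L] M) {A D : Set M} {n : ℕ}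
    {c z : Fin n → M} (h : z ∈ freeType L cl A c D) :
    (fun i => g (z i)) ∈ freeType L cl (g '' A) (fun i => g (c i)) (g '' D) := by
  obtain ⟨w, hw, hr, hwz⟩ := h
  refine ⟨fun i => g (w i), SameGalois.map g hw, ?_, SameGalois.map g hwz⟩
  rw [← image_union, range_aut, range_aut, rk_image hq g _ (finite_range w),
    rk_image hq g _ (finite_range c), hr]

theorem FixesType.conj (hq : IsQuasiminimal L cl) (g : M ≃[L] M) {A : Set M} {n : ℕ}
    {c : Fin n → M} {h : M ≃[L] M} (hh : (monster L cl).FixesType h (freeType L cl A c)) :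
    (monster L cl).FixesType ((g.comp h).comp g.symm)
      (freeType L cl (g '' A) fun i => g (c i)) := by
  rw [fixesType_iff] at *
  intro D hD y hy
  have h1 := freeType_image hq g.symm hy
  simp only [g.symm_apply_apply, image_symm_image] at h1
  have h2 := freeType_image hq g (hh _ (hD.image g.symm) _ h1)
  rwa [← image_comp, ← image_comp] at h2

end FreeType

/-! ### The orbit of a parameter under the stabilizer of a plane curve -/

section Orbit

variable {L : FirstOrder.Language.{v, w}} {M : Type u} [L.Structure M]
variable {cl : ClosureOperator (Set M)} {δ : Cardinal.{u}}

/-- The properties of the stabilizer `P` of the free extension of a stationary type of dimension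
one, with set of realizations `C`, over `A`. Only these properties are needed to bound the orbit of
`A` under `P`. -/
structure IsStabilizer (cl : ClosureOperator (Set M)) (A C : Set M) (P : Set (M ≃[L] M)) :
    Prop where
  of_fixes : ∀ g : M ≃[L] M, (∀ y ∈ A, g y = y) → g ∈ P
  comp : ∀ k ∈ P, ∀ g ∈ P, k.comp g ∈ P
  symm : ∀ g ∈ P, g.symm ∈ P
  free : ∀ k ∈ P, ∀ h ∈ P, rk cl (k '' A ∪ h '' A) (k '' C) = 1 → rk cl (h '' A) (k '' C) = 1

theorem rk_singleton_of_notMem (hcl : IsPregeometry cl) {A : Set M} {x : M} (hx : x ∉ cl A) :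
    rk cl A {x} = 1 := by
  have := rk_insert_of_notMem hcl (A := A) (C := ∅) finite_empty (x := x) (by rwa [union_empty])
  rwa [rk_empty, zero_add, insert_empty_eq] at this

theorem mem_cl_of_rk_eq_zero (hcl : IsPregeometry cl) {A : Set M} {x : M} (h : rk cl A {x} = 0) :
    x ∈ cl A :=
  (rk_eq_zero_iff hcl (finite_singleton x)).1 h (mem_singleton x)

namespace IsStabilizer

variable {A C : Set M} {P : Set (M ≃[L] M)}

theorem exists_max (hM : IsMonster L cl δ) (hA : A.Finite) (hP : IsStabilizer cl A C P) :
    ∃ g ∈ P, ∀ k ∈ P, rk cl A (k '' A) ≤ rk cl A (g '' A) := by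
  have hcl := hM.quasiminimal.pregeometry
  have hbdd : BddAbove ((fun g : M ≃[L] M => rk cl A (g '' A)) '' P) := by
    refine ⟨A.ncard, ?_⟩
    rintro _ ⟨g, -, rfl⟩
    exact (rk_le_ncard hcl A (hA.image g)).trans (ncard_image_le hA)
  have hne : ((fun g : M ≃[L] M => rk cl A (g '' A)) '' P).Nonempty :=
    ⟨_, mem_image_of_mem _ (hP.of_fixes (FirstOrder.Language.Equiv.refl L M) (by simp))⟩
  obtain ⟨g, hg, hgm⟩ := Nat.sSup_mem hne hbdd
  exact ⟨g, hg, fun k hk => (le_csSup hbdd (mem_image_of_mem _ hk)).trans hgm.ge⟩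

/-- The conjugates of `A` of maximal dimension over `A` can be chosen free from any finite set. -/
theorem exists_free (hM : IsMonster L cl δ) (hA : A.Finite) (hP : IsStabilizer cl A C P)
    {g : M ≃[L] M} (hg : g ∈ P) {F : Set M} (hF : F.Finite) :
    ∃ h ∈ P, rk cl (A ∪ F) (h '' A) = rk cl A (g '' A) := by
  obtain ⟨σ, hσ, hr⟩ := ZL.exists_free hM hA.countable (D := A ∪ F) subset_union_left
    (mk_lt_of_countable hM (hA.union hF).countable) (hA.image g)
  refine ⟨σ.comp g, hP.comp _ (hP.of_fixes σ fun y hy => hσ y (subset_cl cl A hy)) _ hg, ?_⟩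
  rwa [← image_comp] at hr

/-- A conjugate `h A` which is of maximal dimension over `k A` and `k C` is a base for the curve
generically realized by `k C`. -/
theorem rk_eq_one (hM : IsMonster L cl δ) (hA : A.Finite) (hC : C.Finite)
    (hP : IsStabilizer cl A C P) (hAC : rk cl A C = 1) {m : ℕ}
    (hm : ∀ g ∈ P, rk cl A (g '' A) ≤ m) {k h : M ≃[L] M} (hk : k ∈ P) (hh : h ∈ P)
    (hkh : m ≤ rk cl (k '' A ∪ k '' C) (h '' A)) : rk cl (h '' A) (k '' C) = 1 := by
  have hq := hM.quasiminimal
  have hcl := hq.pregeometry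
  have h1 : rk cl (k '' A) (h '' A) ≤ m := by
    have := hm _ (hP.comp _ (hP.symm k hk) _ hh)
    rw [← rk_image hq k A (hA.image _), ← image_comp] at this
    have h2 : (⇑k ∘ ⇑(k.symm.comp h)) = h := funext fun x => k.apply_symm_apply (h x)
    rwa [h2] at this
  have h2 := rk_symm hcl (k '' A) (hC.image k) (hA.image h)
  rw [rk_image hq k A hC, hAC] at h2
  have h3 := rk_anti' hcl (subset_union_left : k '' A ⊆ k '' A ∪ h '' A) (hC.image k)
  rw [rk_image hq k A hC, hAC] at h3
  exact hP.free k hk h hh (by omega)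

/-- No conjugate of the curve by its stabilizer has dimension more than one over `A`. -/
theorem rk_image_le_one (hM : IsMonster L cl δ) (hA : A.Finite) (hC : C.Finite)
    (hP : IsStabilizer cl A C P) (hAC : rk cl A C = 1) {k : M ≃[L] M} (hk : k ∈ P) :
    rk cl A (k '' C) ≤ 1 := by
  have hq := hM.quasiminimal
  have hcl := hq.pregeometry
  obtain ⟨g, hg, hmax⟩ := hP.exists_max hM hA
  obtain ⟨h, hh, hr⟩ := hP.exists_free hM hA hg ((hA.image k).union (hC.image k))
  have h1 := hP.rk_eq_one hM hA hC hAC hmax hk hh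
    (hr ▸ rk_anti' hcl subset_union_right (hA.image h))
  have h2 := rk_anti' hcl (union_subset_union_right A subset_union_right :
    A ∪ k '' C ⊆ A ∪ (k '' A ∪ k '' C)) (hA.image h)
  have h3 := hmax h hh
  have h4 := rk_symm hcl A (hA.image h) (hC.image k)
  have h5 := rk_anti' hcl (subset_union_right : h '' A ⊆ A ∪ h '' A) (hC.image k)
  omega

/-- If the curve `{a, b}` over `A` witnesses the failure of local modularity, then the orbit of
`A` under the stabilizer of the curve has codimension at least two. -/
theorem exists_add_two_le (hM : IsMonster L cl δ) (hA : A.Finite) {a b p : M}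
    (hP : IsStabilizer cl A {a, b} P) (hp : p ∉ cl ∅) (hpA : p ∈ A) (ha : a ∉ cl A)
    (hb : b ∉ cl A) (hab : a ∈ cl (insert b A)) (hd : ∀ d ∈ cl A, a ∉ cl {b, d, p}) :
    ∃ m, (∀ g ∈ P, rk cl A (g '' A) ≤ m) ∧ m + 2 ≤ rk cl ∅ A := by
  have hq := hM.quasiminimal
  have hcl := hq.pregeometry
  have hC : ({a, b} : Set M).Finite := (finite_singleton b).insert a
  have hAC : rk cl A {a, b} = 1 := by
    rw [rk_insert_of_mem hcl (by rwa [union_singleton]), rk_singleton_of_notMem hcl hb]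
  -- `m` is the dimension over `A` of a generic conjugate of `A` under `P`
  obtain ⟨g₀, hg₀, hmax⟩ := hP.exists_max hM hA
  refine ⟨rk cl A (g₀ '' A), hmax, ?_⟩
  generalize hm : rk cl A (g₀ '' A) = m at hmax
  by_contra! hlt
  have hid := hP.of_fixes (FirstOrder.Language.Equiv.refl L M) (by simp)
  have himg : ∀ S : Set M, (FirstOrder.Language.Equiv.refl L M) '' S = S :=
    fun S => image_eq_self (by simp)
  -- `d = p` is always a possible choice, so that `a` is not algebraic over `b`
  have hab1 : rk cl {b} {a} ≠ 0 := fun h => hd p (subset_cl cl A hpA)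
    (cl_mono cl (by simp) (mem_cl_of_rk_eq_zero hcl h))
  by_cases hcase : ∃ g ∈ P, g a = p
  · obtain ⟨g, hg, hga⟩ := hcase
    have hgC : g '' {a, b} = {p, g b} := by rw [image_pair, hga]
    -- otherwise `b` could be moved over `g⁻¹ A`, making the conjugate two-dimensional over `A`
    have hgb : g b ∈ cl A := by
      by_contra hgb
      have hgA := hA.image g.symm
      have hb' : b ∉ cl (g.symm '' A) := fun h => hgb (by
        have := mem_cl_aut hq g h
        rwa [image_image_symm] at this)
      obtain ⟨b', hb'⟩ : ∃ b', b' ∉ cl (insert a (g.symm '' A ∪ A)) :=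
        exists_notMem_cl hM (mk_lt_of_countable hM ((hgA.union hA).insert a).countable)
      obtain ⟨σ, hσ, hσb⟩ := exists_aut_of_notMem hM hgA.countable ‹b ∉ cl (g.symm '' A)›
        (fun h => hb' (cl_mono cl (subset_union_left.trans (subset_insert _ _)) h))
      have hσP : σ ∈ P := by
        have h1 := hP.comp _ (hP.symm g hg) _ (hP.comp _
          (hP.of_fixes (g.comp (σ.comp g.symm)) fun y hy => by
            simp only [FirstOrder.Language.Equiv.comp_apply]
            rw [hσ _ (subset_cl cl _ (mem_image_of_mem _ hy)), g.apply_symm_apply]) _ hg)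
        have h2 : g.symm.comp ((g.comp (σ.comp g.symm)).comp g) = σ := by
          ext x; simp
        rwa [h2] at h1
      have hσa : σ a = a :=
        hσ a (subset_cl cl _ ⟨p, hpA, by rw [← hga, g.symm_apply_apply]⟩)
      have h1 := hP.rk_image_le_one hM hA hC hAC hσP
      rw [image_pair, hσa, hσb, pair_comm,
        rk_insert_of_notMem hcl (finite_singleton a) (fun h => hb' (cl_mono cl ?_ h)),
        rk_singleton_of_notMem hcl ha] at h1
      · omega
      · rw [union_singleton]
        exact insert_subset_insert subset_union_right
    have hgCfin : (g '' {a, b}).Finite := hC.image g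
    -- dimensions over a generic conjugate `h A`, over which both `{a, b}` and its image
    -- `{p, g b}` are curves
    obtain ⟨h, hh, hr⟩ := hP.exists_free hM hA hg₀
      (((hA.image g).union hgCfin).union hC)
    have hH := hA.image h
    rw [hm] at hr
    have h1 := hP.rk_eq_one hM hA hC hAC hmax hg hh (hr ▸ rk_anti' hcl
      (subset_union_left.trans subset_union_right) hH)
    have h2 := hP.rk_eq_one hM hA hC hAC hmax hid hh (hr ▸ rk_anti' hcl (by
      rw [himg, himg]; exact union_subset_union_right A subset_union_right) hH)
    rw [himg] at h2
    have h3 : m ≤ rk cl (g '' {a, b} ∪ {a, b}) (h '' A) := hr ▸ rk_anti' hcl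
      (union_subset ((subset_union_right.trans subset_union_left).trans subset_union_right)
        (subset_union_right.trans subset_union_right)) hH
    have h4 : rk cl ∅ (h '' A) = rk cl ∅ A := by
      have := rk_image hq h ∅ hA
      rwa [image_empty] at this
    have h5 := rk_union hcl (h '' A) hgCfin hC
    have h6 := rk_anti' hcl (subset_union_left : h '' A ⊆ h '' A ∪ g '' {a, b}) hC
    have h7 := rk_symm hcl ∅ hH (hgCfin.union hC)
    have h8 := rk_union hcl ∅ hgCfin hC
    have h9 : rk cl ∅ (g '' {a, b}) = rk cl ∅ {a, b} := by
      have := rk_image hq g ∅ hC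
      rwa [image_empty] at this
    have h10 := rk_union hcl ∅ (finite_singleton b) (finite_singleton a)
    have h11 := rk_union hcl (g '' {a, b}) (finite_singleton b) (finite_singleton a)
    have hb0 : rk cl ∅ {b} = 1 :=
      rk_singleton_of_notMem hcl fun h' => hb (cl_mono cl (empty_subset A) h')
    have hb1 : rk cl (g '' {a, b}) {b} = 1 := by
      refine rk_singleton_of_notMem hcl fun h' => hb ?_
      rw [hgC] at h'
      exact (cl_subset_iff cl).2 (insert_subset (subset_cl cl A hpA)
        (singleton_subset_iff.2 hgb)) h'
    rw [singleton_union, pair_comm b a] at h10 h11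
    simp only [empty_union] at h7 h8 h10
    have h12 : rk cl (g '' {a, b} ∪ {b}) {a} = 0 := by omega
    refine hd _ hgb (cl_mono cl ?_ (mem_cl_of_rk_eq_zero hcl h12))
    rw [hgC]
    intro y
    simp only [mem_union, mem_insert_iff, mem_singleton_iff]
    tauto
  · -- the orbit of `p` under `P` is contained in `cl A`
    have hPp : ∀ g ∈ P, g p ∈ cl A := by
      intro g hg
      by_contra hgp
      obtain ⟨σ, hσ, hσa⟩ := exists_aut_of_notMem hM hA.countable ha hgp
      refine hcase ⟨g.symm.comp σ, hP.comp _ (hP.symm g hg) _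
        (hP.of_fixes σ fun y hy => hσ y (subset_cl cl A hy)), ?_⟩
      rw [FirstOrder.Language.Equiv.comp_apply, hσa, g.symm_apply_apply]
    -- hence `p` is algebraic over every conjugate of `A` under `P`
    obtain ⟨h, hh, hr⟩ := hP.exists_free hM hA hg₀ hC
    have hH := hA.image h
    rw [hm] at hr
    have hph : p ∈ cl (h '' A) := by
      have := mem_cl_aut hq h (hPp _ (hP.symm h hh))
      rwa [h.apply_symm_apply] at this
    have h2 := hP.rk_eq_one hM hA hC hAC hmax hid hh (by rw [himg, himg, hr])
    rw [himg] at h2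
    have hp1 := finite_singleton p
    have hb1 := finite_singleton b
    have ha1 := finite_singleton a
    have h3 : m ≤ rk cl ({p} ∪ {a, b}) (h '' A) := hr ▸ rk_anti' hcl
      (union_subset_union_left _ (singleton_subset_iff.2 hpA)) hH
    have h4 : rk cl ∅ (h '' A) = rk cl ∅ A := by
      have := rk_image hq h ∅ hA
      rwa [image_empty] at this
    have h5 : rk cl (h '' A) ({p} ∪ {a, b}) = 1 := by
      rw [singleton_union, rk_insert_of_mem hcl (cl_mono cl subset_union_left hph), h2]
    have h7 := rk_symm hcl ∅ hH (hp1.union hC)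
    have h8 := rk_union hcl ∅ hp1 hC
    have h9 := rk_union hcl {p} hb1 ha1
    have hp0 : rk cl ∅ {p} = 1 := rk_singleton_of_notMem hcl hp
    have hb0 : rk cl {p} {b} = 1 := rk_singleton_of_notMem hcl fun h' =>
      hb (cl_mono cl (singleton_subset_iff.2 hpA) h')
    rw [singleton_union, singleton_union, pair_comm b a] at h9
    simp only [empty_union] at h7 h8
    have h12 : rk cl (insert p {b}) {a} = 0 := by omega
    refine hd p (subset_cl cl A hpA) (cl_mono cl ?_ (mem_cl_of_rk_eq_zero hcl h12))
    intro y
    simp only [mem_insert_iff, mem_singleton_iff]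
    tauto

end IsStabilizer

end Orbit

/-! ### U-ranks of imaginaries -/

section Imaginaries

variable {L : FirstOrder.Language.{v, w}} {M : Type u} [L.Structure M]
variable {cl : ClosureOperator (Set M)} {δ : Cardinal.{u}} {𝓔 : ImagSystem L M}

/-- The class of the tuple `a` as an element of `M^eq`. -/
def ImagSystem.cls (𝓔 : ImagSystem L M) {n : ℕ} (E : 𝓔.rel n) (a : Fin n → M) : 𝓔.Meq :=
  ⟨n, E, Quotient.mk _ a⟩

variable (cl) in
theorem ImagSystem.act_cls (g : M ≃[L] M) {n : ℕ} (E : 𝓔.rel n) (a : Fin n → M) :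
    (𝓔.eqUniverse cl).act g (𝓔.cls E a) = 𝓔.cls E fun i => g (a i) := rfl

theorem ImagSystem.cls_eq_cls {n : ℕ} {E : 𝓔.rel n} {a b : Fin n → M} :
    𝓔.cls E a = 𝓔.cls E b ↔ E.1.r a b := by
  constructor
  · intro h
    have h1 := eq_of_heq (Sigma.mk.inj h).2
    exact Quotient.exact (eq_of_heq (Sigma.mk.inj h1).2)
  · intro h
    unfold ImagSystem.cls
    rw [Quotient.sound h]

theorem ImagSystem.exists_cls (x : 𝓔.Meq) : ∃ (n : ℕ) (E : 𝓔.rel n) (a : Fin n → M),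
    𝓔.cls E a = x := by
  obtain ⟨n, E, q⟩ := x
  obtain ⟨a, rfl⟩ := Quotient.exists_rep q
  exact ⟨n, E, a, rfl⟩

variable (cl) in
theorem ImagSystem.act_comp (k g : M ≃[L] M) (x : 𝓔.Meq) :
    (𝓔.eqUniverse cl).act (k.comp g) x = (𝓔.eqUniverse cl).act k ((𝓔.eqUniverse cl).act g x) := by
  obtain ⟨n, E, a, rfl⟩ := 𝓔.exists_cls x
  rfl

variable (cl) in
theorem ImagSystem.act_symm_act (g : M ≃[L] M) (x : 𝓔.Meq) :
    (𝓔.eqUniverse cl).act g.symm ((𝓔.eqUniverse cl).act g x) = x := by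
  obtain ⟨n, E, a, rfl⟩ := 𝓔.exists_cls x
  rw [act_cls, act_cls]
  simp

variable (cl) in
theorem ImagSystem.act_act_symm (g : M ≃[L] M) (x : 𝓔.Meq) :
    (𝓔.eqUniverse cl).act g ((𝓔.eqUniverse cl).act g.symm x) = x := by
  obtain ⟨n, E, a, rfl⟩ := 𝓔.exists_cls x
  rw [act_cls, act_cls]
  simp

/-- The elements of `M`, seen in `M^eq`. -/
def ImagSystem.emb (𝓔 : ImagSystem L M) (x : M) : 𝓔.Meq := 𝓔.cls ⟨_, 𝓔.eq_mem⟩ ![x]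

variable (cl) in
theorem ImagSystem.act_emb (g : M ≃[L] M) (x : M) :
    (𝓔.eqUniverse cl).act g (𝓔.emb x) = 𝓔.emb (g x) := by
  rw [emb, act_cls, emb]
  congr 1
  funext i
  rw [Subsingleton.elim i 0]; rfl

theorem ImagSystem.emb_injective : Function.Injective 𝓔.emb := fun x y h => by
  have h1 : ![x] = ![y] := cls_eq_cls.1 h
  exact congrFun h1 0

/-- `𝒜^eq`, the set of the classes of tuples from `𝒜`. -/
def ImagSystem.eqSet (𝓔 : ImagSystem L M) (A : Set M) : Set 𝓔.Meq :=
  {y | ∃ (n : ℕ) (E : 𝓔.rel n) (a : Fin n → M), range a ⊆ A ∧ y = 𝓔.cls E a}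

theorem ImagSystem.eqSet_mono {A B : Set M} (h : A ⊆ B) : 𝓔.eqSet A ⊆ 𝓔.eqSet B := by
  rintro y ⟨n, E, a, ha, rfl⟩
  exact ⟨n, E, a, ha.trans h, rfl⟩

theorem ImagSystem.emb_mem {A : Set M} {x : M} : 𝓔.emb x ∈ 𝓔.eqSet A ↔ x ∈ A := by
  constructor
  · rintro ⟨n, E, a, ha, h⟩
    have hn := (Sigma.mk.inj h).1
    subst hn
    have h1 := eq_of_heq (Sigma.mk.inj h).2
    have h3 := (Sigma.mk.inj h1).1
    subst h3
    have h4 : ![x] = a := cls_eq_cls.1 h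
    exact ha ⟨0, by rw [← h4]; rfl⟩
  · intro hx
    refine ⟨1, _, ![x], ?_, rfl⟩
    rintro _ ⟨i, rfl⟩
    rw [Subsingleton.elim i 0]
    exact hx

theorem ImagSystem.subset_of_eqSet_subset {A B : Set M} (h : 𝓔.eqSet A ⊆ 𝓔.eqSet B) : A ⊆ B :=
  fun _ hx => emb_mem.1 (h (emb_mem.2 hx))

theorem ImagSystem.image_eqSet (g : M ≃[L] M) (A : Set M) :
    (𝓔.eqUniverse cl).act g '' 𝓔.eqSet A = 𝓔.eqSet (g '' A) := by
  ext y
  constructor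
  · rintro ⟨_, ⟨n, E, a, ha, rfl⟩, rfl⟩
    exact ⟨n, E, _, by rw [range_aut]; exact image_mono ha, rfl⟩
  · rintro ⟨n, E, a, ha, rfl⟩
    refine ⟨𝓔.cls E fun i => g.symm (a i), ⟨n, E, _, ?_, rfl⟩, ?_⟩
    · rw [range_aut, ← image_symm_image g A]
      exact image_mono ha
    · rw [act_cls]
      simp

/-- Finitely many elements of `𝒜^eq` have representatives in a finite subset of `𝒜`. -/
theorem ImagSystem.exists_finite_reps {A : Set M} {F : Set 𝓔.Meq} (hF : F.Finite)
    (h : F ⊆ 𝓔.eqSet A) : ∃ B ⊆ A, B.Finite ∧ F ⊆ 𝓔.eqSet B := by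
  induction F, hF using Set.Finite.induction_on with
  | empty => exact ⟨∅, empty_subset _, finite_empty, empty_subset _⟩
  | @insert x F _ _ ih =>
    obtain ⟨B, hBA, hB, hFB⟩ := ih ((subset_insert _ _).trans h)
    obtain ⟨n, E, a, ha, rfl⟩ := h (mem_insert _ _)
    exact ⟨B ∪ range a, union_subset hBA ha, hB.union (finite_range a),
      insert_subset ⟨n, E, a, subset_union_right, rfl⟩
        (hFB.trans (eqSet_mono subset_union_left))⟩

theorem ImagSystem.act_eq_of_mem_eqSet {A : Set M} {g : M ≃[L] M} (hg : ∀ y ∈ A, g y = y)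
    {x : 𝓔.Meq} (hx : x ∈ 𝓔.eqSet A) : (𝓔.eqUniverse cl).act g x = x := by
  obtain ⟨n, E, a, ha, rfl⟩ := hx
  rw [act_cls]
  congr 1
  exact funext fun i => hg _ (ha (mem_range_self i))

theorem ImagSystem.sameGalois_iff {A : Set 𝓔.Meq} {n : ℕ} {a b : Fin n → 𝓔.Meq} :
    (𝓔.eqUniverse cl).SameGalois A a b ↔ ∃ g : M ≃[L] M,
      (∀ y ∈ A, (𝓔.eqUniverse cl).act g y = y) ∧ ∀ i, (𝓔.eqUniverse cl).act g (a i) = b i :=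
  Iff.rfl

theorem ImagSystem.sameGalois_append {A : Set 𝓔.Meq} {n m : ℕ} {a a' : Fin n → 𝓔.Meq}
    {b b' : Fin m → 𝓔.Meq} :
    (𝓔.eqUniverse cl).SameGalois A (Fin.append a b) (Fin.append a' b') ↔
      ∃ g : M ≃[L] M, (∀ y ∈ A, (𝓔.eqUniverse cl).act g y = y) ∧
        (∀ i, (𝓔.eqUniverse cl).act g (a i) = a' i) ∧
          ∀ i, (𝓔.eqUniverse cl).act g (b i) = b' i :=
  (𝓔.eqUniverse cl).sameGalois_append

theorem Universe.sameType_iff {X : Type u} {S : Universe.{u, w} X} {A : Set X}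
    (hA : A.Finite) {n : ℕ} {a b : Fin n → X} : S.SameType A a b ↔ S.SameGalois A a b :=
  ⟨fun h => h A le_rfl hA, fun ⟨g, hg, hab⟩ _ hB _ => ⟨g, fun y hy => hg y (hB hy), hab⟩⟩

/-- An imaginary fixed by all automorphisms over `e` is independent from `B` over `A` if `e` is. -/
theorem ImagSystem.indepNS_of_rk_eq (hM : IsMonster L cl δ) {A B : Set M} {n : ℕ} {e : Fin n → M}
    (hA : (monster L cl).IsModel A) (hB : (monster L cl).IsModel B) (hAB : A ⊆ B)
    (h : rk cl B (range e) = rk cl A (range e)) {α : 𝓔.Meq}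
    (hα : ∀ g : M ≃[L] M, (∀ i, g (e i) = e i) → (𝓔.eqUniverse cl).act g α = α) :
    (𝓔.eqUniverse cl).IndepNS ![α] (𝓔.eqSet A) (𝓔.eqSet B) := by
  have hq := hM.quasiminimal
  have hcl := hq.pregeometry
  have he := finite_range e
  obtain ⟨F₀, hF₀A, hF₀, hF₀r⟩ := exists_finite_rk_eq hcl A he
  obtain ⟨F, hF, h0F, hFA, hst⟩ := exists_stationary hM e hA hF₀ hF₀A hF₀r.symm
  have hFE : (𝓔.emb '' F).Finite := hF.image _
  refine ⟨𝓔.emb '' F, ?_, hFE, ?_⟩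
  · rintro _ ⟨x, hx, rfl⟩
    exact emb_mem.2 (hFA hx)
  rw [union_eq_self_of_subset_left (eqSet_mono hAB)]
  rintro ⟨m, b, d, hb, hd, hbd, hns⟩
  refine hns ?_
  have hfix : ∀ g : M ≃[L] M, (∀ y ∈ 𝓔.emb '' F, (𝓔.eqUniverse cl).act g y = y) ↔
      ∀ y ∈ F, g y = y := fun g => by
    rw [forall_mem_image]
    refine forall₂_congr fun y _ => ?_
    rw [act_emb, emb_injective.eq_iff]
  obtain ⟨g, hgF, hgb⟩ := sameGalois_iff.1 ((Universe.sameType_iff hFE).1 hbd)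
  rw [hfix] at hgF
  obtain ⟨R, hRB, hR, hbR⟩ := exists_finite_reps (finite_range b) hb
  obtain ⟨T, hTB, hT, hdT⟩ := exists_finite_reps (finite_range d) hd
  -- move the representatives of `g b` back into `B`, over the representatives of `d`
  obtain ⟨τ, hτ, hτR⟩ := exists_aut_subset_model' hM hB (hF.union hT)
    (union_subset (hFA.trans hAB) hTB) (hR.image g)
  set ρ : M ≃[L] M := τ.comp g with hρ
  have hρF : ∀ y ∈ F, ρ y = y := fun y hy => by
    rw [hρ, FirstOrder.Language.Equiv.comp_apply, hgF y hy, hτ y (Or.inl hy)]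
  have hρb : ∀ i, (𝓔.eqUniverse cl).act ρ (b i) = d i := fun i => by
    rw [hρ, act_comp, hgb i]
    exact act_eq_of_mem_eqSet (fun y hy => hτ y (Or.inr hy)) (hdT (mem_range_self i))
  have hρR : ρ '' R ⊆ B := by
    rw [← image_comp] at hτR
    exact hτR
  have hrF : rk cl F (range e) = rk cl A (range e) :=
    le_antisymm ((rk_anti' hcl h0F he).trans hF₀r.le) (rk_anti' hcl hFA he)
  have hfree : ∀ R : Set M, R ⊆ B → rk cl (F ∪ R) (range e) = rk cl F (range e) := fun R hR =>
    le_antisymm (rk_anti' hcl subset_union_left he) (by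
      rw [hrF, ← h]
      exact rk_anti' hcl (union_subset (hFA.trans hAB) hR) he)
  have h1 : rk cl (F ∪ ρ '' R) (range fun i => ρ (e i)) = rk cl F (range e) := by
    rw [← hfree R hRB, ← rk_image hq ρ (F ∪ R) he, image_union, image_eq_self hρF, ← range_aut]
  obtain ⟨κ, hκ, hκe⟩ := ZL.sameGalois_iff.1 (hst (F ∪ ρ '' R) (hF.union (hR.image ρ))
    subset_union_left _ e (sameGalois_aut ρ hρF e) (SameGalois.refl F e) h1 (hfree _ hρR))
  refine (Universe.sameType_iff hFE).2 (sameGalois_append.2 ⟨κ.comp ρ, ?_,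
    fun i => ?_, fun i => ?_⟩)
  · rw [hfix]
    intro y hy
    rw [FirstOrder.Language.Equiv.comp_apply, hρF y hy, hκ y (Or.inl hy)]
  · rw [Subsingleton.elim i 0]
    exact hα _ hκe
  · rw [act_comp, hρb i, ← hρb i]
    refine act_eq_of_mem_eqSet (A := ρ '' R) (fun y hy => hκ y (Or.inr hy)) ?_
    rw [← image_eqSet (cl := cl)]
    exact mem_image_of_mem _ (hbR (mem_range_self i))

/-- Upper bound for the U-rank of an imaginary that is fixed by all automorphisms over `e`. -/
theorem ImagSystem.le_of_uGe (hM : IsMonster L cl δ) {n : ℕ} {e : Fin n → M} {α : 𝓔.Meq}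
    (hα : ∀ g : M ≃[L] M, (∀ i, g (e i) = e i) → (𝓔.eqUniverse cl).act g α = α) {k : ℕ}
    {A : Set M} (hA : (monster L cl).IsModel A)
    (h : (𝓔.eqUniverse cl).UGe ![α] k (𝓔.eqSet A)) : k ≤ rk cl A (range e) := by
  have hcl := hM.quasiminimal.pregeometry
  induction k generalizing A with
  | zero => exact Nat.zero_le _
  | succ k ih =>
    obtain ⟨_, ⟨B, hB, rfl⟩, hAB, hns, hk⟩ := h
    replace hAB := subset_of_eqSet_subset hAB
    have h1 := ih hB hk
    have h2 := rk_anti' hcl hAB (finite_range e)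
    have h3 : rk cl B (range e) ≠ rk cl A (range e) :=
      fun h => hns (indepNS_of_rk_eq hM hA hB hAB h hα)
    omega

theorem Universe.U_empty {X : Type u} {S : Universe.{u, w} X} {n : ℕ} (a : Fin n → X) :
    S.U a ∅ = S.UFin a ∅ :=
  le_antisymm (iInf_le_of_le ∅ (iInf₂_le le_rfl finite_empty))
    (le_iInf fun B => le_iInf₂ fun hB _ => by rw [subset_empty_iff.1 hB])

theorem Universe.le_U_empty {X : Type u} {S : Universe.{u, w} X} {n : ℕ} {a : Fin n → X} {k : ℕ}
    {A : Set X} (hA : S.IsModel A) (h : S.UGe a k A) : (k : ℕ∞) ≤ S.U a ∅ := by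
  rw [U_empty]
  exact le_iSup_of_le A (le_iSup_of_le hA (le_iSup_of_le (empty_subset A)
    (le_iSup₂ (f := fun (k : ℕ) (_ : S.UGe a k A) => (k : ℕ∞)) k h)))

theorem Universe.U_empty_le {X : Type u} {S : Universe.{u, w} X} {n : ℕ} {a : Fin n → X} {r : ℕ∞}
    (h : ∀ (A : Set X) (k : ℕ), S.IsModel A → S.UGe a k A → (k : ℕ∞) ≤ r) : S.U a ∅ ≤ r := by
  rw [U_empty]
  exact iSup_le fun A => iSup_le fun hA => iSup_le fun _ => iSup₂_le fun k hk => h A k hA hk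

theorem ImagSystem.U_le_rk (hM : IsMonster L cl δ) {n : ℕ} {e : Fin n → M} {α : 𝓔.Meq}
    (hα : ∀ g : M ≃[L] M, (∀ i, g (e i) = e i) → (𝓔.eqUniverse cl).act g α = α) :
    (𝓔.eqUniverse cl).U ![α] ∅ ≤ rk cl ∅ (range e) := by
  refine Universe.U_empty_le ?_
  rintro _ k ⟨A, hA, rfl⟩ hk
  exact_mod_cast (le_of_uGe hM hα hA hk).trans
    (rk_anti' hM.quasiminimal.pregeometry (empty_subset A) (finite_range e))

/-- If the type of `α` over `ℬ^eq` does not split over a finite subset of `𝒜^eq`, then a dimension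
of conjugates of `A` under the stabilizer of `α` which is attained over each finite subset of `𝒜`
is attained over each finite subset of `ℬ`. -/
theorem ImagSystem.exists_rk_of_indepNS (hM : IsMonster L cl δ) {𝒜 ℬ : Set M}
    (h𝒜 : (monster L cl).IsModel 𝒜) {A : Set M} (hA : A.Finite) {α : 𝓔.Meq}
    (hind : (𝓔.eqUniverse cl).IndepNS ![α] (𝓔.eqSet 𝒜) (𝓔.eqSet ℬ)) {k : ℕ}
    (hk : ∀ F ⊆ 𝒜, F.Finite → ∃ g : M ≃[L] M, (𝓔.eqUniverse cl).act g α = α ∧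
      k ≤ rk cl F (g '' A)) {F : Set M} (hFℬ : F ⊆ ℬ) (hF : F.Finite) :
    ∃ g : M ≃[L] M, (𝓔.eqUniverse cl).act g α = α ∧ k ≤ rk cl F (g '' A) := by
  obtain ⟨A₀, hA₀, hA₀f, hns⟩ := hind
  obtain ⟨R, hR𝒜, hR, hA₀R⟩ := exists_finite_reps hA₀f hA₀
  obtain ⟨σ, hσ, hσF⟩ := exists_aut_subset_model' hM h𝒜 hR hR𝒜 hF
  obtain ⟨m, f, rfl⟩ := exists_fin_range hF
  rw [← range_aut] at hσF
  by_contra hcon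
  refine hns ⟨m, fun i => 𝓔.emb (f i), fun i => 𝓔.emb (σ (f i)), ?_, ?_,
    (Universe.sameType_iff hA₀f).2 (sameGalois_iff.2
      ⟨σ, fun y hy => act_eq_of_mem_eqSet hσ (hA₀R hy), fun i => act_emb cl σ (f i)⟩),
    fun h => hcon ?_⟩
  · rintro _ ⟨i, rfl⟩
    exact Or.inr (emb_mem.2 (hFℬ (mem_range_self i)))
  · rintro _ ⟨i, rfl⟩
    exact Or.inl (emb_mem.2 (hσF (mem_range_self i)))
  · obtain ⟨ρ, -, hρα, hρf⟩ := sameGalois_append.1 ((Universe.sameType_iff hA₀f).1 h)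
    have hρα' : (𝓔.eqUniverse cl).act ρ α = α := hρα 0
    have hρf' : ∀ i, ρ (f i) = σ (f i) := fun i => emb_injective (by rw [← act_emb cl, hρf i])
    obtain ⟨g, hg, hgk⟩ := hk _ hσF (finite_range _)
    refine ⟨ρ.symm.comp g, ?_, ?_⟩
    · rw [act_comp, hg, ← hρα', act_symm_act, hρα']
    · refine hgk.trans_eq ?_
      rw [← rk_image hM.quasiminimal ρ (range f) (hA.image _), ← range_aut, funext hρf',
        ← image_comp]
      congr 1
      refine image_congr fun y _ => ?_
      rw [Function.comp_apply, FirstOrder.Language.Equiv.comp_apply, ρ.apply_symm_apply]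

/-- Lower bound for the U-rank of `α` over `𝒜^eq`. The model `𝒜` is enlarged, one element of `l` at
a time, until it contains `A`. The dimension that conjugates of `A` under the stabilizer of `α`
attain over all finite subsets of the model, being at most `m` in the end, drops `j` times, each
time by one; by `ImagSystem.exists_rk_of_indepNS` such a drop is a dependence. -/
theorem ImagSystem.uGe_of_exists_rk (hM : IsMonster L cl δ) {A : Set M} (hA : A.Finite)
    {α : 𝓔.Meq} {m : ℕ}
    (hm : ∀ g : M ≃[L] M, (𝓔.eqUniverse cl).act g α = α → rk cl A (g '' A) ≤ m) {l : Set M}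
    (hl : l.Finite) {j : ℕ} {𝒜 : Set M} (h𝒜 : (monster L cl).IsModel 𝒜) (hA𝒜 : A ⊆ cl (𝒜 ∪ l))
    (hk : ∀ F ⊆ 𝒜, F.Finite → ∃ g : M ≃[L] M, (𝓔.eqUniverse cl).act g α = α ∧
      m + j ≤ rk cl F (g '' A)) : (𝓔.eqUniverse cl).UGe ![α] j (𝓔.eqSet 𝒜) := by
  have hcl := hM.quasiminimal.pregeometry
  induction l, hl using Set.Finite.induction_on generalizing j 𝒜 with
  | empty =>
    rw [union_empty, h𝒜.1] at hA𝒜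
    obtain ⟨g, hg, hgk⟩ := hk A hA𝒜 hA
    obtain rfl : j = 0 := by have := hm g hg; omega
    trivial
  | @insert x l _ _ ih =>
    have hsub : insert x 𝒜 ⊆ cl (insert x 𝒜) := subset_cl cl _
    have h𝒜ℬ : 𝒜 ⊆ cl (insert x 𝒜) := (subset_insert _ _).trans hsub
    have hℬ := isModel_cl_insert h𝒜 x
    have hAℬ : A ⊆ cl (cl (insert x 𝒜) ∪ l) := hA𝒜.trans (cl_mono cl (by
      rw [union_insert, ← insert_union]
      exact union_subset_union_left l hsub))
    by_cases hind : (𝓔.eqUniverse cl).IndepNS ![α] (𝓔.eqSet 𝒜) (𝓔.eqSet (cl (insert x 𝒜)))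
    · exact Universe.UGe.mono (eqSet_mono h𝒜ℬ) (ih hℬ hAℬ fun F hF hFf =>
        exists_rk_of_indepNS hM h𝒜 hA hind hk hF hFf)
    · cases j with
      | zero => trivial
      | succ j =>
        refine ⟨_, ⟨_, hℬ, rfl⟩, eqSet_mono h𝒜ℬ, hind, ih hℬ hAℬ fun F hF hFf => ?_⟩
        -- a single element lowers dimensions by at most one
        obtain ⟨F', hF', hF'f, hr⟩ := exists_finite_rk_eq hcl (insert x 𝒜) hFf
        obtain ⟨g, hg, hgk⟩ := hk (F' ∩ 𝒜) inter_subset_right (hF'f.inter_of_left _)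
        refine ⟨g, hg, ?_⟩
        have h0 : F ⊆ cl F' := (rk_eq_zero_iff hcl hFf).1
          (hr.trans ((rk_eq_zero_iff hcl hFf).2 hF))
        have h1 : F ⊆ cl (F' ∩ 𝒜 ∪ {x}) := h0.trans (cl_mono cl fun y hy => by
          rcases hF' hy with rfl | h
          · exact Or.inr rfl
          · exact Or.inl ⟨hy, h⟩)
        have h2 := rk_anti hcl ((cl_subset_iff cl).2 h1) (hA.image g)
        have h3 := rk_symm hcl (F' ∩ 𝒜) (finite_singleton x) (hA.image g)
        have h4 := rk_le_ncard hcl (F' ∩ 𝒜) (finite_singleton x)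
        rw [ncard_singleton] at h4
        omega

/-- The U-rank of an imaginary `α` is at least the codimension
of the orbit of `A` under the stabilizer of `α`. -/
theorem ImagSystem.le_U (hM : IsMonster L cl δ) {A : Set M} (hA : A.Finite) {α : 𝓔.Meq} {m j : ℕ}
    (hm : ∀ g : M ≃[L] M, (𝓔.eqUniverse cl).act g α = α → rk cl A (g '' A) ≤ m)
    (hmj : m + j ≤ rk cl ∅ A) : (j : ℕ∞) ≤ (𝓔.eqUniverse cl).U ![α] ∅ := by
  obtain ⟨𝒜, -, -, h𝒜, hr⟩ := exists_free_model hM finite_empty hA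
  refine Universe.le_U_empty ⟨𝒜, h𝒜, rfl⟩ (uGe_of_exists_rk hM hA hm hA h𝒜
    (subset_union_right.trans (subset_cl cl _)) fun F hF _ =>
      ⟨FirstOrder.Language.Equiv.refl L M, ?_, ?_⟩)
  · exact act_eq_of_mem_eqSet (A := univ) (by simp) (by
      obtain ⟨n, E, a, rfl⟩ := 𝓔.exists_cls α
      exact ⟨n, E, a, subset_univ _, rfl⟩)
  · rw [image_eq_self (by simp)]
    exact hmj.trans (hr ▸ rk_anti' hM.quasiminimal.pregeometry hF hA)

/-- The U-rank of an imaginary over `∅` depends only on the conjugacy class of its stabilizer. -/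
theorem ImagSystem.U_le_of_conj (hq : IsQuasiminimal L cl) {α β : 𝓔.Meq} (g : M ≃[L] M)
    (h : ∀ k : M ≃[L] M, (𝓔.eqUniverse cl).act k α = α ↔
      (𝓔.eqUniverse cl).act ((g.comp k).comp g.symm) β = β) :
    (𝓔.eqUniverse cl).U ![α] ∅ ≤ (𝓔.eqUniverse cl).U ![β] ∅ := by
  -- conjugation by `g` preserves the relations that define the U-rank
  have hG : ∀ (A : Set 𝓔.Meq) {n : ℕ} (b c : Fin n → 𝓔.Meq), (𝓔.eqUniverse cl).SameGalois A b c →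
      (𝓔.eqUniverse cl).SameGalois ((𝓔.eqUniverse cl).act g '' A)
        (fun i => (𝓔.eqUniverse cl).act g (b i)) (fun i => (𝓔.eqUniverse cl).act g (c i)) := by
    intro A n b c hbc
    obtain ⟨k, hk, hbc⟩ := sameGalois_iff.1 hbc
    refine sameGalois_iff.2 ⟨(g.comp k).comp g.symm, ?_, fun i => ?_⟩
    · rintro _ ⟨y, hy, rfl⟩
      rw [act_comp, act_comp, act_symm_act]
      exact congrArg _ (hk y hy)
    · rw [act_comp, act_comp, act_symm_act]
      exact congrArg _ (hbc i)
  have hsp : ∀ B A : Set 𝓔.Meq, A.Finite → (𝓔.eqUniverse cl).Splits ![α] B A →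
      (𝓔.eqUniverse cl).Splits ![β] ((𝓔.eqUniverse cl).act g '' B)
        ((𝓔.eqUniverse cl).act g '' A) := by
    rintro B A hA ⟨m, b, c, hb, hc, hbc, hns⟩
    have hgA := hA.image ((𝓔.eqUniverse cl).act g)
    refine ⟨m, fun i => (𝓔.eqUniverse cl).act g (b i),
      fun i => (𝓔.eqUniverse cl).act g (c i), ?_, ?_,
      (Universe.sameType_iff hgA).2 (hG A b c ((Universe.sameType_iff hA).1 hbc)),
      fun hcon => hns ((Universe.sameType_iff hA).2 ?_)⟩
    · rintro _ ⟨i, rfl⟩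
      exact mem_image_of_mem _ (hb (mem_range_self i))
    · rintro _ ⟨i, rfl⟩
      exact mem_image_of_mem _ (hc (mem_range_self i))
    · obtain ⟨k, hkA, hkβ, hkb⟩ := sameGalois_append.1 ((Universe.sameType_iff hgA).1 hcon)
      have hk : ∀ x y : 𝓔.Meq,
          (𝓔.eqUniverse cl).act k ((𝓔.eqUniverse cl).act g x) = (𝓔.eqUniverse cl).act g y →
              (𝓔.eqUniverse cl).act ((g.symm.comp k).comp g) x = y := fun x y hxy => by
        rw [act_comp, act_comp]
        exact (congrArg _ hxy).trans (act_symm_act cl g y)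
      refine sameGalois_append.2 ⟨(g.symm.comp k).comp g,
        fun y hy => hk y y (hkA _ (mem_image_of_mem _ hy)), fun i => ?_, fun i => hk _ _ (hkb i)⟩
      rw [Subsingleton.elim i 0]
      refine (h _).2 ?_
      have h1 : (g.comp ((g.symm.comp k).comp g)).comp g.symm = k := by ext x; simp
      rw [h1]
      exact hkβ 0
  have hU : ∀ (j : ℕ) (A : Set 𝓔.Meq), (𝓔.eqUniverse cl).UGe ![α] j A →
      (𝓔.eqUniverse cl).UGe ![β] j ((𝓔.eqUniverse cl).act g '' A) := by
    intro j
    induction j with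
    | zero => exact fun _ _ => trivial
    | succ j ih =>
      rintro A ⟨_, ⟨B, hB, rfl⟩, hAB, hns, hj⟩
      refine ⟨(𝓔.eqUniverse cl).act g '' 𝓔.eqSet B, ?_, image_mono hAB, ?_, ih _ hj⟩
      · exact ⟨_, isModel_image hq g hB, image_eqSet g B⟩
      · rintro ⟨F, hFA, hF, hFs⟩
        have hF' : (𝓔.eqUniverse cl).act g '' ((𝓔.eqUniverse cl).act g.symm '' F) = F := by
          rw [← image_comp]
          exact (image_congr fun x _ => act_act_symm cl g x).trans (image_id' F)
        refine hns ⟨(𝓔.eqUniverse cl).act g.symm '' F, ?_, hF.image _, fun hs => hFs ?_⟩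
        · rintro _ ⟨y, hy, rfl⟩
          obtain ⟨z, hz, rfl⟩ := hFA hy
          rw [act_symm_act]
          exact hz
        · have := hsp _ _ (hF.image _) hs
          rw [hF', image_union] at this
          exact this
  refine Universe.U_empty_le ?_
  rintro _ k ⟨A, hA, rfl⟩ hk
  refine Universe.le_U_empty (A := (𝓔.eqUniverse cl).act g '' 𝓔.eqSet A) ?_ (hU _ _ hk)
  exact ⟨_, isModel_image hq g hA, image_eqSet g A⟩

theorem ImagSystem.U_eq_of_conj (hq : IsQuasiminimal L cl) {α β : 𝓔.Meq} (g : M ≃[L] M)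
    (h : ∀ k : M ≃[L] M, (𝓔.eqUniverse cl).act k α = α ↔
      (𝓔.eqUniverse cl).act ((g.comp k).comp g.symm) β = β) :
    (𝓔.eqUniverse cl).U ![α] ∅ = (𝓔.eqUniverse cl).U ![β] ∅ := by
  refine le_antisymm (U_le_of_conj hq g h) (U_le_of_conj hq g.symm fun k => ?_)
  rw [h]
  have h1 : (g.comp ((g.symm.comp k).comp g.symm.symm)).comp g.symm = k := by ext x; simp
  rw [h1]

end Imaginaries

/-! ### The family of plane curves given by a generic tuple -/

section Family

variable {L : FirstOrder.Language.{v, w}} {M : Type u} [L.Structure M]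
variable {cl : ClosureOperator (Set M)} {δ : Cardinal.{u}}

theorem Stationary.image (hq : IsQuasiminimal L cl) (g : M ≃[L] M) {A : Set M} {n : ℕ}
    {c : Fin n → M} (h : Stationary L cl A c) : Stationary L cl (g '' A) fun i => g (c i) := by
  intro D hD hAD x y hx hy hxr hyr
  have hsymm : ∀ z : Fin n → M, (monster L cl).SameGalois (g '' A) z (fun i => g (c i)) →
      (monster L cl).SameGalois A (fun i => g.symm (z i)) c := fun z hz => by
    have := SameGalois.map g.symm hz
    rw [image_symm_image] at this
    simpa only [g.symm_apply_apply] using this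
  have hr : ∀ z : Fin n → M, rk cl D (range z) = rk cl (g '' A) (range fun i => g (c i)) →
      rk cl (g.symm '' D) (range fun i => g.symm (z i)) = rk cl A (range c) := fun z hz => by
    rw [range_aut, rk_image hq g.symm D (finite_range z), hz, range_aut,
      rk_image hq g A (finite_range c)]
  have h1 := h (g.symm '' D) (hD.image _) (by
    rw [← image_symm_image g A]; exact image_mono hAD) _ _ (hsymm x hx) (hsymm y hy)
    (hr x hxr) (hr y hyr)
  have h2 := SameGalois.map g h1
  rw [image_image_symm] at h2
  simpa only [g.apply_symm_apply] using h2

/-- Elements outside the closure of a finite set are outside its bounded closure. -/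
theorem notMem_bcl (hM : IsMonster L cl δ) {A : Set M} (hA : A.Finite) {x : M} (hx : x ∉ cl A) :
    x ∉ (monster L cl).bcl δ A := by
  intro h
  obtain ⟨y, hy⟩ := exists_notMem_cl hM (mk_union_lt hM
    (show #{c : M | (monster L cl).SameType A ![x] ![c]} < δ from h)
    (mk_lt_of_countable hM hA.countable))
  refine hy (subset_cl cl _ (Or.inl ((sameType_iff hA).2
    (sameGalois_singleton hM hA.countable hx fun hyA => hy (cl_mono cl subset_union_right hyA)))))

theorem range_append {α : Type*} {m n : ℕ} (a : Fin m → α) (b : Fin n → α) :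
    range (Fin.append a b) = range a ∪ range b := by
  ext x
  constructor
  · rintro ⟨i, rfl⟩
    refine Fin.addCases (fun i => ?_) (fun i => ?_) i
    · rw [Fin.append_left]
      exact Or.inl (mem_range_self i)
    · rw [Fin.append_right]
      exact Or.inr (mem_range_self i)
  · rintro (⟨i, rfl⟩ | ⟨i, rfl⟩)
    · exact ⟨Fin.castAdd n i, Fin.append_left _ _ i⟩
    · exact ⟨Fin.natAdd m i, Fin.append_right _ _ i⟩

theorem range_pair {α : Type*} (a b : α) : range ![a, b] = {a, b} := by
  rw [Matrix.range_cons, Matrix.range_cons, Matrix.range_empty, union_empty, singleton_union]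

theorem append_comp_finAddFlip {α : Type*} {m n : ℕ} (a : Fin m → α) (b : Fin n → α) :
    Fin.append b a ∘ finAddFlip = Fin.append a b := by
  funext i
  refine Fin.addCases (fun i => ?_) (fun i => ?_) i
  · simp
  · simp

variable {𝒞 : ∀ n : ℕ, Set (Set (Fin n → M))}

theorem IsZariskiLike.perm_mem (hZ : IsZariskiLike L cl δ 𝒞) {m n : ℕ} (τ : Fin m ≃ Fin n)
    {C : Set (Fin m → M)} (hC : C ∈ 𝒞 m) : {a : Fin n → M | a ∘ τ ∈ C} ∈ 𝒞 n := by
  obtain rfl : m = n := by simpa using Fintype.card_congr τ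
  convert hZ.zl6 m C hC τ.symm using 1
  ext a
  constructor
  · exact fun h => ⟨_, h, by ext i; simp⟩
  · rintro ⟨a, ha, rfl⟩
    have : (a ∘ τ.symm) ∘ τ = a := by ext i; simp
    rwa [mem_ofPred_eq, this]

theorem IsZariskiLike.aut_mem (hZ : IsZariskiLike L cl δ 𝒞) {n : ℕ} {C : Set (Fin n → M)}
    (hC : C ∈ 𝒞 n) (g : M ≃[L] M) {a : Fin n → M} (ha : a ∈ C) : (fun i => g (a i)) ∈ C :=
  (hZ.zl1 n C hC g).le (mem_image_of_mem _ ha)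

/-- `e` is generic in `E`, and `(q, e)` is generic in `C`, with `q` of dimension one over `e`: then
`C` is a family of plane curves parametrized by `E`. -/
structure IsGenericCurve (L : FirstOrder.Language.{v, w}) [L.Structure M]
    (cl : ClosureOperator (Set M)) (𝒞 : ∀ n : ℕ, Set (Set (Fin n → M))) {n : ℕ}
    (E : Set (Fin n → M)) (C : Set (Fin (2 + n) → M)) (e : Fin n → M) (q : Fin 2 → M) : Prop where
  base_mem : E ∈ 𝒞 n
  mem : C ∈ 𝒞 (2 + n)
  base_generic : (monster L cl).IsGeneric E ∅ e
  generic : (monster L cl).IsGeneric C ∅ (Fin.append q e)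
  rk_eq_one : rk cl (range e) (range q) = 1

namespace IsGenericCurve

variable {n : ℕ} {E : Set (Fin n → M)} {C : Set (Fin (2 + n) → M)} {e : Fin n → M}
  {q : Fin 2 → M}

theorem exists_aut_base (hM : IsMonster L cl δ) (hZ : IsZariskiLike L cl δ 𝒞)
    (h : IsGenericCurve L cl 𝒞 E C e q) {e' : Fin n → M}
    (he' : (monster L cl).IsGeneric E ∅ e') :
    ∃ g : M ≃[L] M, (fun i => g (e i)) = e' ∧ (monster L cl).IsGeneric C ∅
      (Fin.append (fun i => g (q i)) e') := by
  obtain ⟨g, -, hg⟩ := sameGalois_iff.1 (hZ.zl3 n E h.base_mem e e' h.base_generic he')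
  obtain rfl : (fun i => g (e i)) = e' := funext hg
  refine ⟨g, rfl, ?_⟩
  have hgen := (isGeneric_iff hM finite_empty).1 h.generic
  have happ : Fin.append (fun i => g (q i)) (fun i => g (e i)) =
      fun i => g (Fin.append q e i) := by
    funext i
    refine Fin.addCases (fun i => ?_) (fun i => ?_) i <;> simp
  rw [isGeneric_iff hM finite_empty, happ]
  refine ⟨hZ.aut_mem h.mem g hgen.1, fun c hc => (hgen.2 c hc).trans_eq ?_⟩
  rw [range_aut, ← rk_image hM.quasiminimal g ∅ (finite_range _), image_empty]

theorem subset (hM : IsMonster L cl δ) (hZ : IsZariskiLike L cl δ 𝒞)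
    (h : IsGenericCurve L cl 𝒞 E C e q) {q' : Fin 2 → M} {e' : Fin n → M}
    (hqe : Fin.append q' e' ∈ C) : e' ∈ E := by
  have hgen := (isGeneric_iff hM finite_empty).1 h.generic
  refine hZ.zl5 n 2 _ (hZ.perm_mem finAddFlip h.mem) E h.base_mem e e' q q' ?_ h.base_generic
    (by rwa [mem_ofPred_eq, append_comp_finAddFlip])
  rw [isGeneric_iff hM finite_empty]
  refine ⟨by rw [mem_ofPred_eq, append_comp_finAddFlip]; exact hgen.1, fun c hc => ?_⟩
  have := hgen.2 _ hc
  rwa [range_append, union_comm, ← range_append, EquivLike.range_comp] at this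

theorem rk_le_one (hM : IsMonster L cl δ)
    (h : IsGenericCurve L cl 𝒞 E C e q) {q' : Fin 2 → M} {e' : Fin n → M}
    (he' : (monster L cl).IsGeneric E ∅ e') (hqe : Fin.append q' e' ∈ C) :
    rk cl (range e') (range q') ≤ 1 := by
  have hq := hM.quasiminimal
  have hcl := hq.pregeometry
  have h1 := ((isGeneric_iff hM finite_empty).1 h.generic).2 _ hqe
  rw [range_append, range_append, union_comm, union_comm (range q),
    rk_union hcl ∅ (finite_range _) (finite_range _),
    rk_union hcl ∅ (finite_range _) (finite_range _), empty_union, empty_union, h.rk_eq_one] at h1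
  have h2 := ((isGeneric_iff hM finite_empty).1 he').2 _ h.base_generic.1
  omega

theorem generic_fiber (hM : IsMonster L cl δ)
    (h : IsGenericCurve L cl 𝒞 E C e q) :
    (monster L cl).IsGeneric (fiber C e) (range e) q :=
  (isGeneric_iff hM (finite_range e)).2
    ⟨h.generic.1, fun _ hc => (h.rk_le_one hM h.base_generic hc).trans h.rk_eq_one.ge⟩

/-- All generic curves of the family are conjugate. -/
theorem exists_aut (hM : IsMonster L cl δ) (hZ : IsZariskiLike L cl δ 𝒞)
    (h : IsGenericCurve L cl 𝒞 E C e q) {q' : Fin 2 → M} {e' : Fin n → M}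
    (he' : (monster L cl).IsGeneric E ∅ e')
    (hq' : (monster L cl).IsGeneric (fiber C e') (range e') q') :
    ∃ g : M ≃[L] M, (fun i => g (q i)) = q' ∧ (fun i => g (e i)) = e' := by
  have hq := hM.quasiminimal
  have hcl := hq.pregeometry
  obtain ⟨k, hk, hgen⟩ := h.exists_aut_base hM hZ he'
  rw [isGeneric_iff hM (finite_range e')] at hq'
  have h1 := hq'.2 (fun i => k (q i)) hgen.1
  suffices (monster L cl).IsGeneric C ∅ (Fin.append q' e') by
    obtain ⟨g, -, hgq, hge⟩ := sameGalois_append.1 (hZ.zl3 _ C h.mem _ _ h.generic this)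
    exact ⟨g, funext hgq, funext hge⟩
  rw [isGeneric_iff hM finite_empty] at hgen ⊢
  refine ⟨hq'.1, fun c hc => (hgen.2 c hc).trans ?_⟩
  rw [range_append, range_append, union_comm, union_comm (range q'),
    rk_union hcl ∅ (finite_range _) (finite_range _),
    rk_union hcl ∅ (finite_range _) (finite_range _), empty_union]
  omega

theorem isFamily (hM : IsMonster L cl δ) (hZ : IsZariskiLike L cl δ 𝒞)
    (h : IsGenericCurve L cl 𝒞 E C e q) : IsFamily L cl 𝒞 E C where
  irreducible_base := h.base_mem
  irreducible := h.mem
  subset q' e' hqe := h.subset hM hZ hqe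
  exists_generic := ⟨e, h.base_generic⟩
  good e' he' := by
    obtain ⟨g, -, hg⟩ := h.exists_aut_base hM hZ he'
    exact ⟨_, hg⟩
  curve e' he' q' hq' := by
    obtain ⟨g, rfl, rfl⟩ := h.exists_aut hM hZ he' hq'
    rw [U_eq hM _ (finite_range _), range_aut, range_aut,
      rk_image hM.quasiminimal g _ (finite_range q), h.rk_eq_one, Nat.cast_one]

theorem isRelevant (hM : IsMonster L cl δ) (hZ : IsZariskiLike L cl δ 𝒞)
    (h : IsGenericCurve L cl 𝒞 E C e q) (h0 : ∀ i, q i ∉ cl (range e)) :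
    IsRelevant L cl δ E C := by
  intro e' he' q' hq'
  obtain ⟨g, rfl, rfl⟩ := h.exists_aut hM hZ he' hq'
  have key : ∀ i, g (q i) ∉ (monster L cl).bcl δ (range fun i => g (e i)) := fun i =>
    notMem_bcl hM (finite_range _) (by
      rw [range_aut, mem_cl_image_iff hM.quasiminimal]
      exact h0 i)
  exact ⟨key 0, key 1⟩

variable {𝓔 : ImagSystem L M}

/-- The class of `e` under the relation coding the free extension is a canonical base. -/
theorem exists_isCb (hM : IsMonster L cl δ) (h𝓔 : 𝓔.CodesTypes cl δ)
    (hst : Stationary L cl (range e) q) : ∃ α : 𝓔.Meq,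
      ∀ g : M ≃[L] M, (monster L cl).FixesType g (freeType L cl (range e) q) ↔
        (𝓔.eqUniverse cl).act g α = α := by
  have he := finite_range e
  have hns := freeType_nonSplitOver hM hst
  refine ⟨𝓔.cls ⟨_, h𝓔 2 n _ q (range e) e he (freeType_isFreeExt hM he hst) hns⟩ e,
    fun g => ?_⟩
  rw [ImagSystem.act_cls, ImagSystem.cls_eq_cls]
  exact (codeRel_iff_fixesType (freeType_isGlobalType hM he hst) hns g).symm

theorem hasRank (hM : IsMonster L cl δ) (hZ : IsZariskiLike L cl δ 𝒞)
    (h : IsGenericCurve L cl 𝒞 E C e q) (hst : Stationary L cl (range e) q) {α : 𝓔.Meq}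
    (hα : ∀ g : M ≃[L] M, (monster L cl).FixesType g (freeType L cl (range e) q) ↔
      (𝓔.eqUniverse cl).act g α = α) {r : ℕ} (hr : (𝓔.eqUniverse cl).U ![α] ∅ = r) :
    HasRank cl δ 𝓔 E C r := by
  have hq := hM.quasiminimal
  refine ⟨⟨e, q, α, h.base_generic, h.generic_fiber hM, _,
    freeType_isFreeExt hM (finite_range e) hst, hα⟩, ?_⟩
  rintro e' q' β he' hq' ⟨p, hp, hβ⟩
  obtain ⟨g, rfl, rfl⟩ := h.exists_aut hM hZ he' hq'
  rw [← hr]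
  refine (ImagSystem.U_eq_of_conj hq g fun k => ?_).symm
  rw [range_aut] at hp
  have hfix := IsFreeExt.fixesType_iff hM ((finite_range e).image g) (hst.image hq g)
    (by rw [range_aut, rk_image hq g _ (finite_range q), h.rk_eq_one]) hp
  rw [← hβ, ← hα, hfix]
  refine ⟨FixesType.conj hq g, fun hk => ?_⟩
  have h1 := FixesType.conj hq g.symm hk
  have h2 : (g.symm.comp ((g.comp k).comp g.symm)).comp g.symm.symm = k := by ext x; simp
  simpa only [h2, image_symm_image, g.symm_apply_apply] using h1

end IsGenericCurve

theorem isStabilizer_freeType (hM : IsMonster L cl δ) {A : Set M} (hA : A.Finite) {n : ℕ}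
    {c : Fin n → M} (hst : Stationary L cl A c) (hc : rk cl A (range c) = 1) :
    IsStabilizer cl A (range c)
      {g : M ≃[L] M | (monster L cl).FixesType g (freeType L cl A c)} where
  of_fixes _ hg := fixesType_freeType_of_fixes hM.quasiminimal hg
  comp _ hk _ hg := FixesType.comp hg hk
  symm _ hg := FixesType.symm (freeType_isGlobalType hM hA hst) hg
  free _ hk _ hh hr := (rk_eq_of_fixesType hM hA hst hk hh (hr.trans hc.symm)).trans hc

/-- If local modularity fails, this is witnessed by a stationary plane curve `{a, b}`: the finite
set of parameters can be enlarged inside a model which is free from `{a, b}`. -/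
theorem exists_stationary_of_not_locallyModular (hM : IsMonster L cl δ)
    (h : ¬ LocallyModular cl) : ∃ (A : Set M) (a b p : M), A.Finite ∧
      Stationary L cl A ![a, b] ∧ p ∉ cl ∅ ∧ p ∈ A ∧ a ∉ cl A ∧ b ∉ cl A ∧
        a ∈ cl (insert b A) ∧ ∀ d ∈ cl A, a ∉ cl {b, d, p} := by
  have hcl := hM.quasiminimal.pregeometry
  obtain ⟨p, e, a, b, hp, he, hpe, ha, hb, hab, hd⟩ := exists_of_not_locallyModular hcl h
  have hC : ({a, b} : Set M).Finite := (finite_singleton b).insert a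
  have hrange : range ![a, b] = {a, b} := range_pair a b
  obtain ⟨N, heN, -, hN, hr⟩ := exists_free_model hM he hC
  have hr1 : rk cl e {a, b} = 1 := by
    rw [rk_insert_of_mem hcl (by rwa [union_singleton]), rk_singleton_of_notMem hcl hb]
  have hba : b ∈ cl (insert a e) := hcl.exchange e a b hab ha
  obtain ⟨A, hA, heA, hAN, hst⟩ := exists_stationary hM ![a, b] hN he heN (by rw [hrange, hr])
  have hclN : ∀ x ∈ N, cl (insert x e) ⊆ N := fun x hx => by
    rw [← hN.1]
    exact cl_mono cl (insert_subset hx heN)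
  have hne : ¬ ({a, b} : Set M) ⊆ cl N := fun hsub => by
    rw [(rk_eq_zero_iff hcl hC).2 hsub] at hr
    omega
  have hAcl : cl A ⊆ N := by
    rw [← hN.1]
    exact cl_mono cl hAN
  have hbN : b ∉ N := fun hbN => hne (by
    rw [hN.1]
    exact insert_subset (hclN b hbN hab) (singleton_subset_iff.2 hbN))
  have haN : a ∉ N := fun haN => hbN (hclN a haN hba)
  refine ⟨A, a, b, p, hA, hst, hp, heA hpe, fun h => haN (hAcl h), fun h => hbN (hAcl h),
    cl_mono cl (insert_subset_insert heA) hab, fun d hdA had => ?_⟩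
  -- by exchange, such a `d` would lie in the closure of the original parameters
  have hap : a ∉ cl {b, p} := fun h' => hd p (subset_cl cl e hpe) (by rwa [pair_eq_singleton])
  rw [insert_comm] at had
  have hde : d ∈ cl (insert b e) := (cl_subset_iff cl).2
    (insert_subset hab (insert_subset (subset_cl cl _ (mem_insert _ _))
      (singleton_subset_iff.2 (subset_cl cl _ (Or.inr hpe)))))
    (hcl.exchange _ _ _ had hap)
  by_cases hdcl : d ∈ cl e
  · exact hd d hdcl (by rwa [insert_comm])
  · exact hbN (hAcl ((cl_subset_iff cl).2 (insert_subset hdA (heA.trans (subset_cl cl A)))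
      (hcl.exchange e d b hde hdcl)))

theorem exists_family_of_not_locallyModular (hM : IsMonster L cl δ)
    (hZ : IsZariskiLike L cl δ 𝒞) {𝓔 : ImagSystem L M} (h𝓔 : 𝓔.CodesTypes cl δ)
    (hLM : ¬ LocallyModular cl) :
    ∃ (n : ℕ) (E : Set (Fin n → M)) (C : Set (Fin (2 + n) → M)) (r : ℕ),
      IsFamily L cl 𝒞 E C ∧ IsRelevant L cl δ E C ∧ HasRank cl δ 𝓔 E C r ∧ 2 ≤ r := by
  have hq := hM.quasiminimal
  have hcl := hq.pregeometry
  obtain ⟨A, a, b, p, hA, hst, hp, hpA, ha, hb, hab, hd⟩ :=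
    exists_stationary_of_not_locallyModular hM hLM
  obtain ⟨n, e, rfl⟩ := exists_fin_range hA
  have hrange : range ![a, b] = {a, b} := range_pair a b
  have hr1 : rk cl (range e) (range ![a, b]) = 1 := by
    rw [hrange, rk_insert_of_mem hcl (by rwa [union_singleton]), rk_singleton_of_notMem hcl hb]
  have hn : 0 < n := by
    obtain ⟨i, -⟩ := hpA
    exact i.pos
  -- the irreducible sets in which the parameters and the curve are generic form the family
  obtain ⟨E, hE, hEe⟩ := hZ.zl2 n hn e
  obtain ⟨C, hC, hCe⟩ := hZ.zl2 (2 + n) (by omega) (Fin.append ![a, b] e)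
  have hcurve : IsGenericCurve L cl 𝒞 E C e ![a, b] := ⟨hE, hC, hEe, hCe, hr1⟩
  obtain ⟨α, hα⟩ := IsGenericCurve.exists_isCb hM h𝓔 hst
  have hαe : ∀ g : M ≃[L] M, (∀ i, g (e i) = e i) → (𝓔.eqUniverse cl).act g α = α := fun g hg =>
    (hα g).1 (fixesType_freeType_of_fixes hq (by rintro _ ⟨i, rfl⟩; exact hg i))
  have hU := ImagSystem.U_le_rk hM hαe
  obtain ⟨r, hr⟩ := ENat.ne_top_iff_exists.1 (hU.trans_lt (ENat.natCast_lt_top _)).ne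
  have hP := isStabilizer_freeType hM hA hst hr1
  rw [hrange] at hP
  obtain ⟨m, hm, hm2⟩ := hP.exists_add_two_le hM hA hp hpA ha hb hab hd
  have h2 := ImagSystem.le_U hM hA (α := α) (fun g hg => hm g ((hα g).2 hg)) hm2
  refine ⟨n, E, C, r, hcurve.isFamily hM hZ, hcurve.isRelevant hM hZ ?_,
    hcurve.hasRank hM hZ hst hα hr.symm, ?_⟩
  · intro i
    fin_cases i
    · exact ha
    · exact hb
  · rw [← hr] at h2
    exact_mod_cast h2

end Family
end ZL

theorem mainTheorem8 (L : FirstOrder.Language.{v, w}) (M : Type u) [L.Structure M]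
    (cl : ClosureOperator (Set M)) (δ : Cardinal.{u}) (hM : ZL.IsMonster L cl δ)
    (𝒞 : ∀ n : ℕ, Set (Set (Fin n → M))) (hZ : ZL.IsZariskiLike L cl δ 𝒞)
    (𝓔 : ZL.ImagSystem L M) (h𝓔 : 𝓔.CodesTypes cl δ) :
    ((∀ (n : ℕ) (E : Set (Fin n → M)) (C : Set (Fin (2 + n) → M)),
        ZL.IsFamily L cl 𝒞 E C → ZL.IsRelevant L cl δ E C →
          ∀ r : ℕ, ZL.HasRank cl δ 𝓔 E C r → r ≤ 1) →
      ZL.LocallyModular cl) ∧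
    (¬ ZL.LocallyModular cl →
      ∃ (n : ℕ) (E : Set (Fin n → M)) (C : Set (Fin (2 + n) → M)) (r : ℕ),
        ZL.IsFamily L cl 𝒞 E C ∧ ZL.IsRelevant L cl δ E C ∧
          ZL.HasRank cl δ 𝓔 E C r ∧ 2 ≤ r) := by
  refine ⟨fun h => ?_, ZL.exists_family_of_not_locallyModular hM hZ h𝓔⟩
  by_contra hLM
  obtain ⟨n, E, C, r, hfam, hrel, hrank, hr⟩ :=
    ZL.exists_family_of_not_locallyModular hM hZ h𝓔 hLM
  exact absurd (h n E C hfam hrel r hrank) (by omega)
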